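/- For integers $k\ge 2$, $N\ge 1$ put $m=k-1$ and $$Z_k(\lambda,N)=\int d\mu^c(M)\,\exp\Bigl[-\frac{\lambda}{N^{m}}\operatorname{Tr}(MM^\dagger)^k\Bigr],\qquad F_k(\lambda,N)=N^{-2}\log Z_k(\lambda,N)\qquad(\Re\lambda>0),$$ where $d\mu^c(M)=\pi^{-N^2}e^{-\operatorname{Tr}MM^\dagger}\prod_{i,j}d\Re M_{ij}\,d\Im M_{ij}$ is the normalized Gaussian measure on complex $N\times N$ matrices. For $\rho>0$ let $D^m_\rho=\{\lambda:\Re\lambda^{-1/m}>\rho^{-1}\}$, where $\lambda$ runs over the Riemann surface of the logarithm with $|\arg\lambda|<m\pi/2$; thus $w=\lambda^{1/m}$ runs over the open disk of diameter $\rho$ in the right half-plane that is tangent to the imaginary axis at $0$. A power series $\sum_n a_n\lambda^n$ is called Borel–Le Roy summable of order $m$ in $D^m_\rho$ to a function $f$ if 1. $f$ is analytic in $D^m_\rho$, and there are constants $A,B>0$ with $$\Bigl|f(\lambda)-\sum_{n<q}a_n\lambda^n\Bigr|\le A\,B^q\,\Gamma(mq)\,|\lambda|^q\qquad\text{for all }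 q\ge 1 \text{ and } \lambda\in D^m_\rho;$$ 2. the Borel–Le Roy transform $\sum_n \frac{a_n}{\Gamma(mn+1)}u^n$ converges for $|u|<B^{-1}$ and has an analytic continuation $G$ to the union of this disk with a strip $\{|\Im u|<R,\ \Re u>0\}$ for some $R>0$, and for all $\lambda\in D^m_\rho$ $$f(\lambda)=\frac1{m\lambda}\int_0^\infty G(u)\,e^{-(u/\lambda)^{1/m}}\Bigl(\frac u\lambda\Bigr)^{\frac1m-1}du ,$$ the integral being absolutely convergent. **Theorem.** There is an absolute constant $K>0$ and, for every $k\ge 2$, a number $r_m>0$ independent of $N$ such that for every $N\ge 1$, with $\rho_m(N)=N^{-1-2/m}\,r_m$, the functions $Z_k(\cdot,N)$ and $F_k(\cdot,N)$ extend analytically from $D^m_{\rho_m(N)}\cap\{|\arg\lambda|<\pi/2\}$ to $D^m_{\rho_m(N)}$, the relation $e^{N^2F_k}=Z_k$ holds there, and their perturbative series $$\sum_n\frac{(-1)^n}{n!}N^{-mn}\Bigl(\int d\mu^c(M)\,\bigl[\operatorname{Tr}(MM^\dagger)^k\bigr]^n\Bigr)\lambda^n$$ for $Z_k$, and $N^{-2}$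 times the formal logarithm of this series for $F_k$, are Borel–Le Roy summable of order $m$ in $D^m_{\rho_m(N)}$ to $Z_k$ and $F_k$. Moreover $|Z_k(\lambda,N)|\le K^{k^{3/2}N^2}$ on $D^m_{\rho_m(N)}$. -/

import Mathlib

open MeasureTheory
open scoped Matrix

/-- The normalized Gaussian measure `π ^ (-N²) e ^ (-Tr M M†) ∏ d(Re M i j) d(Im M i j)` on complex
`N × N` matrices. Matrices are carried by the function type, whose `volume` is the product of the
Lebesgue measures on the entries. -/
noncomputable def gaussianMatrixMeasure (N : ℕ) : Measure (Fin N → Fin N → ℂ) :=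
  volume.withDensity fun M =>
    ENNReal.ofReal ((Real.pi ^ (N ^ 2))⁻¹ *
      Real.exp (-(Matrix.of M * (Matrix.of M)ᴴ).trace.re))

/-- The invariant `Tr (M M†) ^ k` (a non-negative real, viewed in `ℂ`). -/
noncomputable def traceInvariant (k N : ℕ) (M : Fin N → Fin N → ℂ) : ℂ :=
  ((Matrix.of M * (Matrix.of M)ᴴ) ^ k).trace

/-- `Z_k(lam, N) = ∫ exp (-(lam / N ^ (k - 1)) Tr (M M†) ^ k) dμ(M)`, absolutely convergent for
`0 ≤ Re lam`. -/
noncomputable def partitionFunction (k N : ℕ) (lam : ℂ) : ℂ :=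
  ∫ M, Complex.exp (-(lam / (N : ℂ) ^ (k - 1)) * traceInvariant k N M) ∂gaussianMatrixMeasure N

/-- `F_k(lam, N) = N ^ (-2) log Z_k(lam, N)`. -/
noncomputable def freeEnergy (k N : ℕ) (lam : ℂ) : ℂ :=
  ((N : ℂ) ^ 2)⁻¹ * Complex.log (partitionFunction k N lam)

/-- The perturbative series of `Z_k`: the exponential is expanded under the integral and integrated
term by term. -/
noncomputable def partitionSeries (k N : ℕ) : PowerSeries ℂ :=
  PowerSeries.mk fun n =>
    (-1) ^ n / (n.factorial : ℂ) * (((N : ℂ) ^ (k - 1)) ^ n)⁻¹ *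
      ∫ M, traceInvariant k N M ^ n ∂gaussianMatrixMeasure N

/-- The perturbative series of `F_k`: the formal logarithm of the series of `Z_k` (whose constant term
is `1`), divided by `N²`. -/
noncomputable def freeEnergySeries (k N : ℕ) : PowerSeries ℂ :=
  PowerSeries.C (((N : ℂ) ^ 2)⁻¹) * PowerSeries.logOf (partitionSeries k N)

/-- The domain `D^m_ρ = {lam : Re lam ^ (-1/m) > ρ⁻¹}` in the coordinate `w = lam ^ (1/m)`: the disk
of diameter `ρ` tangent at `0` to the imaginary axis. Here `|arg lam| < m π / 2`, so that for `3 ≤ m`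
the domain `D^m_ρ` lies on the Riemann surface of the logarithm, on which `w` is a global coordinate;
a function on `D^m_ρ` is a function of `w`, and `lam = w ^ m`. -/
def leRoyDisk (ρ : ℝ) : Set ℂ := {w | ρ⁻¹ < (w⁻¹).re}

/-- `f`, a function on `D^m_ρ` in the coordinate `w`, extends the function `Φ` of `lam` given on the
half-plane `0 < Re lam` of the principal sheet. -/
def ExtendsOnLeRoyDisk (m : ℕ) (ρ : ℝ) (Φ f : ℂ → ℂ) : Prop :=
  ∀ w ∈ leRoyDisk ρ, |w.arg| < Real.pi / (2 * m) → f w = Φ (w ^ m)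

/-- The series `∑ a_n lam ^ n` is Borel-Le Roy summable of order `m` in `D^m_ρ` to the function `f`
(in the coordinate `w`, with `lam = w ^ m`): `f` is analytic with the Taylor remainder bounds of
order `m`; the Borel-Le Roy transform `∑ a_n u ^ n / Γ(m n + 1)` converges for `|u| < B⁻¹` and
continues analytically to a strip around the positive axis; and `f` is the Borel-Le Roy integral
`(m lam)⁻¹ ∫ G(u) exp (-(u / lam) ^ (1/m)) (u / lam) ^ (1/m - 1) du` of this continuation `G`, where
`(u / lam) ^ (1/m) = u ^ (1/m) / w` and `(u / lam) ^ (1/m - 1) = (u ^ (1/m) / w) ^ (1 - m)`. -/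
def IsBorelLeRoySum (m : ℕ) (ρ : ℝ) (a : PowerSeries ℂ) (f : ℂ → ℂ) : Prop :=
  AnalyticOnNhd ℂ f (leRoyDisk ρ) ∧
  ∃ A B : ℝ, 0 < A ∧ 0 < B ∧
    (∀ q : ℕ, 1 ≤ q → ∀ w ∈ leRoyDisk ρ,
      ‖f w - ∑ n ∈ Finset.range q, PowerSeries.coeff n a * (w ^ m) ^ n‖
        ≤ A * B ^ q * Real.Gamma (m * q) * ‖w ^ m‖ ^ q) ∧
    ∃ R : ℝ, 0 < R ∧ ∃ G : ℂ → ℂ,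
      AnalyticOnNhd ℂ G (Metric.ball 0 B⁻¹ ∪ {u : ℂ | |u.im| < R ∧ 0 < u.re}) ∧
      (∀ u ∈ Metric.ball (0 : ℂ) B⁻¹,
        HasSum (fun n : ℕ => PowerSeries.coeff n a / (Real.Gamma (m * n + 1) : ℂ) * u ^ n) (G u)) ∧
      ∀ w ∈ leRoyDisk ρ,
        IntegrableOn (fun u : ℝ => G u * Complex.exp (-(((u ^ (1 / (m : ℝ)) : ℝ) : ℂ) / w)) *
          (((u ^ (1 / (m : ℝ)) : ℝ) : ℂ) / w) ^ (1 - (m : ℤ))) (Set.Ioi 0) ∧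
        f w = 1 / (m * w ^ m) *
          ∫ u in Set.Ioi (0 : ℝ), G u * Complex.exp (-(((u ^ (1 / (m : ℝ)) : ℝ) : ℂ) / w)) *
            (((u ^ (1 / (m : ℝ)) : ℝ) : ℂ) / w) ^ (1 - (m : ℤ))

/-- The radius `ρ_m(N) = N ^ (-1 - 2/m) r`. -/
noncomputable def shrinkingRadius (m : ℕ) (r : ℝ) (N : ℕ) : ℝ :=
  (N : ℝ) ^ (-1 - 2 / (m : ℝ)) * r

/-!
In the coordinate `w = lam ^ (1 / m)` the Borel-Le Roy integral of order `m` is an ordinary Laplace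
integral `w⁻¹ ∫ H(v) e ^ (-v / w) dv`, with the transform evaluated at `u = v ^ m`
(`integral_leRoy`). It therefore suffices to write `Z` and `F` as such integrals of kernels `H` that
are holomorphic, with growth `e ^ (a ‖v‖)`, on a `δ`-neighbourhood of the positive axis. For such a
kernel, repeated integration by parts and Cauchy's estimate on circles of radius `δ / 2` bound the
Taylor remainders by multiples of `(j + 1)! (2 / δ) ^ j |w| ^ j`, and the Taylor coefficients of `H`
are forced by any asymptotic expansion of the integral as `w → 0⁺`
(`IsBorelKernel.isBorelLeRoySum`). The disk has diameter `ρ < a⁻¹`, so the growth rate `a` is what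
determines the dependence on `N`; neither `δ` nor the constants in the remainder bounds need to be
uniform in `N`.

The kernel of `Z`. Under the Gaussian measure `t = Tr M M†` is Gamma distributed with parameter
`d = N²` and independent of the direction of `M`, and `w ^ m N ^ (-m) Tr (M M†) ^ (m + 1)` equals
`(b w / N) ^ m t ^ (m + 1)`, where `b ∈ [0, 1]` depends on the direction only
(`integral_exp_tracePower_eq`). Thus `Z` is an average over `b` of the one-dimensional integrals
`∫ t ^ (d - 1) / (d - 1)! e ^ (-t - w ^ m t ^ (m + 1)) dt` at `b w / N`. After the rescaling
`t ↦ t / w` the exponent is `-(t + t ^ (m + 1)) / w`, and with the inverse function `T` of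
`x + x ^ (m + 1)` the substitution `t = T x` yields `w ^ (-d)` times the Laplace integral of
`(T ^ d / d!)'`. Hence the kernel is the `d`-th derivative of `T ^ d / d!` (`exists_radial_kernel`).
The inverse `T` is holomorphic on a neighbourhood of the positive axis that contains a sector and a
disk around `0` (`exists_inverse`), and Cauchy's estimate on circles adapted to the size of `x`
bounds the derivative of the kernel by `Λ D e ^ (Λ D ‖x‖)` with `D = d ^ (1 + 1 / m)` and `Λ`
independent of `d` (`exists_norm_iteratedDeriv_succ_pow_le`). The factor `1 / N` in the argument
lowers `D` to `N ^ (1 + 2 / m)` (`exists_partition_kernel`), which is the rate in `ρ_m(N)`.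

The kernel of `F`. Since `H 0 = 1`, `Z - 1` is the Laplace integral of `H'`, which is small where
`Re w⁻¹` exceeds a multiple of `Λ D`. There `log Z` is the Mercator series in powers of `Z - 1`.
These powers are the Borel integrals of the primitives of the convolution powers of `H'`
(`convPow`), and the sum of the series of these primitives converges on the whole neighbourhood and
has growth `e ^ (2 Λ D ‖v‖)` (`isBorelKernel_logKernel`, `borelIntegral_logKernel`). Its asymptotic
expansion is the formal logarithm of the one of `Z` (`HasPowExpansion.log`). The bound on `Z - 1`
also gives `|Z| ≤ 2` on the disk, and `2` is an admissible base `K`, the exponent `k ^ (3 / 2) N²`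
being at least `1`.
-/

/-! ### Holomorphic dependence of integrals on a parameter -/

/-- A parametric integral of holomorphic functions with a locally uniform integrable majorant may be
differentiated under the integral: Cauchy's estimate turns the majorant into one for the
derivatives. -/
theorem hasDerivAt_integral_of_dominated {α : Type*} [MeasurableSpace α] {μ : Measure α}
    {U : Set ℂ} (hU : IsOpen U) {f : ℂ → α → ℂ}
    (hmeas : ∀ v ∈ U, AEStronglyMeasurable (f v) μ)
    (hdiff : ∀ᵐ x ∂μ, DifferentiableOn ℂ (fun v => f v x) U)
    (hbound : ∀ v ∈ U, ∃ r > 0, ∃ B : α → ℝ, Integrable B μ ∧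
      ∀ᵐ x ∂μ, ∀ w ∈ Metric.ball v r ∩ U, ‖f w x‖ ≤ B x) {v : ℂ} (hv : v ∈ U) :
    HasDerivAt (fun v => ∫ x, f v x ∂μ) (∫ x, deriv (fun v => f v x) v ∂μ) v := by
  obtain ⟨r, hr, B, hB, hfB⟩ := hbound v hv
  obtain ⟨s, hs, hsU⟩ := Metric.isOpen_iff.1 hU v hv
  set t := min r s with ht
  have htpos : 0 < t := lt_min hr hs
  have htU : Metric.ball v t ⊆ Metric.ball v r ∩ U := fun w hw =>
    ⟨Metric.ball_subset_ball (min_le_left _ _) hw,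
      hsU (Metric.ball_subset_ball (min_le_right _ _) hw)⟩
  have hmem : Metric.ball v (t / 2) ∈ nhds v := Metric.ball_mem_nhds v (half_pos htpos)
  have hderivmeas : AEStronglyMeasurable (fun x => deriv (fun v => f v x) v) μ := by
    have hu : Filter.Tendsto (fun n : ℕ => ((t / 2 / (n + 1) : ℝ) : ℂ)) Filter.atTop
        (nhdsWithin 0 {0}ᶜ) := by
      refine tendsto_nhdsWithin_iff.2 ⟨?_, Filter.Eventually.of_forall fun n => ?_⟩
      · have : Filter.Tendsto (fun n : ℕ => t / 2 / ((n : ℝ) + 1)) Filter.atTop (nhds 0) :=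
          tendsto_const_div_atTop_nhds_zero_nat (t / 2) |>.comp (Filter.tendsto_add_atTop_nat 1)
            |>.congr fun n => by simp
        exact_mod_cast (Complex.continuous_ofReal.tendsto 0).comp this
      · simp only [Set.mem_compl_iff, Set.mem_singleton_iff, Complex.ofReal_eq_zero]
        positivity
    refine aestronglyMeasurable_of_tendsto_ae (u := Filter.atTop)
      (f := fun (n : ℕ) x => ((t / 2 / (n + 1) : ℝ) : ℂ)⁻¹ •
        (f (v + ((t / 2 / (n + 1) : ℝ) : ℂ)) x - f v x)) ?_ ?_
    · intro n
      refine AEStronglyMeasurable.const_smul (𝕜 := ℂ) ((hmeas _ ?_).sub (hmeas v hv)) _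
      refine (htU ?_).2
      rw [Metric.mem_ball, dist_eq_norm, add_sub_cancel_left, Complex.norm_real, Real.norm_eq_abs,
        abs_of_nonneg (by positivity)]
      calc t / 2 / ((n : ℝ) + 1) ≤ t / 2 :=
            div_le_self (by positivity) (by linarith [n.cast_nonneg (α := ℝ)])
        _ < t := by linarith
    · filter_upwards [hdiff] with x hx
      have h1 : HasDerivAt (fun v => f v x) (deriv (fun v => f v x) v) v :=
        ((hx v hv).differentiableAt (hU.mem_nhds hv)).hasDerivAt
      have h2 := (hasDerivAt_iff_tendsto_slope_zero.1 h1).comp hu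
      exact h2
  refine (hasDerivAt_integral_of_dominated_loc_of_deriv_le (F := f)
    (F' := fun w x => deriv (fun v => f v x) w) (bound := fun x => B x / (t / 2)) hmem ?_ ?_
    hderivmeas ?_ (hB.div_const _) ?_).2
  · filter_upwards [hU.mem_nhds hv] with w hw using hmeas w hw
  · refine hB.mono' (hmeas v hv) ?_
    filter_upwards [hfB] with x hx using hx v (htU (Metric.mem_ball_self htpos))
  · filter_upwards [hfB, hdiff] with x hx hd w hw
    have hsub : Metric.closedBall w (t / 2) ⊆ Metric.ball v t := by
      intro y hy
      have := dist_triangle y w v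
      have h1 := Metric.mem_closedBall.1 hy
      have h2 := Metric.mem_ball.1 hw
      exact Metric.mem_ball.2 (by linarith)
    refine Complex.norm_deriv_le_of_forall_mem_sphere_norm_le (half_pos htpos) ?_ ?_
    · refine (hd.mono ?_).diffContOnCl
      rw [closure_ball _ (half_pos htpos).ne']
      exact fun y hy => (htU (hsub hy)).2
    · exact fun y hy => hx y (htU (hsub (Metric.sphere_subset_closedBall hy)))
  · filter_upwards [hdiff] with x hd w hw
    have hwU : w ∈ U := (htU (Metric.ball_subset_ball (by linarith) hw)).2
    exact ((hd w hwU).differentiableAt (hU.mem_nhds hwU)).hasDerivAt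

theorem differentiableOn_integral_of_dominated {α : Type*} [MeasurableSpace α] {μ : Measure α}
    {U : Set ℂ} (hU : IsOpen U) {f : ℂ → α → ℂ}
    (hmeas : ∀ v ∈ U, AEStronglyMeasurable (f v) μ)
    (hdiff : ∀ᵐ x ∂μ, DifferentiableOn ℂ (fun v => f v x) U)
    (hbound : ∀ v ∈ U, ∃ r > 0, ∃ B : α → ℝ, Integrable B μ ∧
      ∀ᵐ x ∂μ, ∀ w ∈ Metric.ball v r ∩ U, ‖f w x‖ ≤ B x) :
    DifferentiableOn ℂ (fun v => ∫ x, f v x ∂μ) U := fun _ hv =>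
  (hasDerivAt_integral_of_dominated hU hmeas hdiff hbound
    hv).differentiableAt.differentiableWithinAt

/-! ### Neighbourhoods of the positive axis and Borel kernels -/

/-- The open `δ`-neighbourhood of the half-line `[0, ∞)` in `ℂ`. -/
def rayNhd (δ : ℝ) : Set ℂ := Metric.thickening δ ((fun t : ℝ => (t : ℂ)) '' Set.Ici 0)

theorem mem_rayNhd {δ : ℝ} {v : ℂ} : v ∈ rayNhd δ ↔ ∃ t : ℝ, 0 ≤ t ∧ dist v t < δ := by
  simp [rayNhd, Metric.mem_thickening_iff]

theorem isOpen_rayNhd (δ : ℝ) : IsOpen (rayNhd δ) := Metric.isOpen_thickening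

theorem ofReal_mem_rayNhd {δ : ℝ} (hδ : 0 < δ) {t : ℝ} (ht : 0 ≤ t) : (t : ℂ) ∈ rayNhd δ :=
  mem_rayNhd.2 ⟨t, ht, by simpa using hδ⟩

theorem zero_mem_rayNhd {δ : ℝ} (hδ : 0 < δ) : (0 : ℂ) ∈ rayNhd δ := by
  simpa using ofReal_mem_rayNhd hδ le_rfl

theorem rayNhd_mono {δ δ' : ℝ} (h : δ ≤ δ') : rayNhd δ ⊆ rayNhd δ' := Metric.thickening_mono h _

theorem ball_subset_rayNhd (δ : ℝ) : Metric.ball 0 δ ⊆ rayNhd δ := fun v hv =>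
  mem_rayNhd.2 ⟨0, le_rfl, by simpa using hv⟩

theorem closedBall_subset_rayNhd {δ : ℝ} {v : ℂ} (hv : v ∈ rayNhd (δ / 2)) :
    Metric.closedBall v (δ / 2) ⊆ rayNhd δ := by
  obtain ⟨t, ht, hvt⟩ := mem_rayNhd.1 hv
  intro y hy
  refine mem_rayNhd.2 ⟨t, ht, ?_⟩
  have := dist_triangle y v t
  have := Metric.mem_closedBall.1 hy
  linarith

theorem mul_mem_rayNhd {δ : ℝ} {v : ℂ} (hv : v ∈ rayNhd δ) {s : ℝ} (hs0 : 0 ≤ s)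
    (hs1 : s ≤ 1) : (s : ℂ) * v ∈ rayNhd δ := by
  obtain ⟨t, ht, hvt⟩ := mem_rayNhd.1 hv
  refine mem_rayNhd.2 ⟨s * t, by positivity, ?_⟩
  rw [dist_eq_norm] at hvt ⊢
  rw [Complex.ofReal_mul, ← mul_sub, norm_mul, Complex.norm_real, Real.norm_eq_abs,
    abs_of_nonneg hs0]
  nlinarith [norm_nonneg (v - t)]

/-- `H` is holomorphic on the `δ`-neighbourhood of the positive axis, with exponential growth
`‖H v‖ ≤ C e ^ (a ‖v‖)`. -/
structure IsBorelKernel (δ a C : ℝ) (H : ℂ → ℂ) : Prop where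
  differentiableOn : DifferentiableOn ℂ H (rayNhd δ)
  norm_le : ∀ v ∈ rayNhd δ, ‖H v‖ ≤ C * Real.exp (a * ‖v‖)

theorem DifferentiableOn.iteratedDeriv_of_isOpen {H : ℂ → ℂ} {U : Set ℂ}
    (hH : DifferentiableOn ℂ H U) (hU : IsOpen U) (n : ℕ) :
    DifferentiableOn ℂ (iteratedDeriv n H) U := by
  induction n with
  | zero => simpa using hH
  | succ n ih => rw [iteratedDeriv_succ]; exact ih.deriv hU

namespace IsBorelKernel

variable {δ a C : ℝ} {H : ℂ → ℂ}

theorem mono (hH : IsBorelKernel δ a C H) {δ' : ℝ} (h : δ' ≤ δ) : IsBorelKernel δ' a C H :=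
  ⟨hH.1.mono (rayNhd_mono h), fun v hv => hH.2 v (rayNhd_mono h hv)⟩

theorem const_nonneg (hH : IsBorelKernel δ a C H) (hδ : 0 < δ) : 0 ≤ C := by
  have := (norm_nonneg _).trans (hH.2 0 (zero_mem_rayNhd hδ))
  simpa using this

/-- Cauchy's estimate for the derivatives of a Borel kernel. -/
theorem iteratedDeriv (hH : IsBorelKernel δ a C H) (hδ : 0 < δ) (ha : 0 ≤ a) (n : ℕ) :
    IsBorelKernel (δ / 2) a (C * Real.exp (a * (δ / 2)) * (n.factorial * (2 / δ) ^ n))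
      (iteratedDeriv n H) := by
  refine ⟨(hH.1.mono (rayNhd_mono (by linarith))).iteratedDeriv_of_isOpen (isOpen_rayNhd _) n,
    fun v hv => ?_⟩
  have hC := hH.const_nonneg hδ
  have hsub := closedBall_subset_rayNhd hv
  refine (Complex.norm_iteratedDeriv_le_of_forall_mem_sphere_norm_le
    (C := C * Real.exp (a * (‖v‖ + δ / 2))) n (half_pos hδ) ?_ ?_).trans ?_
  · refine (hH.1.mono ?_).diffContOnCl
    rw [closure_ball _ (half_pos hδ).ne']
    exact hsub
  · intro y hy
    refine (hH.2 y (hsub (Metric.sphere_subset_closedBall hy))).trans ?_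
    have : ‖y‖ ≤ ‖v‖ + δ / 2 := by
      have h1 := norm_add_le v (y - v)
      rw [add_sub_cancel, ← dist_eq_norm, Metric.mem_sphere.1 hy] at h1
      exact h1
    gcongr
  · apply le_of_eq
    rw [mul_add, Real.exp_add, div_eq_mul_inv, ← inv_pow, inv_div]
    ring

/-- The Laplace integrand of a Borel kernel is continuous on the half-line. -/
theorem continuousOn_ofReal (hH : IsBorelKernel δ a C H) (hδ : 0 < δ) :
    ContinuousOn (fun v : ℝ => H v) (Set.Ici 0) :=
  hH.1.continuousOn.comp Complex.continuous_ofReal.continuousOn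
    fun _ ht => ofReal_mem_rayNhd hδ ht

theorem norm_mul_exp_le (hH : IsBorelKernel δ a C H) (hδ : 0 < δ) (z : ℂ) {v : ℝ} (hv : 0 ≤ v) :
    ‖H v * Complex.exp (-(z * v))‖ ≤ C * Real.exp ((a - z.re) * v) := by
  rw [norm_mul, Complex.norm_exp]
  have h1 := hH.2 v (ofReal_mem_rayNhd hδ hv)
  rw [Complex.norm_real, Real.norm_eq_abs, abs_of_nonneg hv] at h1
  calc _ ≤ C * Real.exp (a * v) * Real.exp (-(z * v)).re := by gcongr
    _ = _ := by
      rw [mul_assoc, ← Real.exp_add, Complex.neg_re, Complex.re_mul_ofReal, sub_mul, sub_eq_add_neg]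

theorem aestronglyMeasurable (hH : IsBorelKernel δ a C H) (hδ : 0 < δ) (z : ℂ) :
    AEStronglyMeasurable (fun v : ℝ => H v * Complex.exp (-(z * v)))
      (volume.restrict (Set.Ioi 0)) := by
  refine (ContinuousOn.mul ((hH.continuousOn_ofReal hδ).mono Set.Ioi_subset_Ici_self)
    (Continuous.continuousOn (by fun_prop))).aestronglyMeasurable measurableSet_Ioi

theorem integrableOn (hH : IsBorelKernel δ a C H) (hδ : 0 < δ) {z : ℂ} (hz : a < z.re) :
    IntegrableOn (fun v : ℝ => H v * Complex.exp (-(z * v))) (Set.Ioi 0) := by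
  refine Integrable.mono' ((integrableOn_exp_mul_Ioi (sub_neg.2 hz) 0).const_mul C)
    (hH.aestronglyMeasurable hδ z) ?_
  refine (ae_restrict_iff' measurableSet_Ioi).2 (Filter.Eventually.of_forall fun v hv => ?_)
  exact hH.norm_mul_exp_le hδ z (le_of_lt hv)

end IsBorelKernel

/-- The Laplace transform on the half-line. -/
noncomputable def laplaceIoi (H : ℂ → ℂ) (z : ℂ) : ℂ :=
  ∫ v in Set.Ioi (0 : ℝ), H v * Complex.exp (-(z * v))

namespace IsBorelKernel

variable {δ a C : ℝ} {H : ℂ → ℂ}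

theorem norm_laplaceIoi_le (hH : IsBorelKernel δ a C H) (hδ : 0 < δ) {z : ℂ} (hz : a < z.re) :
    ‖laplaceIoi H z‖ ≤ C / (z.re - a) := by
  have h1 : ‖laplaceIoi H z‖ ≤ ∫ v in Set.Ioi (0 : ℝ), C * Real.exp ((a - z.re) * v) := by
    refine norm_integral_le_of_norm_le ((integrableOn_exp_mul_Ioi (sub_neg.2 hz) 0).const_mul C) ?_
    refine (ae_restrict_iff' measurableSet_Ioi).2 (Filter.Eventually.of_forall fun v hv => ?_)
    exact hH.norm_mul_exp_le hδ z (le_of_lt hv)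
  refine h1.trans (le_of_eq ?_)
  rw [integral_const_mul, integral_exp_mul_Ioi (sub_neg.2 hz)]
  have h2 : z.re - a ≠ 0 := by linarith
  have h3 : a - z.re ≠ 0 := by linarith
  field_simp
  simp
  ring

theorem differentiableOn_laplaceIoi (hH : IsBorelKernel δ a C H) (hδ : 0 < δ) :
    DifferentiableOn ℂ (laplaceIoi H) {z | a < z.re} := by
  have hC := hH.const_nonneg hδ
  refine differentiableOn_integral_of_dominated
    (isOpen_lt continuous_const Complex.continuous_re) (fun z _ => hH.aestronglyMeasurable hδ z)
    (Filter.Eventually.of_forall fun v => by fun_prop) fun z hz => ?_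
  have hz' : a < z.re := hz
  refine ⟨(z.re - a) / 2, by linarith, fun v => C * Real.exp ((a - (a + z.re) / 2) * v),
    (integrableOn_exp_mul_Ioi (by linarith) 0).const_mul C, ?_⟩
  refine (ae_restrict_iff' measurableSet_Ioi).2 (Filter.Eventually.of_forall fun v hv w hw => ?_)
  refine (hH.norm_mul_exp_le hδ w (le_of_lt hv)).trans ?_
  have h1 : |(w - z).re| < (z.re - a) / 2 :=
    (Complex.abs_re_le_norm _).trans_lt (by simpa [dist_eq_norm] using hw.1)
  have h2 := (abs_lt.1 h1).1
  rw [Complex.sub_re] at h2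
  have hv' : (0 : ℝ) < v := hv
  have h3 : (a - w.re) * v ≤ (a - (a + z.re) / 2) * v :=
    mul_le_mul_of_nonneg_right (by linarith) hv'.le
  exact mul_le_mul_of_nonneg_left (Real.exp_le_exp.2 h3) hC

/-- Integration by parts in the Laplace integral. -/
theorem laplaceIoi_deriv (hH : IsBorelKernel δ a C H) (hδ : 0 < δ) (ha : 0 ≤ a) {z : ℂ}
    (hz : a < z.re) : laplaceIoi (deriv H) z = z * laplaceIoi H z - H 0 := by
  have hH' := hH.iteratedDeriv hδ ha 1
  rw [iteratedDeriv_one] at hH'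
  have hI := hH.integrableOn hδ hz
  have hI' := hH'.integrableOn (half_pos hδ) hz
  have key := integral_Ioi_of_hasDerivAt_of_tendsto' (a := (0 : ℝ)) (m := 0)
    (f := fun v : ℝ => H v * Complex.exp (-(z * v)))
    (f' := fun v : ℝ => deriv H v * Complex.exp (-(z * v)) -
      z * (H v * Complex.exp (-(z * v)))) ?_ (hI'.sub (hI.const_mul z)) ?_
  · rw [integral_sub hI' (hI.const_mul z), integral_const_mul] at key
    simp only [laplaceIoi]
    simp only [Complex.ofReal_zero, mul_zero, neg_zero, Complex.exp_zero, mul_one, zero_sub] at key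
    linear_combination key
  · intro x hx
    have hx' := ofReal_mem_rayNhd hδ hx
    have h1 : HasDerivAt H (deriv H x) (x : ℂ) :=
      ((hH.1 _ hx').differentiableAt ((isOpen_rayNhd δ).mem_nhds hx')).hasDerivAt
    have h2 : HasDerivAt (fun v : ℂ => Complex.exp (-(z * v))) (Complex.exp (-(z * x)) * -z) x := by
      have := (((hasDerivAt_id (x : ℂ)).const_mul z).neg).cexp
      simpa using this
    refine (h1.mul h2).comp_ofReal.congr_deriv ?_
    ring
  · have hlim : Filter.Tendsto (fun v : ℝ => C * Real.exp ((a - z.re) * v)) Filter.atTop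
        (nhds (C * 0)) := by
      refine (Real.tendsto_exp_atBot.comp ?_).const_mul C
      exact Filter.Tendsto.const_mul_atTop_of_neg (sub_neg.2 hz) Filter.tendsto_id
    rw [mul_zero] at hlim
    refine squeeze_zero_norm' ?_ hlim
    filter_upwards [Filter.eventually_ge_atTop 0] with v hv using hH.norm_mul_exp_le hδ z hv

end IsBorelKernel

/-- The Borel integral `w⁻¹ ∫ H(v) e ^ (-v / w) dv`. -/
noncomputable def borelIntegral (H : ℂ → ℂ) (w : ℂ) : ℂ := w⁻¹ * laplaceIoi H w⁻¹

namespace IsBorelKernel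

variable {δ a C : ℝ} {H : ℂ → ℂ}

theorem borelIntegral_eq_add_laplaceIoi (hH : IsBorelKernel δ a C H) (hδ : 0 < δ) (ha : 0 ≤ a)
    {w : ℂ} (hw : a < (w⁻¹).re) : borelIntegral H w = H 0 + laplaceIoi (deriv H) w⁻¹ := by
  rw [hH.laplaceIoi_deriv hδ ha hw, borelIntegral]
  ring

theorem borelIntegral_eq_add (hH : IsBorelKernel δ a C H) (hδ : 0 < δ) (ha : 0 ≤ a)
    {w : ℂ} (hw : a < (w⁻¹).re) :
    borelIntegral H w = H 0 + w * borelIntegral (deriv H) w := by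
  have hw0 : w ≠ 0 := by
    rintro rfl
    simp at hw
    linarith
  rw [hH.borelIntegral_eq_add_laplaceIoi hδ ha hw, borelIntegral]
  field_simp

/-- The Taylor expansion of a Borel integral, by repeated integration by parts. -/
theorem borelIntegral_eq_sum_add (hH : IsBorelKernel δ a C H) (hδ : 0 < δ) (ha : 0 ≤ a)
    {w : ℂ} (hw : a < (w⁻¹).re) (J : ℕ) :
    borelIntegral H w = ∑ j ∈ Finset.range J, _root_.iteratedDeriv j H 0 * w ^ j +
      w ^ J * borelIntegral (_root_.iteratedDeriv J H) w := by
  induction J with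
  | zero => simp
  | succ J ih =>
    rw [ih, (hH.iteratedDeriv hδ ha J).borelIntegral_eq_add (half_pos hδ) ha hw,
      Finset.sum_range_succ, iteratedDeriv_succ]
    ring

/-- Watson's remainder bound: after `J` integrations by parts Cauchy's estimate for the `J`-th and
`(J + 1)`-st derivatives of the kernel applies. One more integration by parts removes the factor
`w⁻¹`, so that the bound is uniform up to the boundary point `w = 0` of the disk. -/
theorem norm_borelIntegral_sub_le (hH : IsBorelKernel δ a C H) (hδ : 0 < δ) (ha : 0 ≤ a)
    {b : ℝ} (hb : a < b) {w : ℂ} (hw : b < (w⁻¹).re) (J : ℕ) :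
    ‖borelIntegral H w - ∑ j ∈ Finset.range J, _root_.iteratedDeriv j H 0 * w ^ j‖ ≤
      (C * Real.exp (a * (δ / 2)) * (1 + 2 / δ / (b - a))) *
        ((J + 1).factorial * (2 / δ) ^ J) * ‖w‖ ^ J := by
  have hC := hH.const_nonneg hδ
  have hwa : a < (w⁻¹).re := hb.trans hw
  have hJ := hH.iteratedDeriv hδ ha J
  have hJ' := hH.iteratedDeriv hδ ha (J + 1)
  rw [hH.borelIntegral_eq_sum_add hδ ha hwa J, add_sub_cancel_left,
    hJ.borelIntegral_eq_add_laplaceIoi (half_pos hδ) ha hwa, ← iteratedDeriv_succ,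
    norm_mul, norm_pow, mul_comm]
  gcongr
  refine (norm_add_le _ _).trans ?_
  have h1 := hJ.norm_le 0 (zero_mem_rayNhd (half_pos hδ))
  have h2 := hJ'.norm_laplaceIoi_le (half_pos hδ) hwa
  rw [norm_zero, mul_zero, Real.exp_zero, mul_one] at h1
  have h3 : C * Real.exp (a * (δ / 2)) * ((J + 1).factorial * (2 / δ) ^ (J + 1)) / ((w⁻¹).re - a)
      ≤ C * Real.exp (a * (δ / 2)) * ((J + 1).factorial * (2 / δ) ^ (J + 1)) / (b - a) := by
    have : 0 < b - a := sub_pos.2 hb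
    gcongr
  have h4 : C * Real.exp (a * (δ / 2)) * (J.factorial * (2 / δ) ^ J) ≤
      C * Real.exp (a * (δ / 2)) * ((J + 1).factorial * (2 / δ) ^ J) := by
    gcongr
    exact Nat.le_succ J
  calc _ ≤ C * Real.exp (a * (δ / 2)) * ((J + 1).factorial * (2 / δ) ^ J) +
        C * Real.exp (a * (δ / 2)) * ((J + 1).factorial * (2 / δ) ^ (J + 1)) / (b - a) :=
        add_le_add (h1.trans h4) (h2.trans h3)
    _ = _ := by ring

end IsBorelKernel

/-! ### Borel-Le Roy summability of Borel integrals -/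

theorem leRoyDisk_eq_ball {ρ : ℝ} (hρ : 0 < ρ) :
    leRoyDisk ρ = Metric.ball ((ρ / 2 : ℝ) : ℂ) (ρ / 2) := by
  ext w
  rw [Metric.mem_ball, dist_eq_norm, ← sq_lt_sq₀ (norm_nonneg _) (by positivity), Complex.sq_norm,
    Complex.normSq_apply]
  simp only [leRoyDisk, Set.mem_ofPred_eq, Complex.inv_re, Complex.sub_re, Complex.ofReal_re,
    Complex.sub_im, Complex.ofReal_im, sub_zero]
  rcases eq_or_ne w 0 with rfl | hw
  · simp only [Complex.zero_re, zero_div, Complex.zero_im]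
    constructor
    · intro h
      exact absurd h (inv_pos.2 hρ).not_gt
    · intro h
      nlinarith
  · have hn : 0 < Complex.normSq w := Complex.normSq_pos.2 hw
    rw [lt_div_iff₀ hn, inv_mul_lt_iff₀ hρ, Complex.normSq_apply]
    constructor <;> intro h <;> nlinarith

theorem isOpen_leRoyDisk {ρ : ℝ} (hρ : 0 < ρ) : IsOpen (leRoyDisk ρ) := by
  rw [leRoyDisk_eq_ball hρ]
  exact Metric.isOpen_ball

theorem convex_leRoyDisk {ρ : ℝ} (hρ : 0 < ρ) : Convex ℝ (leRoyDisk ρ) := by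
  rw [leRoyDisk_eq_ball hρ]
  exact convex_ball _ _

theorem ne_zero_of_mem_leRoyDisk {ρ : ℝ} (hρ : 0 < ρ) {w : ℂ} (hw : w ∈ leRoyDisk ρ) : w ≠ 0 := by
  rintro rfl
  have : ρ⁻¹ < ((0 : ℂ)⁻¹).re := hw
  simp at this
  linarith

/-- Real points close to `0` have an inverse of large real part. -/
theorem eventually_lt_inv_re (b : ℝ) :
    ∀ᶠ w : ℝ in nhdsWithin 0 (Set.Ioi 0), b < ((w : ℂ)⁻¹).re := by
  filter_upwards [tendsto_inv_nhdsGT_zero.eventually_gt_atTop b] with w hw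
  rw [← Complex.ofReal_inv, Complex.ofReal_re]
  exact hw

/-- Uniqueness of asymptotic expansions: a polynomial of degree less than `J` that is `O(w ^ J)`
at `0` vanishes. -/
theorem eq_zero_of_sum_isBigO {J : ℕ} {c : ℕ → ℂ}
    (h : (fun w : ℝ => ∑ j ∈ Finset.range J, c j * (w : ℂ) ^ j) =O[nhdsWithin 0 (Set.Ioi 0)]
      fun w : ℝ => w ^ J) : ∀ j < J, c j = 0 := by
  intro j
  induction j using Nat.strong_induction_on with
  | _ j ih =>
    intro hj
    have hpow : Filter.Tendsto (fun w : ℝ => (w : ℂ)) (nhdsWithin 0 (Set.Ioi 0)) (nhds 0) := by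
      have := (Complex.continuous_ofReal.tendsto 0).mono_left
        (nhdsWithin_le_nhds (s := Set.Ioi (0 : ℝ)))
      simpa using this
    -- after division by `w ^ j` the sum tends to `c j`, and is `O(w)`
    have hlim : Filter.Tendsto (fun w : ℝ => ∑ i ∈ Finset.range (J - j), c (j + i) * (w : ℂ) ^ i)
        (nhdsWithin 0 (Set.Ioi 0)) (nhds (c j)) := by
      have hsum : ∑ i ∈ Finset.range (J - j), c (j + i) * (0 : ℂ) ^ i = c j := by
        rw [Finset.sum_eq_single 0]
        · simp
        · intro b _ hb
          simp [hb]
        · intro h0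
          simp at h0
          omega
      rw [← hsum]
      exact tendsto_finsetSum _ fun i _ => (hpow.pow i).const_mul _
    have hO : (fun w : ℝ => ∑ i ∈ Finset.range (J - j), c (j + i) * (w : ℂ) ^ i)
        =O[nhdsWithin 0 (Set.Ioi 0)] fun w : ℝ => w := by
      obtain ⟨K, hK⟩ := h.bound
      refine Asymptotics.IsBigO.of_bound K ?_
      have h1 : ∀ᶠ w : ℝ in nhdsWithin 0 (Set.Ioi 0), w < 1 :=
        mem_nhdsWithin_of_mem_nhds (Iio_mem_nhds one_pos)
      filter_upwards [hK, self_mem_nhdsWithin, h1] with w hw hw0 hw1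
      have hw0' : (0 : ℝ) < w := hw0
      have hsplit : ∑ i ∈ Finset.range J, c i * (w : ℂ) ^ i =
          (w : ℂ) ^ j * ∑ i ∈ Finset.range (J - j), c (j + i) * (w : ℂ) ^ i := by
        conv_lhs => rw [show J = j + (J - j) by omega]
        rw [Finset.sum_range_add, Finset.sum_eq_zero, zero_add, Finset.mul_sum]
        · exact Finset.sum_congr rfl fun i _ => by ring
        · intro i hi
          rw [ih i (Finset.mem_range.1 hi) ((Finset.mem_range.1 hi).trans hj), zero_mul]
      rw [hsplit, norm_mul, norm_pow, norm_pow, Complex.norm_real, Real.norm_eq_abs,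
        abs_of_pos hw0'] at hw
      have hKn : 0 ≤ K := by
        by_contra hneg
        push Not at hneg
        have := (mul_nonneg (pow_nonneg hw0'.le j) (norm_nonneg _)).trans hw
        have h2 : K * w ^ J < 0 := mul_neg_of_neg_of_pos hneg (by positivity)
        linarith
      have h2 : w ^ J ≤ w ^ j * w := by
        rw [← pow_succ]
        exact pow_le_pow_of_le_one hw0'.le hw1.le hj
      rw [Real.norm_eq_abs, abs_of_pos hw0']
      have h3 : w ^ j * ‖∑ i ∈ Finset.range (J - j), c (j + i) * (w : ℂ) ^ i‖ ≤ w ^ j * (K * w) :=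
        hw.trans ((mul_le_mul_of_nonneg_left h2 hKn).trans (le_of_eq (by ring)))
      exact le_of_mul_le_mul_left h3 (by positivity)
    have hz : Filter.Tendsto (fun w : ℝ => w) (nhdsWithin 0 (Set.Ioi 0)) (nhds 0) :=
      nhdsWithin_le_nhds
    exact tendsto_nhds_unique hlim (hO.trans_tendsto hz)

/-- The coefficients, with respect to `w`, of a power series in `w ^ m`. -/
noncomputable def spreadCoeff (m : ℕ) (A : PowerSeries ℂ) (j : ℕ) : ℂ :=
  if m ∣ j then PowerSeries.coeff (j / m) A else 0

theorem spreadCoeff_mul {m : ℕ} (hm : 1 ≤ m) (A : PowerSeries ℂ) (n : ℕ) :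
    spreadCoeff m A (m * n) = PowerSeries.coeff n A := by
  rw [spreadCoeff, if_pos (dvd_mul_right _ _), Nat.mul_div_cancel_left _ hm]

theorem sum_spreadCoeff {m : ℕ} (hm : 1 ≤ m) (A : PowerSeries ℂ) (w : ℂ) (q : ℕ) :
    ∑ j ∈ Finset.range (m * q), spreadCoeff m A j * w ^ j =
      ∑ n ∈ Finset.range q, PowerSeries.coeff n A * (w ^ m) ^ n := by
  induction q with
  | zero => simp
  | succ q ih =>
    rw [mul_add, mul_one, Finset.sum_range_add, ih, Finset.sum_range_succ]
    congr 1
    rw [Finset.sum_eq_single 0]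
    · rw [add_zero, spreadCoeff_mul hm, pow_mul]
    · intro i hi hi0
      rw [spreadCoeff, if_neg, zero_mul]
      rw [Nat.dvd_add_right (dvd_mul_right _ _)]
      intro hdvd
      have := Nat.le_of_dvd (Nat.pos_of_ne_zero hi0) hdvd
      have := Finset.mem_range.1 hi
      omega
    · intro h
      simp at h
      omega

/-- The `m`-th root maps the strip `|Im u| < δ ^ m`, `0 < Re u` into the `δ`-neighbourhood of the
positive axis: this is clear for `|u| < δ ^ m`, and otherwise follows from
`|sin (arg u / m)| ≤ |sin (arg u)|`. -/
theorem cpow_inv_mem_rayNhd {m : ℕ} (hm : 1 ≤ m) {δ : ℝ} (hδ : 0 < δ) {u : ℂ} (hre : 0 < u.re)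
    (him : |u.im| < δ ^ m) : u ^ ((m : ℂ)⁻¹) ∈ rayNhd δ := by
  have hu0 : u ≠ 0 := by
    rintro rfl
    simp at hre
  have hm0 : m ≠ 0 := by omega
  set v := u ^ ((m : ℂ)⁻¹) with hv
  have hvm : v ^ m = u := Complex.cpow_nat_inv_pow u hm0
  have hvn : ‖v‖ ^ m = ‖u‖ := by rw [← norm_pow, hvm]
  rcases lt_or_ge ‖v‖ δ with hlt | hge
  · exact ball_subset_rayNhd δ (by simpa using hlt)
  have hmr : (1 : ℝ) ≤ m := by exact_mod_cast hm
  have hlog : Complex.log u * (m : ℂ)⁻¹ = ((Real.log ‖u‖ / m : ℝ) : ℂ) +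
      ((u.arg / m : ℝ) : ℂ) * Complex.I := by
    apply Complex.ext <;>
      simp [Complex.log_re, Complex.log_im, Complex.mul_re, Complex.mul_im, ← Complex.ofReal_natCast,
        ← Complex.ofReal_inv, div_eq_mul_inv, Complex.ofReal_re, Complex.ofReal_im]
  have hvexp : v = Complex.exp (((Real.log ‖u‖ / m : ℝ) : ℂ) +
      ((u.arg / m : ℝ) : ℂ) * Complex.I) := by
    rw [hv, Complex.cpow_def_of_ne_zero hu0, hlog]
  have hnorm : ‖v‖ = Real.exp (Real.log ‖u‖ / m) := by
    rw [hvexp, Complex.norm_exp]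
    simp
  have hvim : v.im = ‖v‖ * Real.sin (u.arg / m) := by
    rw [hnorm, hvexp, Complex.exp_im]
    simp
  have hvre : v.re = ‖v‖ * Real.cos (u.arg / m) := by
    rw [hnorm, hvexp, Complex.exp_re]
    simp
  have harg : |u.arg| < Real.pi / 2 := Complex.abs_arg_lt_pi_div_two_iff.2 (Or.inl hre)
  have harg' : |u.arg / m| ≤ |u.arg| := by
    rw [abs_div, abs_of_pos (by linarith : (0 : ℝ) < m)]
    exact div_le_self (abs_nonneg _) hmr
  have hsin : |Real.sin (u.arg / m)| ≤ |Real.sin u.arg| := by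
    have hpi := Real.pi_pos
    have e1 : |Real.sin (u.arg / m)| = Real.sin |u.arg / m| :=
      (Real.abs_sin_eq_sin_abs_of_abs_le_pi (by linarith))
    have e2 : |Real.sin u.arg| = Real.sin |u.arg| :=
      (Real.abs_sin_eq_sin_abs_of_abs_le_pi (by linarith))
    rw [e1, e2]
    exact Real.sin_le_sin_of_le_of_le_pi_div_two (by linarith [abs_nonneg (u.arg / m)]) harg.le harg'
  have hvpos : 0 < ‖v‖ := hδ.trans_le hge
  refine mem_rayNhd.2 ⟨v.re, ?_, ?_⟩
  · rw [hvre]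
    refine mul_nonneg (norm_nonneg _) (Real.cos_nonneg_of_mem_Icc ?_)
    have := abs_lt.1 (harg'.trans_lt harg)
    exact ⟨by linarith, by linarith⟩
  · have hd : dist v (v.re : ℂ) = |v.im| := by
      rw [Complex.dist_of_re_eq (by simp)]
      simp
    rw [hd, hvim, abs_mul, abs_norm]
    have h1 : ‖v‖ * |Real.sin (u.arg / m)| * ‖u‖ ≤ ‖v‖ * |u.im| := by
      rw [← Complex.norm_mul_sin_arg u, abs_mul, abs_norm, mul_assoc, mul_comm _ ‖u‖]
      gcongr
    have h2 : ‖v‖ * |u.im| < ‖v‖ * δ ^ m := by gcongr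
    obtain ⟨n, rfl⟩ : ∃ n, m = n + 1 := ⟨m - 1, by omega⟩
    by_contra hcon
    push Not at hcon
    have h3 : δ ^ n ≤ ‖v‖ ^ n := by gcongr
    have h4 : δ * ‖u‖ ≤ ‖v‖ * |Real.sin (u.arg / (n + 1 : ℕ))| * ‖u‖ := by gcongr
    rw [← hvn, pow_succ] at h1 h4
    have h5 : δ * (δ ^ n * ‖v‖) ≤ δ * (‖v‖ ^ n * ‖v‖) := by gcongr
    rw [pow_succ] at h2
    nlinarith

/-- The change of variables `u = v ^ m` identifies the Borel-Le Roy integral with the ordinary Borel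
integral in the coordinate `w`. -/
theorem integral_leRoy {m : ℕ} (hm : 1 ≤ m) {δ a C : ℝ} {H : ℂ → ℂ} (hH : IsBorelKernel δ a C H)
    (hδ : 0 < δ) {w : ℂ} (hw0 : w ≠ 0) (hw : a < (w⁻¹).re) :
    IntegrableOn (fun u : ℝ => H ((u : ℂ) ^ ((m : ℂ)⁻¹)) *
        Complex.exp (-(((u ^ (1 / (m : ℝ)) : ℝ) : ℂ) / w)) *
          (((u ^ (1 / (m : ℝ)) : ℝ) : ℂ) / w) ^ (1 - (m : ℤ))) (Set.Ioi 0) ∧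
      borelIntegral H w = 1 / (m * w ^ m) *
        ∫ u in Set.Ioi (0 : ℝ), H ((u : ℂ) ^ ((m : ℂ)⁻¹)) *
          Complex.exp (-(((u ^ (1 / (m : ℝ)) : ℝ) : ℂ) / w)) *
            (((u ^ (1 / (m : ℝ)) : ℝ) : ℂ) / w) ^ (1 - (m : ℤ)) := by
  have hmr : (0 : ℝ) < m := by exact_mod_cast hm
  have hmc : (m : ℂ) ≠ 0 := by exact_mod_cast hmr.ne'
  set p : ℝ := 1 / (m : ℝ) with hp
  have hp0 : 0 < p := by positivity
  have hI := hH.integrableOn hδ hw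
  have hI' := (integrableOn_Ioi_comp_rpow_iff _ hp0.ne').2 hI
  have hval := integral_comp_rpow_Ioi_of_pos (g := fun v : ℝ => H v * Complex.exp (-(w⁻¹ * v))) hp0
  have hcongr : ∀ u ∈ Set.Ioi (0 : ℝ), H ((u : ℂ) ^ ((m : ℂ)⁻¹)) *
        Complex.exp (-(((u ^ p : ℝ) : ℂ) / w)) * (((u ^ p : ℝ) : ℂ) / w) ^ (1 - (m : ℤ)) =
      (m * w ^ (m - 1)) * ((|p| * u ^ (p - 1)) •
        (H ((u ^ p : ℝ) : ℂ) * Complex.exp (-(w⁻¹ * ((u ^ p : ℝ) : ℂ))))) := by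
    intro u hu
    have hu' : (0 : ℝ) < u := hu
    have e1 : (u : ℂ) ^ ((m : ℂ)⁻¹) = ((u ^ p : ℝ) : ℂ) := by
      rw [Complex.ofReal_cpow hu'.le, hp]
      push_cast
      rw [one_div]
    have e2 : (((u ^ p : ℝ) : ℂ) / w) ^ (1 - (m : ℤ)) = ((u ^ (p - 1) : ℝ) : ℂ) * w ^ (m - 1) := by
      have hz : (1 - (m : ℤ)) = -((m - 1 : ℕ) : ℤ) := by
        rw [Nat.cast_sub hm]
        simp
      rw [hz, zpow_neg, zpow_natCast, div_pow, inv_div, div_eq_mul_inv, mul_comm]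
      congr 1
      rw [← Complex.ofReal_pow, ← Complex.ofReal_inv]
      congr 1
      rw [← Real.rpow_natCast, ← Real.rpow_mul hu'.le, ← Real.rpow_neg hu'.le, Nat.cast_sub hm, hp]
      congr 1
      field_simp
      simp
    rw [e1, e2, abs_of_pos hp0, Complex.real_smul]
    have e3 : (m : ℂ) * (p : ℂ) = 1 := by
      rw [hp]
      push_cast
      field_simp
    push_cast
    rw [div_eq_inv_mul]
    linear_combination (-(((u ^ (p - 1) : ℝ) : ℂ) * w ^ (m - 1) * H ((u ^ p : ℝ) : ℂ) *
      Complex.exp (-(w⁻¹ * ((u ^ p : ℝ) : ℂ))))) * e3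
  refine ⟨?_, ?_⟩
  · exact IntegrableOn.congr_fun (hI'.const_mul (m * w ^ (m - 1)))
      (fun u hu => (hcongr u hu).symm) measurableSet_Ioi
  · rw [setIntegral_congr_fun measurableSet_Ioi hcongr, integral_const_mul, abs_of_pos hp0, hval,
      borelIntegral, laplaceIoi]
    obtain ⟨n, rfl⟩ : ∃ n, m = n + 1 := ⟨m - 1, by omega⟩
    rw [Nat.add_sub_cancel, pow_succ]
    field_simp

namespace IsBorelKernel

variable {δ a C : ℝ} {H : ℂ → ℂ}

theorem borelIntegral_sub_isBigO (hH : IsBorelKernel δ a C H) (hδ : 0 < δ) (ha : 0 ≤ a) (J : ℕ) :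
    (fun w : ℝ => borelIntegral H w -
      ∑ j ∈ Finset.range J, _root_.iteratedDeriv j H 0 * (w : ℂ) ^ j)
      =O[nhdsWithin 0 (Set.Ioi 0)] fun w : ℝ => w ^ J := by
  refine Asymptotics.IsBigO.of_bound ((C * Real.exp (a * (δ / 2)) * (1 + 2 / δ / (a + 1 - a))) *
        ((J + 1).factorial * (2 / δ) ^ J)) ?_
  filter_upwards [eventually_lt_inv_re (a + 1)] with w hw
  refine (hH.norm_borelIntegral_sub_le hδ ha (lt_add_one a) hw J).trans (le_of_eq ?_)
  rw [norm_pow, Complex.norm_real]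

/-- The Taylor coefficients of a Borel kernel are read off from any asymptotic expansion of its
Borel integral. -/
theorem iteratedDeriv_zero_eq (hH : IsBorelKernel δ a C H) (hδ : 0 < δ) (ha : 0 ≤ a) {m : ℕ}
    (hm : 1 ≤ m) {A : PowerSeries ℂ}
    (hA : ∀ q, (fun w : ℝ => borelIntegral H w -
      ∑ n ∈ Finset.range q, PowerSeries.coeff n A * ((w : ℂ) ^ m) ^ n)
      =O[nhdsWithin 0 (Set.Ioi 0)] fun w : ℝ => w ^ (m * q)) (j : ℕ) :
    _root_.iteratedDeriv j H 0 = spreadCoeff m A j := by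
  have h := (hA (j + 1)).sub (hH.borelIntegral_sub_isBigO hδ ha (m * (j + 1)))
  refine sub_eq_zero.1 (eq_zero_of_sum_isBigO (J := m * (j + 1))
    (c := fun j => _root_.iteratedDeriv j H 0 - spreadCoeff m A j) ?_ j (by nlinarith))
  refine h.congr_left fun w => ?_
  rw [← sum_spreadCoeff hm, sub_sub_sub_cancel_left, ← Finset.sum_sub_distrib]
  exact Finset.sum_congr rfl fun i _ => by ring

/-- The Borel-Le Roy transform near `0` is the kernel in the coordinate `v = u ^ (1 / m)`: only the
Taylor coefficients of the kernel at multiples of `m` are present, so no branch of the root matters.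
-/
theorem hasSum_leRoy (hH : IsBorelKernel δ a C H) {m : ℕ} (hm : 1 ≤ m)
    {A : PowerSeries ℂ} (hj : ∀ j, _root_.iteratedDeriv j H 0 = spreadCoeff m A j) {u : ℂ}
    (hu : ‖u‖ < δ ^ m) (hδ : 0 < δ) :
    HasSum (fun n : ℕ => PowerSeries.coeff n A / (Real.Gamma (m * n + 1) : ℂ) * u ^ n)
      (H (u ^ ((m : ℂ)⁻¹))) := by
  have hm0 : m ≠ 0 := by omega
  set v := u ^ ((m : ℂ)⁻¹) with hv
  have hvm : v ^ m = u := Complex.cpow_nat_inv_pow u hm0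
  have hvδ : ‖v‖ < δ := by
    refine lt_of_pow_lt_pow_left₀ m hδ.le ?_
    rwa [← norm_pow, hvm]
  have h := Complex.hasSum_taylorSeries_on_ball (hH.1.mono (ball_subset_rayNhd δ))
    (z := v) (by simpa using hvδ)
  have hinj : Function.Injective fun n : ℕ => m * n := fun x y hxy => by
    exact Nat.eq_of_mul_eq_mul_left hm hxy
  rw [← hinj.hasSum_iff] at h
  · refine h.congr_fun fun n => ?_
    simp only [Function.comp, sub_zero, smul_eq_mul]
    rw [hj, spreadCoeff_mul hm, pow_mul, hvm]
    have : Real.Gamma (m * n + 1) = ((m * n).factorial : ℝ) := by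
      rw [← Real.Gamma_nat_eq_factorial]
      push_cast
      rfl
    rw [this]
    push_cast
    ring
  · intro j hjr
    have : ¬ m ∣ j := fun ⟨n, hn⟩ => hjr ⟨n, hn.symm⟩
    rw [hj, spreadCoeff, if_neg this]
    simp

/-- The Borel integral of a kernel of exponential type `a` on a neighbourhood of the positive axis
is a Borel-Le Roy sum of order `m` of its asymptotic expansion in powers of `w ^ m`, on every disk
of diameter less than `a⁻¹`. -/
theorem isBorelLeRoySum (hH : IsBorelKernel δ a C H) (hδ : 0 < δ) (ha : 0 ≤ a) {m : ℕ}
    (hm : 1 ≤ m) {ρ : ℝ} (hρ : 0 < ρ) (haρ : a < ρ⁻¹) {A : PowerSeries ℂ}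
    (hA : ∀ q, (fun w : ℝ => borelIntegral H w -
      ∑ n ∈ Finset.range q, PowerSeries.coeff n A * ((w : ℂ) ^ m) ^ n)
      =O[nhdsWithin 0 (Set.Ioi 0)] fun w : ℝ => w ^ (m * q)) :
    IsBorelLeRoySum m ρ A (borelIntegral H) := by
  have hj := hH.iteratedDeriv_zero_eq hδ ha hm hA
  have hC := hH.const_nonneg hδ
  have hlt : ∀ w ∈ leRoyDisk ρ, a < (w⁻¹).re := fun w hw => haρ.trans hw
  set D : ℝ := C * Real.exp (a * (δ / 2)) * (1 + 2 / δ / (ρ⁻¹ - a)) with hD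
  have hDn : 0 ≤ D := by
    have : 0 < ρ⁻¹ - a := sub_pos.2 haρ
    positivity
  have hsub : ∀ u : ℂ, ‖u‖ < (((8 / δ) ^ m)⁻¹ : ℝ) → ‖u‖ < δ ^ m := by
    intro u hu
    refine hu.trans_le ?_
    rw [← inv_pow, inv_div]
    gcongr
    linarith
  -- `8 / δ` is the rate `2 / δ` of Cauchy's estimate times the `4` of `(j + 1)! ≤ 4 ^ j (j - 1)!`
  refine ⟨?_, D + 1, (8 / δ) ^ m, by linarith, by positivity, ?_, δ ^ m, by positivity,
    fun u => H (u ^ ((m : ℂ)⁻¹)), ?_, ?_, ?_⟩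
  · refine DifferentiableOn.analyticOnNhd ?_ (isOpen_leRoyDisk hρ)
    have hinv : DifferentiableOn ℂ (fun w : ℂ => w⁻¹) (leRoyDisk ρ) :=
      differentiableOn_inv.mono fun w hw => ne_zero_of_mem_leRoyDisk hρ hw
    exact hinv.mul ((hH.differentiableOn_laplaceIoi hδ).comp hinv hlt)
  · intro q hq w hw
    have h := hH.norm_borelIntegral_sub_le hδ ha haρ hw (m * q)
    rw [Finset.sum_congr rfl fun j _ => by rw [hj j], sum_spreadCoeff hm] at h
    refine h.trans ?_
    have hq' : 1 ≤ m * q := Nat.one_le_iff_ne_zero.2 (by positivity)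
    obtain ⟨J, hJ⟩ : ∃ J, m * q = J + 1 := ⟨m * q - 1, by omega⟩
    have hΓ : Real.Gamma (m * q) = (J.factorial : ℝ) := by
      rw [← Real.Gamma_nat_eq_factorial]
      congr 1
      exact_mod_cast hJ
    have hfac : (((m * q + 1).factorial : ℕ) : ℝ) ≤ 4 ^ (m * q) * J.factorial := by
      rw [hJ, Nat.factorial_succ, Nat.factorial_succ]
      push_cast
      have h1 : ((J : ℝ) + 1 + 1) ≤ 2 ^ (J + 1) := by
        have : J + 1 + 1 ≤ 2 ^ (J + 1) := Nat.lt_two_pow_self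
        exact_mod_cast this
      have h4 : (4 : ℝ) ^ (J + 1) = 2 ^ (J + 1) * 2 ^ (J + 1) := by
        rw [← mul_pow]
        norm_num
      rw [h4, ← mul_assoc]
      gcongr
      linarith
    rw [hΓ, ← pow_mul, norm_pow, ← pow_mul]
    have h8 : (8 / δ) ^ (m * q) = 4 ^ (m * q) * (2 / δ) ^ (m * q) := by
      rw [← mul_pow]
      congr 1
      ring
    calc D * (((m * q + 1).factorial : ℕ) * (2 / δ) ^ (m * q)) * ‖w‖ ^ (m * q)
        ≤ (D + 1) * ((4 ^ (m * q) * J.factorial) * (2 / δ) ^ (m * q)) * ‖w‖ ^ (m * q) := by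
          gcongr
          linarith
      _ = _ := by
          rw [h8]
          ring
  · intro u hu
    rcases hu with hu | hu
    · refine DifferentiableOn.analyticOnNhd (s := Metric.ball (0 : ℂ) (((8 / δ) ^ m)⁻¹)) ?_
        Metric.isOpen_ball u hu
      have hr : ‖((((8 / δ) ^ m)⁻¹ : ℝ) : ℂ)‖ < δ ^ m := by
        rw [Complex.norm_real, Real.norm_eq_abs, abs_of_pos (by positivity), ← inv_pow, inv_div]
        gcongr
        linarith
      refine DifferentiableOn.congr (Complex.differentiableOn_tsum_of_summable_norm
        (F := fun (n : ℕ) (u : ℂ) => PowerSeries.coeff n A / (Real.Gamma (m * n + 1) : ℂ) * u ^ n)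
        (hH.hasSum_leRoy hm hj hr hδ).summable.norm (fun n => by fun_prop) Metric.isOpen_ball ?_) ?_
      · intro n y hy
        rw [norm_mul, norm_mul, norm_pow, norm_pow]
        have hy' : ‖y‖ < ((8 / δ) ^ m)⁻¹ := by simpa using hy
        rw [Complex.norm_real, Real.norm_eq_abs, abs_of_pos (by positivity : 0 < ((8 / δ) ^ m)⁻¹)]
        gcongr
      · intro y hy
        exact (hH.hasSum_leRoy hm hj (hsub y (by simpa using hy)) hδ).tsum_eq.symm
    · have hopen : IsOpen {u : ℂ | |u.im| < δ ^ m ∧ 0 < u.re} :=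
        (isOpen_lt (continuous_abs.comp Complex.continuous_im) continuous_const).inter
          (isOpen_lt continuous_const Complex.continuous_re)
      refine DifferentiableOn.analyticOnNhd (s := {u : ℂ | |u.im| < δ ^ m ∧ 0 < u.re}) ?_ hopen u hu
      refine hH.1.comp (fun y hy => ?_) fun y hy => cpow_inv_mem_rayNhd hm hδ hy.2 hy.1
      exact (differentiableAt_id.cpow_const (Or.inl hy.2)).differentiableWithinAt
  · intro u hu
    exact hH.hasSum_leRoy hm hj (hsub u (by simpa using hu)) hδ
  · intro w hw
    exact integral_leRoy hm hH hδ (ne_zero_of_mem_leRoyDisk hρ hw) (hlt w hw)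

end IsBorelKernel

/-! ### The inverse of `x + x ^ (m + 1)` near the positive axis -/

/-- A neighbourhood of the positive axis which contains a disk around `0` and a sector. -/
def conicNhd (κ : ℝ) : Set ℂ := {x | ∃ t : ℝ, 0 ≤ t ∧ dist x t < κ * (1 + t)}

theorem isOpen_conicNhd (κ : ℝ) : IsOpen (conicNhd κ) := by
  have : conicNhd κ = ⋃ t ∈ Set.Ici (0 : ℝ), Metric.ball (t : ℂ) (κ * (1 + t)) := by
    ext x
    simp [conicNhd]
  rw [this]
  exact isOpen_biUnion fun _ _ => Metric.isOpen_ball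

theorem convex_conicNhd (κ : ℝ) : Convex ℝ (conicNhd κ) := by
  rintro x ⟨t, ht, hxt⟩ y ⟨s, hs, hys⟩ a b ha hb hab
  refine ⟨a * t + b * s, by positivity, ?_⟩
  rw [dist_eq_norm] at hxt hys ⊢
  have h1 : a • x + b • y - ((a * t + b * s : ℝ) : ℂ) = (a : ℂ) * (x - t) + (b : ℂ) * (y - s) := by
    simp only [Complex.real_smul]
    push_cast
    ring
  rw [h1]
  have h2 := norm_add_le ((a : ℂ) * (x - t)) ((b : ℂ) * (y - s))
  rw [norm_mul, norm_mul, Complex.norm_real, Complex.norm_real, Real.norm_eq_abs, Real.norm_eq_abs,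
    abs_of_nonneg ha, abs_of_nonneg hb] at h2
  refine h2.trans_lt ?_
  have e : κ * (1 + (a * t + b * s)) = a * (κ * (1 + t)) + b * (κ * (1 + s)) := by
    have : b = 1 - a := by linarith
    rw [this]
    ring
  rw [e]
  rcases ha.eq_or_lt with rfl | ha'
  · have : b = 1 := by linarith
    subst this
    simpa using hys
  · have := mul_lt_mul_of_pos_left hxt ha'
    have := mul_le_mul_of_nonneg_left hys.le hb
    linarith

theorem rayNhd_subset_conicNhd {κ : ℝ} (hκ : 0 ≤ κ) : rayNhd κ ⊆ conicNhd κ := by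
  intro x hx
  obtain ⟨t, ht, hxt⟩ := mem_rayNhd.1 hx
  exact ⟨t, ht, hxt.trans_le (by nlinarith)⟩

theorem ofReal_mem_conicNhd {κ : ℝ} (hκ : 0 < κ) {t : ℝ} (ht : 0 ≤ t) : (t : ℂ) ∈ conicNhd κ :=
  rayNhd_subset_conicNhd hκ.le (ofReal_mem_rayNhd hκ ht)

/-- A holomorphic function on a convex set whose derivative has real part at least `1 / 2` is
expanding up to the factor `2`. -/
theorem norm_sub_le_of_half_le_re {f f' : ℂ → ℂ} {s : Set ℂ} (hs : Convex ℝ s)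
    (hf : ∀ x ∈ s, HasDerivAt f (f' x) x) (hre : ∀ x ∈ s, 1 / 2 ≤ (f' x).re) {a b : ℂ}
    (ha : a ∈ s) (hb : b ∈ s) : ‖a - b‖ ≤ 2 * ‖f a - f b‖ := by
  set c := (starRingEnd ℂ) (a - b) with hc
  have hmem : ∀ r ∈ Set.Icc (0 : ℝ) 1, b + (r : ℂ) * (a - b) ∈ s := by
    intro r hr
    have := hs hb ha (sub_nonneg.2 hr.2) hr.1 (by ring)
    convert this using 1
    simp only [Complex.real_smul]
    push_cast
    ring
  have hderiv : ∀ r ∈ Set.Icc (0 : ℝ) 1, HasDerivAt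
      (fun r : ℝ => (c * f (b + (r : ℂ) * (a - b))).re)
      ((c * (f' (b + (r : ℂ) * (a - b)) * (a - b))).re) r := by
    intro r hr
    have h1 : HasDerivAt (fun z : ℂ => b + z * (a - b)) (a - b) (r : ℂ) := by
      simpa using ((hasDerivAt_id (r : ℂ)).mul_const (a - b)).const_add b
    have h2 := ((hf _ (hmem r hr)).comp (r : ℂ) h1).const_mul c
    exact h2.real_of_complex
  obtain ⟨r, hr, hslope⟩ := exists_hasDerivAt_eq_slope _ _ (zero_lt_one' ℝ)
    (fun r hr => (hderiv r hr).continuousAt.continuousWithinAt)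
    fun r hr => hderiv r (Set.Ioo_subset_Icc_self hr)
  have hr' := Set.Ioo_subset_Icc_self hr
  have h3 := hre _ (hmem r hr')
  have e1 : (c * (f' (b + (r : ℂ) * (a - b)) * (a - b))).re =
      ‖a - b‖ ^ 2 * (f' (b + (r : ℂ) * (a - b))).re := by
    rw [show c * (f' (b + (r : ℂ) * (a - b)) * (a - b)) =
      ((a - b) * c) * f' (b + (r : ℂ) * (a - b)) by ring, hc, Complex.mul_conj,
      Complex.re_ofReal_mul, Complex.normSq_eq_norm_sq]
  rw [e1] at hslope
  simp only [Complex.ofReal_one, one_mul, Complex.ofReal_zero, zero_mul, add_zero, sub_zero,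
    div_one, add_sub_cancel] at hslope
  rw [← Complex.sub_re, ← mul_sub] at hslope
  have h4 : (c * (f a - f b)).re ≤ ‖a - b‖ * ‖f a - f b‖ := by
    refine (Complex.re_le_norm _).trans (le_of_eq ?_)
    rw [norm_mul, hc, Complex.norm_conj]
  rcases eq_or_ne (a - b) 0 with h0 | h0
  · rw [h0, norm_zero]
    positivity
  · have hpos : 0 < ‖a - b‖ := norm_pos_iff.2 h0
    have h5 : ‖a - b‖ ^ 2 * (1 / 2) ≤ ‖a - b‖ ^ 2 * (f' (b + (r : ℂ) * (a - b))).re := by gcongr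
    nlinarith

theorem norm_pow_sub_pow_le_mul {x y : ℂ} {B : ℝ} (hx : ‖x‖ ≤ B) (hy : ‖y‖ ≤ B) (m : ℕ) :
    ‖x ^ m - y ^ m‖ ≤ m * B ^ (m - 1) * ‖x - y‖ := by
  have hB : 0 ≤ B := (norm_nonneg x).trans hx
  rw [← (Commute.all x y).geom_sum₂_mul m, norm_mul]
  gcongr
  refine (norm_sum_le _ _).trans ?_
  refine (Finset.sum_le_card_nsmul _ _ (B ^ (m - 1)) fun i hi => ?_).trans (by simp)
  have hi' := Finset.mem_range.1 hi
  rw [norm_mul, norm_pow, norm_pow]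
  calc ‖x‖ ^ i * ‖y‖ ^ (m - 1 - i) ≤ B ^ i * B ^ (m - 1 - i) := by gcongr
    _ = B ^ (m - 1) := by
      rw [← pow_add]
      congr 1
      omega

/-- The relative oscillation of the derivative `1 + (m + 1) x ^ m` is at most `1 / 2` on disks
around points `t ≥ 0` of radius a fixed small multiple of `1 + t`. -/
theorem exists_deriv_oscillation (m : ℕ) (hm : 1 ≤ m) : ∃ κ : ℝ, 0 < κ ∧ κ ≤ 1 ∧
    ∀ t : ℝ, 0 ≤ t → ∀ x : ℂ, dist x t ≤ κ * (1 + t) →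
      ‖(1 + (m + 1) * x ^ m) - ((1 + (m + 1) * t ^ m : ℝ) : ℂ)‖ ≤ 1 / 2 * (1 + (m + 1) * t ^ m) := by
  have hmr : (1 : ℝ) ≤ m := by exact_mod_cast hm
  set κ : ℝ := 1 / (2 * m * (m + 1) * 4 ^ m) with hκ
  have h4 : (1 : ℝ) ≤ 4 ^ m := one_le_pow₀ (by norm_num)
  have hκ0 : 0 < κ := by positivity
  have hκ1 : κ ≤ 1 := by
    rw [hκ, div_le_one (by positivity)]
    have : (1 : ℝ) ≤ 2 * m * (m + 1) := by nlinarith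
    nlinarith
  refine ⟨κ, hκ0, hκ1, fun t ht x hx => ?_⟩
  rw [dist_eq_norm] at hx
  have hB : ‖x‖ ≤ 2 * (1 + t) := by
    have h1 := norm_add_le (x - t) (t : ℂ)
    rw [sub_add_cancel, Complex.norm_real, Real.norm_eq_abs, abs_of_nonneg ht] at h1
    nlinarith
  have hB' : ‖(t : ℂ)‖ ≤ 2 * (1 + t) := by
    rw [Complex.norm_real, Real.norm_eq_abs, abs_of_nonneg ht]
    linarith
  have h2 := norm_pow_sub_pow_le_mul hB hB' m
  have h3 : (1 + t) ^ m ≤ 2 ^ m * (1 + t ^ m) := by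
    rcases le_total t 1 with h | h
    · calc (1 + t) ^ m ≤ 2 ^ m := by
            gcongr
            linarith
        _ ≤ _ := le_mul_of_one_le_right (by positivity) (by linarith [pow_nonneg ht m])
    · calc (1 + t) ^ m ≤ (2 * t) ^ m := by
            gcongr
            linarith
        _ = 2 ^ m * t ^ m := mul_pow _ _ _
        _ ≤ _ := by
          gcongr
          linarith
  have e : (1 + (m + 1) * x ^ m) - ((1 + (m + 1) * t ^ m : ℝ) : ℂ) =
      ((m + 1 : ℝ) : ℂ) * (x ^ m - (t : ℂ) ^ m) := by
    push_cast
    ring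
  rw [e, norm_mul, Complex.norm_real, Real.norm_eq_abs, abs_of_pos (by positivity)]
  calc ((m : ℝ) + 1) * ‖x ^ m - (t : ℂ) ^ m‖
      ≤ (m + 1) * (m * (2 * (1 + t)) ^ (m - 1) * (κ * (1 + t))) := by
        refine mul_le_mul_of_nonneg_left (h2.trans ?_) (by positivity)
        gcongr
    _ ≤ (m + 1) * (m * (2 * (1 + t)) ^ (m - 1) * (κ * (2 * (1 + t)))) := by
        gcongr
        linarith
    _ = (m + 1) * m * κ * (2 * (1 + t)) ^ m := by
        obtain ⟨n, rfl⟩ : ∃ n, m = n + 1 := ⟨m - 1, by omega⟩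
        rw [Nat.add_sub_cancel, pow_succ]
        ring
    _ ≤ (m + 1) * m * κ * (2 ^ m * (2 ^ m * (1 + t ^ m))) := by
        rw [mul_pow]
        gcongr
    _ = 1 / 2 * (1 + t ^ m) := by
        have : (2 : ℝ) ^ m * 2 ^ m = 4 ^ m := by
          rw [← mul_pow]
          norm_num
        rw [← mul_assoc ((2 : ℝ) ^ m), this, hκ]
        field_simp
    _ ≤ _ := by
        have : t ^ m ≤ (m + 1) * t ^ m := le_mul_of_one_le_left (by positivity) (by linarith)
        linarith

/-- The holomorphic inverse of `x + x ^ (m + 1)` on a conic neighbourhood of the positive axis. -/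
theorem exists_inverse (m : ℕ) (hm : 1 ≤ m) : ∃ κ : ℝ, 0 < κ ∧ κ ≤ 1 ∧ ∃ T : ℂ → ℂ,
    DifferentiableOn ℂ T (conicNhd κ) ∧
    (∀ ζ ∈ conicNhd κ, T ζ + T ζ ^ (m + 1) = ζ ∧ ‖T ζ‖ ≤ 2 * ‖ζ‖) ∧
    ∀ t : ℝ, 0 ≤ t → T ((t + t ^ (m + 1) : ℝ) : ℂ) = t := by
  obtain ⟨κ, hκ0, hκ1, hκ⟩ := exists_deriv_oscillation m hm
  set φ : ℂ → ℂ := fun x => x + x ^ (m + 1) with hφ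
  have hφ' : ∀ x, HasDerivAt φ (1 + (m + 1) * x ^ m) x := by
    intro x
    exact ((hasDerivAt_id x).add (hasDerivAt_pow (m + 1) x)).congr_deriv (by simp)
  have hre : ∀ x ∈ conicNhd κ, 1 / 2 ≤ (1 + (m + 1) * x ^ m : ℂ).re := by
    rintro x ⟨t, ht, hxt⟩
    have h1 := (Complex.abs_re_le_norm _).trans (hκ t ht x hxt.le)
    rw [Complex.sub_re, Complex.ofReal_re] at h1
    have h2 := (abs_le.1 h1).1
    have : (0 : ℝ) ≤ (m + 1) * t ^ m := by positivity
    linarith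
  have hexp : ∀ a ∈ conicNhd κ, ∀ b ∈ conicNhd κ, ‖a - b‖ ≤ 2 * ‖φ a - φ b‖ := fun a ha b hb =>
    norm_sub_le_of_half_le_re (convex_conicNhd κ) (fun x _ => hφ' x) hre ha hb
  have hinj : Set.InjOn φ (conicNhd κ) := by
    intro a ha b hb hab
    have := hexp a ha b hb
    rw [hab, sub_self, norm_zero, mul_zero] at this
    exact sub_eq_zero.1 (norm_le_zero_iff.1 this)
  have hsurj : Set.SurjOn φ (conicNhd κ) (conicNhd (κ / 4)) := by
    rintro v ⟨s, hs, hvs⟩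
    obtain ⟨t, ht, hts⟩ : ∃ t : ℝ, 0 ≤ t ∧ t + t ^ (m + 1) = s := by
      have hc : ContinuousOn (fun t : ℝ => t + t ^ (m + 1)) (Set.Icc 0 s) := by fun_prop
      have := intermediate_value_Icc hs hc
      obtain ⟨t, ht, hts⟩ := this ⟨by simpa using hs, by
        simpa using pow_nonneg hs (m + 1)⟩
      exact ⟨t, ht.1, hts⟩
    set D : ℝ := 1 + (m + 1) * t ^ m with hD
    have hD1 : 1 ≤ D := by
      have : (0 : ℝ) ≤ (m + 1) * t ^ m := by positivity
      linarith
    have hD0 : (D : ℂ) ≠ 0 := by exact_mod_cast (by linarith : D ≠ 0)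
    -- after division by `φ' t` the map is close to the identity
    have happ : ApproximatesLinearOn (fun x => φ x / D)
        ((ContinuousLinearEquiv.refl ℂ ℂ : ℂ ≃L[ℂ] ℂ) : ℂ →L[ℂ] ℂ)
        (Metric.closedBall (t : ℂ) (κ * (1 + t))) (1 / 2) := by
      intro x hx y hy
      have hd : ∀ z ∈ Metric.closedBall (t : ℂ) (κ * (1 + t)),
          HasDerivWithinAt (fun x => φ x / D - x) ((1 + (m + 1) * z ^ m) / D - 1)
            (Metric.closedBall (t : ℂ) (κ * (1 + t))) z := fun z _ =>
        (((hφ' z).div_const _).sub (hasDerivAt_id z)).hasDerivWithinAt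
      have := (convex_closedBall (t : ℂ) (κ * (1 + t))).norm_image_sub_le_of_norm_hasDerivWithin_le
        (C := 1 / 2) hd (fun z hz => ?_) hy hx
      · calc _ = ‖φ x / D - x - (φ y / D - y)‖ := by
              congr 1
              simp
              ring
          _ ≤ _ := by simpa using this
      · have h1 := hκ t ht z hz
        have e : (1 + (m + 1) * z ^ m) / (D : ℂ) - 1 = ((1 + (m + 1) * z ^ m) - (D : ℂ)) / D := by
          field_simp
        rw [e, norm_div, Complex.norm_real, Real.norm_eq_abs, abs_of_pos (by linarith),
          div_le_iff₀ (by linarith)]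
        exact h1
    have hball := happ.surjOn_closedBall_of_nonlinearRightInverse
      (ContinuousLinearEquiv.refl ℂ ℂ).toNonlinearRightInverse (ε := κ * (1 + t) / 2) (b := (t : ℂ))
      (by positivity) (Metric.closedBall_subset_closedBall (by
        have : 0 ≤ κ * (1 + t) := by positivity
        linarith))
    have hnn : (((ContinuousLinearEquiv.refl ℂ ℂ).toNonlinearRightInverse.nnnorm : ℝ)) = 1 := by
      simp [ContinuousLinearEquiv.toNonlinearRightInverse]
    rw [hnn] at hball
    have hφt : φ t = s := by
      rw [hφ, ← hts]
      push_cast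
      ring
    obtain ⟨x, hx, hxv⟩ := hball (a := v / D) (by
      rw [Metric.mem_closedBall, dist_eq_norm, hφt, ← sub_div, norm_div, Complex.norm_real,
        Real.norm_eq_abs, abs_of_pos (by linarith), div_le_iff₀ (by linarith), ← dist_eq_norm]
      refine hvs.le.trans ?_
      have h2 : 1 + s ≤ (1 + t) * D := by
        rw [hD, ← hts, pow_succ]
        have : 0 ≤ t ^ m := by positivity
        have h3 : 0 ≤ (m : ℝ) * t ^ m * (1 + t) := by positivity
        nlinarith
      have h3 : κ * (1 + s) ≤ κ * ((1 + t) * D) := by gcongr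
      simp
      nlinarith)
    refine ⟨x, ⟨t, ht, ?_⟩, ?_⟩
    · have := Metric.mem_closedBall.1 hx
      have h5 : 0 < κ * (1 + t) := by positivity
      linarith
    · have : φ x / D = v / D := hxv
      field_simp at this
      exact this
  set T := Function.invFunOn φ (conicNhd κ) with hT
  have hTmem : ∀ ζ ∈ conicNhd (κ / 4), T ζ ∈ conicNhd κ := fun ζ hζ =>
    Function.invFunOn_mem (hsurj hζ)
  have hTeq : ∀ ζ ∈ conicNhd (κ / 4), φ (T ζ) = ζ := fun ζ hζ =>
    Function.invFunOn_eq (hsurj hζ)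
  have h0mem : (0 : ℂ) ∈ conicNhd κ := by
    simpa using ofReal_mem_conicNhd hκ0 (le_refl (0 : ℝ))
  have hlip : ∀ a ∈ conicNhd (κ / 4), ∀ b ∈ conicNhd (κ / 4), ‖T a - T b‖ ≤ 2 * ‖a - b‖ := by
    intro a ha b hb
    have := hexp _ (hTmem a ha) _ (hTmem b hb)
    rwa [hTeq a ha, hTeq b hb] at this
  refine ⟨κ / 4, by positivity, by linarith, T, ?_, ?_, ?_⟩
  · intro ζ hζ
    have hnhds := (isOpen_conicNhd (κ / 4)).mem_nhds hζ
    refine (HasDerivAt.of_local_left_inverse ?_ (hφ' (T ζ))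
      ?_ ?_).differentiableAt.differentiableWithinAt
    · rw [Metric.continuousAt_iff]
      intro ε hε
      obtain ⟨r, hr, hrsub⟩ := Metric.mem_nhds_iff.1 hnhds
      refine ⟨min r (ε / 2), by positivity, fun {y} hy => ?_⟩
      have h1 := hlip y (hrsub (hy.trans_le (min_le_left _ _))) ζ hζ
      have h2 := hy.trans_le (min_le_right _ _)
      rw [dist_eq_norm] at h2 ⊢
      linarith
    · intro h0
      have := hre _ (hTmem ζ hζ)
      rw [h0] at this
      norm_num at this
    · filter_upwards [hnhds] with y hy using hTeq y hy
  · intro ζ hζ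
    refine ⟨hTeq ζ hζ, ?_⟩
    have := hexp _ (hTmem ζ hζ) _ h0mem
    rw [hTeq ζ hζ] at this
    simpa [hφ] using this
  · intro t ht
    have hmem : ((t + t ^ (m + 1) : ℝ) : ℂ) ∈ conicNhd (κ / 4) :=
      ofReal_mem_conicNhd (by positivity) (by positivity)
    refine hinj (hTmem _ hmem) (ofReal_mem_conicNhd hκ0 ht) ?_
    rw [hTeq _ hmem, hφ]
    push_cast
    ring

/-! ### The Borel transform of the radial integral -/

/-- Cauchy's estimate for the `(d + 1)`-st derivative of `T ^ d / d!`. -/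
theorem norm_iteratedDeriv_succ_pow_le {T : ℂ → ℂ} {U : Set ℂ} (hT : DifferentiableOn ℂ T U)
    (d : ℕ) {x : ℂ} {R A : ℝ} (hR : 0 < R) (hU : Metric.closedBall x R ⊆ U)
    (hA : ∀ ζ ∈ Metric.sphere x R, ‖T ζ‖ ≤ A) :
    ‖iteratedDeriv (d + 1) (fun x => T x ^ d / (d.factorial : ℂ)) x‖ ≤
      (d + 1) / R * (A / R) ^ d := by
  have hfac : (0 : ℝ) < d.factorial := by exact_mod_cast d.factorial_pos
  refine (Complex.norm_iteratedDeriv_le_of_forall_mem_sphere_norm_le (C := A ^ d / d.factorial)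
    (d + 1) hR ?_ ?_).trans (le_of_eq ?_)
  · refine DifferentiableOn.diffContOnCl ?_
    rw [closure_ball _ hR.ne']
    exact ((hT.mono hU).pow d).div_const _
  · intro ζ hζ
    rw [norm_div, norm_pow, Complex.norm_natCast]
    have := hA ζ hζ
    gcongr
  · rw [Nat.factorial_succ, div_pow, pow_succ]
    push_cast
    field_simp

/-- The derivative of the `d`-th derivative of `T ^ d / d!` is bounded by `Λ D e ^ (Λ D ‖x‖)`, where
`D = d ^ (1 + 1 / m)` and `Λ` does not depend on `d`. For `‖x‖ ≤ η d ^ (-1 / m)` this is Cauchy's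
estimate on a circle of radius `η d ^ (-1 / m)`, on which `T` is the identity up to a relative error
`O(1 / d)`; for larger `‖x‖` a circle of radius proportional to `‖x‖` yields `e ^ O(d)`, which is
absorbed into the exponential. -/
theorem exists_norm_iteratedDeriv_succ_pow_le {m : ℕ} (hm : 1 ≤ m) {κ : ℝ} (hκ0 : 0 < κ)
    (hκ1 : κ ≤ 1) {T : ℂ → ℂ} (hT : DifferentiableOn ℂ T (conicNhd κ))
    (hT' : ∀ ζ ∈ conicNhd κ, T ζ + T ζ ^ (m + 1) = ζ ∧ ‖T ζ‖ ≤ 2 * ‖ζ‖) :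
    ∃ Λ : ℝ, 0 < Λ ∧ ∀ d : ℕ, 1 ≤ d → ∀ x ∈ rayNhd (κ / 4),
      ‖iteratedDeriv (d + 1) (fun x => T x ^ d / (d.factorial : ℂ)) x‖ ≤
        Λ * (d : ℝ) ^ (1 + 1 / (m : ℝ)) * Real.exp (Λ * (d : ℝ) ^ (1 + 1 / (m : ℝ)) * ‖x‖) := by
  have hmr : (0 : ℝ) < m := by exact_mod_cast hm
  set η := κ / 4 with hη
  have hη0 : 0 < η := by positivity
  have hη1 : η ≤ 1 / 4 := by linarith
  refine ⟨2 * Real.exp (2 ^ (m + 1)) / η + 4 / η ^ 2, by positivity, fun d hd x hx => ?_⟩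
  set Λ := 2 * Real.exp (2 ^ (m + 1)) / η + 4 / η ^ 2 with hΛ
  have hdr : (1 : ℝ) ≤ d := by exact_mod_cast hd
  set S := (d : ℝ) ^ (1 / (m : ℝ)) with hS
  have hS1 : 1 ≤ S := Real.one_le_rpow hdr (by positivity)
  have hSm : S ^ m = d := by
    rw [hS, ← Real.rpow_natCast, ← Real.rpow_mul (by linarith), one_div, inv_mul_cancel₀ hmr.ne',
      Real.rpow_one]
  have hD : (d : ℝ) ^ (1 + 1 / (m : ℝ)) = d * S := by
    rw [Real.rpow_add (by linarith), Real.rpow_one]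
  rw [hD]
  have hT2 : ∀ ζ ∈ conicNhd κ, ‖T ζ‖ ≤ ‖ζ‖ * (1 + 2 ^ (m + 1) * ‖ζ‖ ^ m) := by
    intro ζ hζ
    obtain ⟨h1, h2⟩ := hT' ζ hζ
    have h3 : T ζ = ζ - T ζ ^ (m + 1) := eq_sub_of_add_eq h1
    calc ‖T ζ‖ = ‖ζ - T ζ ^ (m + 1)‖ := by rw [← h3]
      _ ≤ ‖ζ‖ + ‖T ζ‖ ^ (m + 1) := by
        rw [← norm_pow]
        exact norm_sub_le _ _
      _ ≤ ‖ζ‖ + (2 * ‖ζ‖) ^ (m + 1) := by gcongr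
      _ = _ := by ring
  have hsph : ∀ {R : ℝ} {ζ : ℂ}, ζ ∈ Metric.sphere x R → ‖ζ‖ ≤ ‖x‖ + R := by
    intro R ζ hζ
    have h1 := norm_add_le x (ζ - x)
    rw [add_sub_cancel, ← dist_eq_norm, Metric.mem_sphere.1 hζ] at h1
    exact h1
  have hΛ1 : 1 / η ≤ Λ := by
    have h1 : 1 / η ≤ 4 / η ^ 2 := by
      rw [div_le_div_iff₀ hη0 (by positivity)]
      nlinarith
    have h2 : 0 ≤ 2 * Real.exp (2 ^ (m + 1)) / η := by positivity
    linarith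
  have hΛ0 : 0 < Λ := lt_of_lt_of_le (by positivity) hΛ1
  rcases le_or_gt ‖x‖ (η / S) with hxs | hxs
  · have hR : 0 < η / S := by positivity
    have hRη : η / S ≤ η := div_le_self hη0.le hS1
    have hsub : Metric.closedBall x (η / S) ⊆ conicNhd κ := by
      intro y hy
      refine ⟨0, le_rfl, ?_⟩
      have h1 := dist_triangle y x 0
      have h2 := Metric.mem_closedBall.1 hy
      rw [dist_zero_right x] at h1
      simp only [Complex.ofReal_zero, add_zero, mul_one]
      linarith
    have hA : ∀ ζ ∈ Metric.sphere x (η / S),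
        ‖T ζ‖ ≤ (‖x‖ + η / S) * (1 + 2 ^ (m + 1) / d) := by
      intro ζ hζ
      have h1 := hsph hζ
      refine (hT2 ζ (hsub (Metric.sphere_subset_closedBall hζ))).trans ?_
      have h2 : ‖ζ‖ ≤ 1 / S := by
        refine h1.trans ?_
        have : η / S ≤ (1 / 4) / S := by gcongr
        have h3 : (1 / 4) / S + (1 / 4) / S ≤ 1 / S := by
          rw [← add_div]
          gcongr
          norm_num
        linarith
      have h3 : 2 ^ (m + 1) * ‖ζ‖ ^ m ≤ 2 ^ (m + 1) / d := by
        rw [div_eq_mul_one_div]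
        gcongr
        calc ‖ζ‖ ^ m ≤ (1 / S) ^ m := by gcongr
          _ = 1 / d := by rw [div_pow, one_pow, hSm]
      gcongr
    refine (norm_iteratedDeriv_succ_pow_le hT d hR hsub hA).trans ?_
    have e1 : ((‖x‖ + η / S) * (1 + 2 ^ (m + 1) / d)) / (η / S) =
        (‖x‖ * S / η + 1) * (2 ^ (m + 1) / d + 1) := by
      field_simp
      ring
    have h4 : (‖x‖ * S / η + 1) ^ d ≤ Real.exp (d * S * ‖x‖ / η) := by
      calc (‖x‖ * S / η + 1) ^ d ≤ Real.exp (‖x‖ * S / η) ^ d := by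
            gcongr
            exact Real.add_one_le_exp _
        _ = _ := by
          rw [← Real.exp_nat_mul]
          congr 1
          ring
    have h5 : ((2 : ℝ) ^ (m + 1) / d + 1) ^ d ≤ Real.exp (2 ^ (m + 1)) := by
      calc ((2 : ℝ) ^ (m + 1) / d + 1) ^ d ≤ Real.exp (2 ^ (m + 1) / d) ^ d := by
            gcongr
            exact Real.add_one_le_exp _
        _ = _ := by
          rw [← Real.exp_nat_mul]
          congr 1
          field_simp
    have h6 : Real.exp (d * S * ‖x‖ / η) ≤ Real.exp (Λ * (d * S) * ‖x‖) := by
      refine Real.exp_le_exp.2 ?_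
      calc d * S * ‖x‖ / η = 1 / η * (d * S) * ‖x‖ := by ring
        _ ≤ _ := by gcongr
    rw [e1, mul_pow]
    calc ((d : ℝ) + 1) / (η / S) * ((‖x‖ * S / η + 1) ^ d * (2 ^ (m + 1) / d + 1) ^ d)
        ≤ (d + d) / (η / S) * (Real.exp (Λ * (d * S) * ‖x‖) * Real.exp (2 ^ (m + 1))) := by
          gcongr
          exact h4.trans h6
      _ = 2 * Real.exp (2 ^ (m + 1)) / η * (d * S) * Real.exp (Λ * (d * S) * ‖x‖) := by
          field_simp
          ring
      _ ≤ _ := by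
          gcongr
          rw [hΛ]
          exact le_add_of_nonneg_right (by positivity)
  · have hx0 : 0 < ‖x‖ := lt_trans (by positivity) hxs
    have hR : 0 < η * ‖x‖ := by positivity
    have hsub : Metric.closedBall x (η * ‖x‖) ⊆ conicNhd κ := by
      intro y hy
      obtain ⟨t, ht, hxt⟩ := mem_rayNhd.1 hx
      refine ⟨t, ht, ?_⟩
      have h1 := dist_triangle y x t
      have h2 := Metric.mem_closedBall.1 hy
      have h3 : ‖x‖ ≤ η + t := by
        have h4 := norm_add_le (x - t) (t : ℂ)
        rw [sub_add_cancel, Complex.norm_real, Real.norm_eq_abs, abs_of_nonneg ht,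
          ← dist_eq_norm] at h4
        linarith
      have h4 : η * ‖x‖ ≤ η * (η + t) := by gcongr
      have h5 : κ = 4 * η := by rw [hη]; ring
      rw [h5]
      nlinarith
    have hA : ∀ ζ ∈ Metric.sphere x (η * ‖x‖), ‖T ζ‖ ≤ 4 * ‖x‖ := by
      intro ζ hζ
      have h1 := hsph hζ
      refine ((hT' ζ (hsub (Metric.sphere_subset_closedBall hζ))).2).trans ?_
      nlinarith
    refine (norm_iteratedDeriv_succ_pow_le hT d hR hsub hA).trans ?_
    have e1 : 4 * ‖x‖ / (η * ‖x‖) = 4 / η := by field_simp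
    have hxS : 1 ≤ S * ‖x‖ / η := by
      rw [le_div_iff₀ hη0, one_mul]
      rw [div_lt_iff₀ (by linarith)] at hxs
      linarith
    have h4 : (4 / η) ^ d ≤ Real.exp (Λ * (d * S) * ‖x‖) := by
      calc (4 / η) ^ d ≤ Real.exp (4 / η) ^ d := by
            gcongr
            linarith [Real.add_one_le_exp (4 / η)]
        _ = Real.exp (4 / η * d * 1) := by
            rw [← Real.exp_nat_mul]
            congr 1
            ring
        _ ≤ Real.exp (4 / η * d * (S * ‖x‖ / η)) := by gcongr
        _ = Real.exp (4 / η ^ 2 * (d * S) * ‖x‖) := by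
            congr 1
            field_simp
        _ ≤ _ := by
            gcongr
            rw [hΛ]
            exact le_add_of_nonneg_left (by positivity)
    have h5 : ((d : ℝ) + 1) / (η * ‖x‖) ≤ 4 / η ^ 2 * (d * S) := by
      calc ((d : ℝ) + 1) / (η * ‖x‖) ≤ (d + d) / (η * ‖x‖) * (S * ‖x‖ / η) := by
            have h7 : ((d : ℝ) + 1) / (η * ‖x‖) ≤ (d + d) / (η * ‖x‖) := by gcongr
            exact h7.trans (le_mul_of_one_le_right (by positivity) hxS)
        _ = 2 / η ^ 2 * (d * S) := by
            field_simp
            ring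
        _ ≤ _ := by
            gcongr
            norm_num
    rw [e1]
    calc ((d : ℝ) + 1) / (η * ‖x‖) * (4 / η) ^ d
        ≤ 4 / η ^ 2 * (d * S) * Real.exp (Λ * (d * S) * ‖x‖) := by gcongr
      _ ≤ _ := by
          gcongr
          rw [hΛ]
          exact le_add_of_nonneg_left (by positivity)

theorem image_add_pow_Ioi (m : ℕ) :
    (fun t : ℝ => t + t ^ (m + 1)) '' Set.Ioi 0 = Set.Ioi 0 := by
  ext s
  constructor
  · rintro ⟨t, ht, rfl⟩
    have ht' : (0 : ℝ) < t := ht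
    exact add_pos ht' (by positivity)
  · intro hs
    have hs' : (0 : ℝ) < s := hs
    have hc : ContinuousOn (fun t : ℝ => t + t ^ (m + 1)) (Set.Icc 0 s) := by fun_prop
    obtain ⟨t, ht, hts⟩ := intermediate_value_Icc hs'.le hc
      ⟨by simpa using hs'.le, by simpa using pow_nonneg hs'.le (m + 1)⟩
    refine ⟨t, lt_of_le_of_ne ht.1 fun h0 => ?_, hts⟩
    rw [← h0] at hts
    simp at hts
    linarith

/-- The density `t ^ (d - 1) e ^ (-t) / (d - 1)!` of the squared norm, integrated against
`e ^ (-w ^ m t ^ (m + 1))`. -/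
noncomputable def radialIntegral (m d : ℕ) (w : ℝ) : ℝ :=
  ∫ t in Set.Ioi (0 : ℝ), t ^ (d - 1) / (d - 1).factorial * Real.exp (-t - w ^ m * t ^ (m + 1))

theorem integral_gamma_density {d : ℕ} (hd : 1 ≤ d) :
    IntegrableOn (fun t : ℝ => t ^ (d - 1) / (d - 1).factorial * Real.exp (-t)) (Set.Ioi 0) ∧
    ∫ t in Set.Ioi (0 : ℝ), t ^ (d - 1) / (d - 1).factorial * Real.exp (-t) = 1 := by
  obtain ⟨n, rfl⟩ : ∃ n, d = n + 1 := ⟨d - 1, by omega⟩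
  have hn : (0 : ℝ) < n + 1 := by positivity
  have hfac : ((n.factorial : ℕ) : ℝ) ≠ 0 := by exact_mod_cast n.factorial_ne_zero
  have h1 := Real.GammaIntegral_convergent hn
  have h2 := Real.Gamma_eq_integral hn
  have e : ∀ t : ℝ, t ^ (n + 1 - 1) / ((n + 1 - 1).factorial : ℝ) * Real.exp (-t) =
      (n.factorial : ℝ)⁻¹ * (Real.exp (-t) * t ^ ((n : ℝ) + 1 - 1)) := by
    intro t
    rw [add_sub_cancel_right, Real.rpow_natCast, Nat.add_sub_cancel]
    ring
  simp_rw [e]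
  refine ⟨h1.const_mul _, ?_⟩
  rw [integral_const_mul, ← h2, Real.Gamma_nat_eq_factorial, inv_mul_cancel₀ hfac]

theorem radialIntegral_nonneg (m d : ℕ) (w : ℝ) : 0 ≤ radialIntegral m d w :=
  setIntegral_nonneg measurableSet_Ioi fun t ht => by
    have : (0 : ℝ) < t := ht
    positivity

theorem radialIntegral_le_one (m : ℕ) {d : ℕ} (hd : 1 ≤ d) {w : ℝ} (hw : 0 ≤ w) :
    radialIntegral m d w ≤ 1 := by
  rw [← (integral_gamma_density hd).2, radialIntegral]
  refine integral_mono_of_nonneg ?_ (integral_gamma_density hd).1 ?_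
  · refine (ae_restrict_iff' measurableSet_Ioi).2 (Filter.Eventually.of_forall fun t ht => ?_)
    have : (0 : ℝ) < t := ht
    simp only [Pi.zero_apply]
    positivity
  · refine (ae_restrict_iff' measurableSet_Ioi).2 (Filter.Eventually.of_forall fun t ht => ?_)
    have : (0 : ℝ) < t := ht
    simp only
    gcongr
    have : 0 ≤ w ^ m * t ^ (m + 1) := by positivity
    linarith

theorem tendsto_radialIntegral {m : ℕ} (hm : 1 ≤ m) {d : ℕ} (hd : 1 ≤ d) :
    Filter.Tendsto (radialIntegral m d) (nhdsWithin 0 (Set.Ioi 0)) (nhds 1) := by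
  have h := tendsto_integral_filter_of_dominated_convergence (l := nhdsWithin (0 : ℝ) (Set.Ioi 0))
    (F := fun w t => t ^ (d - 1) / (d - 1).factorial * Real.exp (-t - w ^ m * t ^ (m + 1)))
    (f := fun t => t ^ (d - 1) / (d - 1).factorial * Real.exp (-t))
    (μ := volume.restrict (Set.Ioi (0 : ℝ))) _
    (Filter.Eventually.of_forall fun w => Continuous.aestronglyMeasurable (by fun_prop)) ?_
    (integral_gamma_density hd).1 ?_
  · rwa [(integral_gamma_density hd).2] at h
  · filter_upwards [self_mem_nhdsWithin] with w hw
    refine (ae_restrict_iff' measurableSet_Ioi).2 (Filter.Eventually.of_forall fun t ht => ?_)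
    have ht' : (0 : ℝ) < t := ht
    have hw' : (0 : ℝ) < w := hw
    rw [Real.norm_eq_abs, abs_of_nonneg (by positivity)]
    gcongr
    have : 0 ≤ w ^ m * t ^ (m + 1) := by positivity
    linarith
  · refine Filter.Eventually.of_forall fun t => ?_
    have hc : Continuous fun w : ℝ =>
        t ^ (d - 1) / (d - 1).factorial * Real.exp (-t - w ^ m * t ^ (m + 1)) := by fun_prop
    have := (hc.tendsto 0).mono_left (nhdsWithin_le_nhds (s := Set.Ioi (0 : ℝ)))
    simpa [Nat.one_le_iff_ne_zero.1 hm] using this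

/-- The substitution `x = t + t ^ (m + 1)`, `t = T x`, turns the radial integral into a Laplace
integral of the derivative of `T ^ d / d!`. -/
theorem laplaceIoi_deriv_pow {m : ℕ} {κ : ℝ} (hκ0 : 0 < κ) {T : ℂ → ℂ}
    (hT : DifferentiableOn ℂ T (conicNhd κ)) (hT' : ∀ ζ ∈ conicNhd κ, T ζ + T ζ ^ (m + 1) = ζ)
    (hTr : ∀ t : ℝ, 0 ≤ t → T ((t + t ^ (m + 1) : ℝ) : ℂ) = t) {d : ℕ} (hd : 1 ≤ d) {w : ℝ}
    (hw : 0 < w) :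
    laplaceIoi (deriv fun x => T x ^ d / (d.factorial : ℂ)) (w : ℂ)⁻¹ =
      ((w ^ d * radialIntegral m d w : ℝ) : ℂ) := by
  obtain ⟨n, rfl⟩ : ∃ n, d = n + 1 := ⟨d - 1, by omega⟩
  have hsubst := integral_image_eq_integral_abs_deriv_smul (s := Set.Ioi (0 : ℝ))
    (f := fun t : ℝ => t + t ^ (m + 1)) (f' := fun t => 1 + (m + 1) * t ^ m) measurableSet_Ioi
    (fun t _ => (((hasDerivAt_id t).add (hasDerivAt_pow (m + 1) t)).congr_deriv
      (by simp)).hasDerivWithinAt) ?_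
    (fun x : ℝ => deriv (fun x => T x ^ (n + 1) / ((n + 1).factorial : ℂ)) x *
      Complex.exp (-((w : ℂ)⁻¹ * x)))
  · rw [image_add_pow_Ioi] at hsubst
    rw [laplaceIoi, hsubst]
    have hscale := integral_comp_mul_left_Ioi
      (fun t : ℝ => t ^ n / n.factorial * Real.exp (-((t + t ^ (m + 1)) / w))) 0 hw
    have e1 : ∫ t in Set.Ioi (0 : ℝ), |1 + ((m : ℝ) + 1) * t ^ m| •
        (deriv (fun x => T x ^ (n + 1) / ((n + 1).factorial : ℂ)) ((t + t ^ (m + 1) : ℝ) : ℂ) *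
          Complex.exp (-((w : ℂ)⁻¹ * ((t + t ^ (m + 1) : ℝ) : ℂ)))) =
        ∫ t in Set.Ioi (0 : ℝ),
          ((t ^ n / n.factorial * Real.exp (-((t + t ^ (m + 1)) / w)) : ℝ) : ℂ) := by
      refine setIntegral_congr_fun measurableSet_Ioi fun t ht => ?_
      have ht' : (0 : ℝ) < t := ht
      have hx : ((t + t ^ (m + 1) : ℝ) : ℂ) ∈ conicNhd κ :=
        ofReal_mem_conicNhd hκ0 (by positivity)
      set x := ((t + t ^ (m + 1) : ℝ) : ℂ) with hxdef
      have hnhds := (isOpen_conicNhd κ).mem_nhds hx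
      have hTd := ((hT x hx).differentiableAt hnhds).hasDerivAt
      have hTx : T x = t := hTr t ht'.le
      -- differentiate `T ζ + T ζ ^ (m + 1) = ζ`
      have hT1 : deriv T x * (1 + (m + 1) * (t : ℂ) ^ m) = 1 := by
        have h1 := hTd.add (hTd.pow (m + 1))
        have h2 : HasDerivAt (T + T ^ (m + 1)) 1 x := by
          refine (hasDerivAt_id x).congr_of_eventuallyEq ?_
          filter_upwards [hnhds] with y hy using hT' y hy
        have := h1.unique h2
        rw [hTx, Nat.add_sub_cancel] at this
        push_cast at this
        linear_combination this
      have hq : deriv (fun x => T x ^ (n + 1) / ((n + 1).factorial : ℂ)) x =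
          (t : ℂ) ^ n / n.factorial * deriv T x := by
        have hfac : ((n.factorial : ℕ) : ℂ) ≠ 0 := by exact_mod_cast n.factorial_ne_zero
        have hn1 : ((n : ℂ) + 1) ≠ 0 := by exact_mod_cast n.succ_ne_zero
        have h3 : HasDerivAt (fun x => T x ^ (n + 1) / ((n + 1).factorial : ℂ))
            (((n + 1 : ℕ) : ℂ) * T x ^ (n + 1 - 1) * deriv T x / ((n + 1).factorial : ℂ)) x :=
          (hTd.pow (n + 1)).div_const _
        rw [h3.deriv, hTx, Nat.factorial_succ, Nat.add_sub_cancel]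
        push_cast
        field_simp
      rw [hq, abs_of_pos (by positivity), Complex.real_smul]
      generalize deriv T x = D at hT1
      rw [hxdef]
      push_cast
      rw [div_eq_inv_mul ((t : ℂ) + t ^ (m + 1)) (w : ℂ)]
      linear_combination ((t : ℂ) ^ n / n.factorial *
        Complex.exp (-((w : ℂ)⁻¹ * (t + t ^ (m + 1))))) * hT1
    rw [e1, integral_complex_ofReal]
    congr 1
    rw [mul_zero, smul_eq_mul, eq_inv_mul_iff_mul_eq₀ hw.ne'] at hscale
    rw [← hscale, radialIntegral, Nat.add_sub_cancel, pow_succ', mul_assoc]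
    congr 1
    rw [← integral_const_mul]
    refine setIntegral_congr_fun measurableSet_Ioi fun t ht => ?_
    rw [mul_pow, mul_pow]
    have : -((w * t + w ^ (m + 1) * t ^ (m + 1)) / w) = -t - w ^ m * t ^ (m + 1) := by
      field_simp
      ring
    rw [this]
    ring
  · refine StrictMonoOn.injOn fun a ha b hb hab => ?_
    have ha' : (0 : ℝ) < a := ha
    have : a ^ (m + 1) < b ^ (m + 1) := pow_lt_pow_left₀ hab ha'.le (by omega)
    linarith

/-- The radial integral is the Borel integral of the kernel `(T ^ d / d!)^(d)`, where `T` is the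
inverse of `x + x ^ (m + 1)`. -/
theorem exists_radial_kernel (m : ℕ) (hm : 1 ≤ m) : ∃ κ : ℝ, 0 < κ ∧ ∃ Λ : ℝ, 0 < Λ ∧
    ∀ d : ℕ, 1 ≤ d → ∃ (Q : ℂ → ℂ) (C : ℝ), IsBorelKernel κ 2 C Q ∧ Q 0 = 1 ∧
      (∀ x ∈ rayNhd κ, ‖deriv Q x‖ ≤
        Λ * (d : ℝ) ^ (1 + 1 / (m : ℝ)) * Real.exp (Λ * (d : ℝ) ^ (1 + 1 / (m : ℝ)) * ‖x‖)) ∧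
      ∀ w : ℝ, 0 < w → 2 < w⁻¹ → borelIntegral Q w = radialIntegral m d w := by
  obtain ⟨κ, hκ0, hκ1, T, hT, hT', hTr⟩ := exists_inverse m hm
  obtain ⟨Λ, hΛ, hbound⟩ := exists_norm_iteratedDeriv_succ_pow_le hm hκ0 hκ1 hT hT'
  refine ⟨κ / 4, by positivity, Λ, hΛ, fun d hd => ?_⟩
  set q : ℂ → ℂ := fun x => T x ^ d / (d.factorial : ℂ) with hq
  have hd0 : d ≠ 0 := by omega
  have hker : IsBorelKernel κ 2 1 q := by
    refine ⟨((hT.mono (rayNhd_subset_conicNhd hκ0.le)).pow d).div_const _, fun v hv => ?_⟩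
    rw [hq, norm_div, norm_pow, Complex.norm_natCast, one_mul]
    refine le_trans ?_ (Real.pow_div_factorial_le_exp (2 * ‖v‖) (by positivity) d)
    have := (hT' v (rayNhd_subset_conicNhd hκ0.le hv)).2
    gcongr
  have h0 : q 0 = 0 := by
    have := hTr 0 le_rfl
    simp only [ne_eq, Nat.add_eq_zero_iff, one_ne_zero, and_false, not_false_eq_true, zero_pow,
      add_zero, Complex.ofReal_zero] at this
    simp [hq, this, hd0]
  have hre : ∀ w : ℝ, ((w : ℂ)⁻¹).re = w⁻¹ := fun w => by
    rw [← Complex.ofReal_inv, Complex.ofReal_re]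
  have hval : ∀ w : ℝ, 0 < w → 2 < w⁻¹ →
      borelIntegral q w = ((w ^ d * radialIntegral m d w : ℝ) : ℂ) := by
    intro w hw hw2
    rw [hker.borelIntegral_eq_add_laplaceIoi hκ0 zero_le_two (by rwa [hre]), h0, zero_add,
      laplaceIoi_deriv_pow hκ0 hT (fun ζ hζ => (hT' ζ hζ).1) hTr hd hw]
  -- the Borel integral of `T ^ d / d!` is `O(w ^ d)`, so the first `d` Taylor coefficients vanish
  have hvanish : ∀ j < d, iteratedDeriv j q 0 = 0 := by
    refine eq_zero_of_sum_isBigO ?_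
    have hO : (fun w : ℝ => borelIntegral q w) =O[nhdsWithin 0 (Set.Ioi 0)] fun w : ℝ => w ^ d := by
      refine Asymptotics.IsBigO.of_bound 1 ?_
      filter_upwards [eventually_lt_inv_re 2, self_mem_nhdsWithin] with w hw2 hw
      have hw' : (0 : ℝ) < w := hw
      rw [hre] at hw2
      rw [hval w hw' hw2, Complex.norm_real, one_mul, norm_mul]
      refine mul_le_of_le_one_right (norm_nonneg _) ?_
      rw [Real.norm_eq_abs, abs_of_nonneg (radialIntegral_nonneg _ _ _)]
      exact radialIntegral_le_one m hd hw'.le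
    refine (hO.sub (hker.borelIntegral_sub_isBigO hκ0 zero_le_two d)).congr_left fun w => ?_
    ring
  have hQ := hker.iteratedDeriv hκ0 zero_le_two d
  have hQval : ∀ w : ℝ, 0 < w → 2 < w⁻¹ →
      borelIntegral (iteratedDeriv d q) w = radialIntegral m d w := by
    intro w hw hw2
    have h1 := hker.borelIntegral_eq_sum_add hκ0 zero_le_two (by rwa [hre]) d (w := (w : ℂ))
    rw [Finset.sum_eq_zero fun j hj => by rw [hvanish j (Finset.mem_range.1 hj), zero_mul],
      zero_add, hval w hw hw2] at h1
    have hwd : ((w : ℂ) ^ d) ≠ 0 := pow_ne_zero _ (by exact_mod_cast hw.ne')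
    refine mul_left_cancel₀ hwd ?_
    rw [← h1]
    push_cast
    rfl
  refine ⟨iteratedDeriv d q, _, hQ.mono (by linarith), ?_, fun x hx => ?_, hQval⟩
  · have h1 := (hQ.borelIntegral_sub_isBigO (half_pos hκ0) zero_le_two 1).trans_tendsto
      (show Filter.Tendsto (fun w : ℝ => w ^ 1) (nhdsWithin 0 (Set.Ioi 0)) (nhds 0) by
        simp only [pow_one]
        exact tendsto_nhdsWithin_of_tendsto_nhds Filter.tendsto_id)
    have h2 : Filter.Tendsto (fun w : ℝ => (radialIntegral m d w : ℂ) - iteratedDeriv d q 0)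
        (nhdsWithin 0 (Set.Ioi 0)) (nhds 0) := by
      refine h1.congr' ?_
      filter_upwards [eventually_lt_inv_re 2, self_mem_nhdsWithin] with w hw2 hw
      rw [hre] at hw2
      rw [hQval w hw hw2]
      simp
    have h3 := ((Complex.continuous_ofReal.tendsto 1).comp (tendsto_radialIntegral hm hd)).sub_const
      (iteratedDeriv d q 0)
    have h4 := tendsto_nhds_unique h2 h3
    rw [Complex.ofReal_one] at h4
    exact (sub_eq_zero.1 h4.symm).symm
  · rw [← iteratedDeriv_succ]
    exact hbound d hd x hx

/-! ### The Gaussian matrix measure and the trace invariant -/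

/-- `Tr M M†`, the sum of the squared moduli of the entries. -/
noncomputable def frobeniusSq (N : ℕ) (M : Fin N → Fin N → ℂ) : ℝ := ∑ i, ∑ j, ‖M i j‖ ^ 2

/-- The real value of `Tr (M M†) ^ k`. -/
noncomputable def tracePower (k N : ℕ) (M : Fin N → Fin N → ℂ) : ℝ := (traceInvariant k N M).re

theorem trace_mul_conjTranspose_re (N : ℕ) (M : Fin N → Fin N → ℂ) :
    (Matrix.of M * (Matrix.of M)ᴴ).trace.re = frobeniusSq N M := by
  rw [Matrix.trace, Complex.re_sum, frobeniusSq]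
  refine Finset.sum_congr rfl fun i _ => ?_
  rw [Matrix.diag_apply, Matrix.mul_apply, Complex.re_sum]
  refine Finset.sum_congr rfl fun j _ => ?_
  rw [Matrix.conjTranspose_apply, Matrix.of_apply, Complex.star_def, Complex.mul_conj,
    Complex.ofReal_re, Complex.normSq_eq_norm_sq]

theorem frobeniusSq_nonneg (N : ℕ) (M : Fin N → Fin N → ℂ) : 0 ≤ frobeniusSq N M := by
  unfold frobeniusSq
  positivity

theorem frobeniusSq_pos {N : ℕ} {M : Fin N → Fin N → ℂ} (hM : M ≠ 0) : 0 < frobeniusSq N M := by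
  obtain ⟨i, hi⟩ := Function.ne_iff.1 hM
  obtain ⟨j, hj⟩ := Function.ne_iff.1 hi
  have h1 : 0 < ‖M i j‖ ^ 2 := by
    have : 0 < ‖M i j‖ := norm_pos_iff.2 hj
    positivity
  refine h1.trans_le ?_
  refine (Finset.single_le_sum (f := fun j => ‖M i j‖ ^ 2) (fun _ _ => by positivity)
    (Finset.mem_univ j)).trans ?_
  exact Finset.single_le_sum (f := fun i => ∑ j, ‖M i j‖ ^ 2) (fun _ _ => by positivity)
    (Finset.mem_univ i)

theorem frobeniusSq_smul (N : ℕ) (r : ℝ) (M : Fin N → Fin N → ℂ) :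
    frobeniusSq N (r • M) = r ^ 2 * frobeniusSq N M := by
  simp only [frobeniusSq, Pi.smul_apply, norm_smul, mul_pow, Real.norm_eq_abs, sq_abs,
    Finset.mul_sum]

theorem continuous_frobeniusSq (N : ℕ) : Continuous (frobeniusSq N) := by
  unfold frobeniusSq
  fun_prop

theorem traceInvariant_smul (k N : ℕ) (r : ℝ) (M : Fin N → Fin N → ℂ) :
    traceInvariant k N (r • M) = ((r ^ 2) ^ k : ℝ) * traceInvariant k N M := by
  have h1 : Matrix.of (r • M) = r • Matrix.of M := rfl
  rw [traceInvariant, traceInvariant, h1, Matrix.conjTranspose_smul, star_trivial, Matrix.smul_mul,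
    Matrix.mul_smul, smul_smul, smul_pow, Matrix.trace_smul, ← pow_two, Complex.real_smul]

theorem tracePower_smul (k N : ℕ) (r : ℝ) (M : Fin N → Fin N → ℂ) :
    tracePower k N (r • M) = (r ^ 2) ^ k * tracePower k N M := by
  rw [tracePower, traceInvariant_smul, Complex.re_ofReal_mul, tracePower]

theorem continuous_traceInvariant (k N : ℕ) : Continuous (traceInvariant k N) := by
  have h1 : Continuous fun M : Fin N → Fin N → ℂ => (Matrix.of M : Matrix (Fin N) (Fin N) ℂ) :=
    continuous_id
  unfold traceInvariant
  exact ((h1.matrix_mul h1.matrix_conjTranspose).pow k).matrix_trace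

theorem continuous_tracePower (k N : ℕ) : Continuous (tracePower k N) :=
  Complex.continuous_re.comp (continuous_traceInvariant k N)

open scoped ComplexOrder in
theorem traceInvariant_nonneg (k N : ℕ) (M : Fin N → Fin N → ℂ) :
    (0 : ℂ) ≤ traceInvariant k N M := by
  exact ((Matrix.posSemidef_self_mul_conjTranspose (Matrix.of M)).pow k).trace_nonneg

open scoped ComplexOrder in
theorem traceInvariant_eq (k N : ℕ) (M : Fin N → Fin N → ℂ) :
    traceInvariant k N M = tracePower k N M := by
  have h := (Complex.le_def.1 (traceInvariant_nonneg k N M)).2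
  apply Complex.ext
  · rfl
  · simpa using h.symm

open scoped ComplexOrder in
theorem tracePower_nonneg (k N : ℕ) (M : Fin N → Fin N → ℂ) : 0 ≤ tracePower k N M :=
  (Complex.le_def.1 (traceInvariant_nonneg k N M)).1

open scoped Matrix.Norms.Frobenius in
/-- `Tr (M M†) ^ k ≤ (Tr M M†) ^ k`, by the Cauchy-Schwarz inequality and the submultiplicativity of
the Frobenius norm. -/
theorem tracePower_le (k N : ℕ) (hk : 2 ≤ k) (M : Fin N → Fin N → ℂ) :
    tracePower k N M ≤ frobeniusSq N M ^ k := by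
  obtain ⟨j, rfl⟩ : ∃ j, k = j + 1 := ⟨k - 1, by omega⟩
  have hsq : ∀ A : Matrix (Fin N) (Fin N) ℂ, ‖A‖ = Real.sqrt (∑ i, ∑ j, ‖A i j‖ ^ 2) := by
    intro A
    rw [Matrix.frobenius_norm_def, Real.sqrt_eq_rpow]
    simp
  have hCS : ∀ A B : Matrix (Fin N) (Fin N) ℂ, ‖(A * B).trace‖ ≤ ‖A‖ * ‖B‖ := by
    intro A B
    have h1 : ‖(A * B).trace‖ ≤ ∑ p : Fin N × Fin N, ‖A p.1 p.2‖ * ‖B p.2 p.1‖ := by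
      rw [Matrix.trace, Fintype.sum_prod_type]
      refine (norm_sum_le _ _).trans (Finset.sum_le_sum fun i _ => ?_)
      rw [Matrix.diag_apply, Matrix.mul_apply]
      refine (norm_sum_le _ _).trans (Finset.sum_le_sum fun l _ => ?_)
      rw [norm_mul]
    refine h1.trans ((Real.sum_mul_le_sqrt_mul_sqrt _ _ _).trans (le_of_eq ?_))
    rw [hsq A, hsq B, Fintype.sum_prod_type, Fintype.sum_prod_type, Finset.sum_comm (f := fun x y =>
      ‖B (x, y).2 (x, y).1‖ ^ 2)]
  set A := Matrix.of M * (Matrix.of M)ᴴ with hA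
  have hAn : ‖A‖ ≤ frobeniusSq N M := by
    refine (norm_mul_le _ _).trans (le_of_eq ?_)
    rw [Matrix.frobenius_norm_conjTranspose, hsq, Real.mul_self_sqrt (by positivity)]
    rfl
  calc tracePower (j + 1) N M ≤ ‖traceInvariant (j + 1) N M‖ := Complex.re_le_norm _
    _ = ‖(A * A ^ j).trace‖ := by rw [traceInvariant, pow_succ']
    _ ≤ ‖A‖ * ‖A ^ j‖ := hCS _ _
    _ ≤ ‖A‖ * ‖A‖ ^ j := by
      gcongr
      exact norm_pow_le' A (by omega)
    _ = ‖A‖ ^ (j + 1) := (pow_succ' _ _).symm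
    _ ≤ _ := by gcongr

theorem integral_exp_neg_frobeniusSq (N : ℕ) {b : ℝ} (hb : 0 < b) :
    ∫ M : Fin N → Fin N → ℂ, Real.exp (-b * frobeniusSq N M) = (Real.pi / b) ^ (N ^ 2) := by
  have h1 : ∀ M : Fin N → Fin N → ℂ, Real.exp (-b * frobeniusSq N M) =
      ∏ i, ∏ j, Real.exp (-b * ‖M i j‖ ^ 2) := by
    intro M
    simp_rw [← Real.exp_sum, ← Finset.mul_sum]
    rfl
  simp_rw [h1]
  rw [integral_fintype_prod_volume_eq_pow (fun v : Fin N → ℂ => ∏ j, Real.exp (-b * ‖v j‖ ^ 2)),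
    integral_fintype_prod_volume_eq_pow (fun z : ℂ => Real.exp (-b * ‖z‖ ^ 2)),
    GaussianFourier.integral_rexp_neg_mul_sq_norm hb, Complex.finrank_real_complex, Fintype.card_fin]
  norm_num
  rw [← pow_mul, pow_two]

theorem integrable_exp_neg_frobeniusSq (N : ℕ) {b : ℝ} (hb : 0 < b) :
    Integrable fun M : Fin N → Fin N → ℂ => Real.exp (-b * frobeniusSq N M) := by
  by_contra h
  have h1 := integral_exp_neg_frobeniusSq N hb
  rw [integral_undef h] at h1
  have : 0 < (Real.pi / b) ^ (N ^ 2) := by positivity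
  linarith

/-- The density of the Gaussian matrix measure. -/
noncomputable def gaussianDensity (N : ℕ) (M : Fin N → Fin N → ℂ) : ℝ :=
  (Real.pi ^ (N ^ 2))⁻¹ * Real.exp (-frobeniusSq N M)

theorem continuous_gaussianDensity (N : ℕ) : Continuous (gaussianDensity N) := by
  have := continuous_frobeniusSq N
  unfold gaussianDensity
  fun_prop

theorem gaussianDensity_nonneg (N : ℕ) (M : Fin N → Fin N → ℂ) : 0 ≤ gaussianDensity N M := by
  unfold gaussianDensity
  positivity

theorem gaussianMatrixMeasure_eq (N : ℕ) : gaussianMatrixMeasure N =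
    volume.withDensity fun M => ENNReal.ofReal (gaussianDensity N M) := by
  simp_rw [gaussianMatrixMeasure, trace_mul_conjTranspose_re]
  rfl

theorem integrable_gaussianMatrixMeasure_iff (N : ℕ) {f : (Fin N → Fin N → ℂ) → ℝ} :
    Integrable f (gaussianMatrixMeasure N) ↔
      Integrable fun M => f M * gaussianDensity N M := by
  rw [gaussianMatrixMeasure_eq, integrable_withDensity_iff
    (continuous_gaussianDensity N).measurable.ennreal_ofReal (by simp)]
  simp_rw [ENNReal.toReal_ofReal (gaussianDensity_nonneg N _)]

instance isProbabilityMeasure_gaussianMatrixMeasure (N : ℕ) :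
    IsProbabilityMeasure (gaussianMatrixMeasure N) := by
  refine ⟨?_⟩
  have h1 := integral_exp_neg_frobeniusSq N one_pos
  have h2 := integrable_exp_neg_frobeniusSq N one_pos
  simp only [neg_mul, one_mul, div_one] at h1 h2
  have h3 : Integrable (gaussianDensity N) := h2.const_mul _
  rw [gaussianMatrixMeasure_eq, withDensity_apply _ MeasurableSet.univ, Measure.restrict_univ,
    ← ofReal_integral_eq_lintegral_ofReal h3
      (Filter.Eventually.of_forall fun M => gaussianDensity_nonneg N M)]
  simp_rw [gaussianDensity]
  rw [integral_const_mul, h1, inv_mul_cancel₀ (by positivity), ENNReal.ofReal_one]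

/-- All moments of the trace invariant are finite. -/
theorem integrable_tracePower_pow {k : ℕ} (hk : 2 ≤ k) (N n : ℕ) :
    Integrable (fun M => tracePower k N M ^ n) (gaussianMatrixMeasure N) := by
  rw [integrable_gaussianMatrixMeasure_iff]
  have hc : Continuous fun M => tracePower k N M ^ n * gaussianDensity N M :=
    ((continuous_tracePower k N).pow n).mul (continuous_gaussianDensity N)
  refine Integrable.mono' ((integrable_exp_neg_frobeniusSq N (one_half_pos (α := ℝ))).const_mul
    ((k * n).factorial * 2 ^ (k * n) * (Real.pi ^ (N ^ 2))⁻¹)) hc.aestronglyMeasurable ?_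
  refine Filter.Eventually.of_forall fun M => ?_
  have hs := frobeniusSq_nonneg N M
  have hP := tracePower_nonneg k N M
  have hP' := tracePower_le k N hk M
  set s := frobeniusSq N M with hsdef
  rw [Real.norm_eq_abs, abs_of_nonneg (mul_nonneg (by positivity) (gaussianDensity_nonneg N M)),
    gaussianDensity, ← hsdef]
  have h1 : s ^ (k * n) ≤ (k * n).factorial * 2 ^ (k * n) * Real.exp (s / 2) := by
    have h2 := Real.pow_div_factorial_le_exp (s / 2) (by positivity) (k * n)
    rw [div_pow, div_div, div_le_iff₀ (by positivity)] at h2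
    linarith
  have h3 : Real.exp (s / 2) * Real.exp (-s) = Real.exp (-(1 / 2) * s) := by
    rw [← Real.exp_add]
    congr 1
    ring
  calc tracePower k N M ^ n * ((Real.pi ^ (N ^ 2))⁻¹ * Real.exp (-s))
      ≤ (s ^ k) ^ n * ((Real.pi ^ (N ^ 2))⁻¹ * Real.exp (-s)) := by gcongr
    _ = s ^ (k * n) * ((Real.pi ^ (N ^ 2))⁻¹ * Real.exp (-s)) := by rw [pow_mul]
    _ ≤ ((k * n).factorial * 2 ^ (k * n) * Real.exp (s / 2)) *
        ((Real.pi ^ (N ^ 2))⁻¹ * Real.exp (-s)) := by gcongr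
    _ = _ := by
      rw [← h3]
      ring

theorem lintegral_smul_matrix (N : ℕ) (f : (Fin N → Fin N → ℂ) → ENNReal) {r : ℝ} (hr : 0 < r) :
    ∫⁻ M, f (r • M) = ENNReal.ofReal ((r ^ 2) ^ (N ^ 2))⁻¹ * ∫⁻ M, f M := by
  have hv : ∀ _ : Fin N, (volume : Measure (Fin N → ℂ)).IsAddHaarMeasure := fun _ =>
    inferInstanceAs (Measure.pi fun _ : Fin N => (volume : Measure ℂ)).IsAddHaarMeasure
  have : (volume : Measure (Fin N → Fin N → ℂ)).IsAddHaarMeasure :=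
    Measure.pi.isAddHaarMeasure (μ := fun _ : Fin N => (volume : Measure (Fin N → ℂ)))
  have h1 : Measure.map (r • ·) (volume : Measure (Fin N → Fin N → ℂ)) =
      ENNReal.ofReal |(r ^ Module.finrank ℝ (Fin N → Fin N → ℂ))⁻¹| • volume :=
    Measure.map_addHaar_smul _ hr.ne'
  have h2 : Module.finrank ℝ (Fin N → Fin N → ℂ) = 2 * N ^ 2 := by
    rw [Module.finrank_pi_fintype]
    simp_rw [Module.finrank_pi_fintype]
    simp only [Complex.finrank_real_complex, Finset.sum_const, Finset.card_univ, Fintype.card_fin,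
      smul_eq_mul]
    ring
  rw [h2, pow_mul, abs_of_pos (by positivity)] at h1
  have he : MeasurableEmbedding fun M : Fin N → Fin N → ℂ => r • M :=
    (Homeomorph.smulOfNeZero r hr.ne').measurableEmbedding
  rw [← he.lintegral_map, h1, lintegral_smul_measure, smul_eq_mul]

/-! ### Separation of the radial variable -/

/-- The scale-invariant quantity `b = (Tr (M M†) ^ (m + 1) / (Tr M M†) ^ (m + 1)) ^ (1 / m)`, which
lies in `[0, 1]`. The root is taken because `w ^ m Tr (M M†) ^ (m + 1) = (b w) ^ m t ^ (m + 1)` for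
`t = Tr M M†`: the direction of `M` acts on the radial integral by dilating `w`. At `M = 0` the
value is `0`. -/
noncomputable def invariantRoot (m N : ℕ) (M : Fin N → Fin N → ℂ) : ℝ :=
  (tracePower (m + 1) N M / frobeniusSq N M ^ (m + 1)) ^ (1 / (m : ℝ))

theorem invariantRoot_nonneg (m N : ℕ) (M : Fin N → Fin N → ℂ) : 0 ≤ invariantRoot m N M :=
  Real.rpow_nonneg (div_nonneg (tracePower_nonneg _ _ _) (pow_nonneg (frobeniusSq_nonneg _ _) _)) _

theorem invariantRoot_le_one {m : ℕ} (hm : 1 ≤ m) (N : ℕ) (M : Fin N → Fin N → ℂ) :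
    invariantRoot m N M ≤ 1 := by
  have h0 := pow_nonneg (frobeniusSq_nonneg N M) (m + 1)
  exact Real.rpow_le_one (div_nonneg (tracePower_nonneg _ _ _) h0)
    (div_le_one_of_le₀ (tracePower_le _ _ (by omega) M) h0) (by positivity)

theorem invariantRoot_pow {m : ℕ} (hm : 1 ≤ m) (N : ℕ) (M : Fin N → Fin N → ℂ) :
    invariantRoot m N M ^ m = tracePower (m + 1) N M / frobeniusSq N M ^ (m + 1) := by
  rw [invariantRoot, one_div, Real.rpow_inv_natCast_pow _ (by omega)]
  exact div_nonneg (tracePower_nonneg _ _ _) (pow_nonneg (frobeniusSq_nonneg _ _) _)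

theorem measurable_invariantRoot (m N : ℕ) : Measurable (invariantRoot m N) :=
  ((continuous_tracePower _ _).measurable.div
    ((continuous_frobeniusSq N).pow _).measurable).pow_const _

theorem measurable_radialIntegral (m d : ℕ) : Measurable (radialIntegral m d) := by
  have hc : Continuous fun p : ℝ × ℝ => p.2 ^ (d - 1) / (d - 1).factorial *
      Real.exp (-p.2 - p.1 ^ m * p.2 ^ (m + 1)) := by fun_prop
  exact (hc.stronglyMeasurable.integral_prod_right'
    (ν := volume.restrict (Set.Ioi (0 : ℝ)))).measurable

theorem image_const_div_Ioi {s : ℝ} (hs : 0 < s) :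
    (fun x : ℝ => s / x) '' Set.Ioi 0 = Set.Ioi 0 := by
  ext y
  constructor
  · rintro ⟨x, hx, rfl⟩
    exact div_pos hs hx
  · intro hy
    exact ⟨s / y, div_pos hs hy, by field_simp⟩

/-- The Gamma density, rescaled by `s` and weighted by `G`. -/
theorem lintegral_scaled_gamma {d : ℕ} (hd : 1 ≤ d) {s G : ℝ} (hs : 0 < s) (hG : 0 ≤ G) :
    ∫⁻ x in Set.Ioi (0 : ℝ), ENNReal.ofReal
      (G * (s ^ d * x ^ (d - 1) / (d - 1).factorial * Real.exp (-(x * s)))) = ENNReal.ofReal G := by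
  obtain ⟨h1, h2⟩ := integral_gamma_density hd
  have e : ∀ x : ℝ, G * (s ^ d * x ^ (d - 1) / (d - 1).factorial * Real.exp (-(x * s))) =
      G * s * ((s * x) ^ (d - 1) / (d - 1).factorial * Real.exp (-(s * x))) := by
    intro x
    have : s ^ d = s * s ^ (d - 1) := by
      rw [← pow_succ']
      congr 1
      omega
    rw [this, mul_pow, mul_comm x s]
    ring
  simp_rw [e]
  have h3 := (integrableOn_Ioi_comp_mul_left_iff
    (fun t : ℝ => t ^ (d - 1) / (d - 1).factorial * Real.exp (-t)) 0 hs).2 (by rwa [mul_zero])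
  rw [← ofReal_integral_eq_lintegral_ofReal (h3.const_mul (G * s))]
  · congr 1
    rw [integral_const_mul, integral_comp_mul_left_Ioi
      (fun t : ℝ => t ^ (d - 1) / (d - 1).factorial * Real.exp (-t)) 0 hs, mul_zero, h2]
    simp only [smul_eq_mul, mul_one]
    field_simp
  · refine (ae_restrict_iff' measurableSet_Ioi).2 (Filter.Eventually.of_forall fun x hx => ?_)
    have : (0 : ℝ) < x := hx
    simp only [Pi.zero_apply]
    positivity

/-- The radial integral after the substitution `t = s / x`. -/
theorem lintegral_inverted_radial (m : ℕ) {d : ℕ} (hd : 1 ≤ d) {s G b : ℝ} (hs : 0 < s) (hG : 0 ≤ G)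
    (hb : 0 ≤ b) :
    ∫⁻ x in Set.Ioi (0 : ℝ), ENNReal.ofReal (G * (s ^ d / x ^ (d + 1) / (d - 1).factorial *
      Real.exp (-(s / x) - b ^ m * (s / x) ^ (m + 1)))) =
      ENNReal.ofReal (G * radialIntegral m d b) := by
  have hderiv : ∀ x ∈ Set.Ioi (0 : ℝ),
      HasDerivWithinAt (fun x : ℝ => s / x) (-(s / x ^ 2)) (Set.Ioi 0) x := by
    intro x hx
    have hx' : (0 : ℝ) < x := hx
    have := ((hasDerivAt_id x).fun_inv hx'.ne').const_mul s
    refine (this.congr_deriv ?_).hasDerivWithinAt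
    simp only [id]
    ring
  have hinj : Set.InjOn (fun x : ℝ => s / x) (Set.Ioi 0) := by
    intro x hx y hy hxy
    have hx' : (0 : ℝ) < x := hx
    have hy' : (0 : ℝ) < y := hy
    simp only at hxy
    rw [div_eq_div_iff hx'.ne' hy'.ne'] at hxy
    exact (mul_left_cancel₀ hs.ne' hxy).symm
  have hsub := lintegral_image_eq_lintegral_abs_deriv_mul measurableSet_Ioi hderiv hinj
    (fun t => ENNReal.ofReal (G * (t ^ (d - 1) / (d - 1).factorial *
      Real.exp (-t - b ^ m * t ^ (m + 1)))))
  rw [image_const_div_Ioi hs] at hsub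
  have hint : IntegrableOn (fun t : ℝ => t ^ (d - 1) / (d - 1).factorial *
      Real.exp (-t - b ^ m * t ^ (m + 1))) (Set.Ioi 0) := by
    refine Integrable.mono' (integral_gamma_density hd).1
      (Continuous.aestronglyMeasurable (by fun_prop)) ?_
    refine (ae_restrict_iff' measurableSet_Ioi).2 (Filter.Eventually.of_forall fun t ht => ?_)
    have : (0 : ℝ) < t := ht
    rw [Real.norm_eq_abs, abs_of_nonneg (by positivity)]
    gcongr
    have : 0 ≤ b ^ m * t ^ (m + 1) := by positivity
    linarith
  rw [radialIntegral, ← integral_const_mul, ofReal_integral_eq_lintegral_ofReal (hint.const_mul G),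
    hsub]
  · refine setLIntegral_congr_fun measurableSet_Ioi fun x hx => ?_
    have hx' : (0 : ℝ) < x := hx
    rw [← ENNReal.ofReal_mul (abs_nonneg _), abs_neg, abs_of_pos (by positivity)]
    congr 1
    obtain ⟨n, rfl⟩ : ∃ n, d = n + 1 := ⟨d - 1, by omega⟩
    rw [Nat.add_sub_cancel, div_pow s x n]
    field_simp
    ring
  · refine (ae_restrict_iff' measurableSet_Ioi).2 (Filter.Eventually.of_forall fun x hx => ?_)
    have : (0 : ℝ) < x := hx
    simp only [Pi.zero_apply]
    positivity

/-- Under the Gaussian measure `Tr M M†` is Gamma distributed and independent of the direction of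
`M`. With the Gamma density inserted as an additional integral, both sides become integrals over
pairs `(M, x)`, which are exchanged by the dilation `M ↦ x ^ (-1 / 2) M`. -/
theorem integral_exp_tracePower_eq {m : ℕ} (hm : 1 ≤ m) {N : ℕ} (hN : 1 ≤ N) {w : ℝ} (hw : 0 ≤ w) :
    ∫ M, Real.exp (-(w ^ m * tracePower (m + 1) N M)) ∂gaussianMatrixMeasure N =
      ∫ M, radialIntegral m (N ^ 2) (invariantRoot m N M * w) ∂gaussianMatrixMeasure N := by
  have hd : 1 ≤ N ^ 2 := Nat.one_le_pow _ _ hN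
  set d := N ^ 2 with hddef
  have hcs := continuous_frobeniusSq N
  have hcP := continuous_tracePower (m + 1) N
  have hcg := continuous_gaussianDensity N
  have hne : ∀ᵐ M : Fin N → Fin N → ℂ, M ≠ 0 := by
    have hnt : Nonempty (Fin N) := ⟨⟨0, hN⟩⟩
    have : NullSingletonClass (volume : Measure (Fin N → ℂ)) := inferInstance
    exact Measure.ae_ne volume 0
  set Φ : (Fin N → Fin N → ℂ) → ℝ → ENNReal := fun M x => ENNReal.ofReal
    (gaussianDensity N M * Real.exp (-(w ^ m * tracePower (m + 1) N M)) *
      (frobeniusSq N M ^ d * x ^ (d - 1) / (d - 1).factorial * Real.exp (-(x * frobeniusSq N M))))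
    with hΦ
  set Ψ : (Fin N → Fin N → ℂ) → ℝ → ENNReal := fun M x => ENNReal.ofReal
    (gaussianDensity N M * (frobeniusSq N M ^ d / x ^ (d + 1) / (d - 1).factorial *
      Real.exp (-(frobeniusSq N M / x) - (invariantRoot m N M * w) ^ m *
        (frobeniusSq N M / x) ^ (m + 1)))) with hΨ
  have hΦm : Measurable (Function.uncurry Φ) := by
    refine Measurable.ennreal_ofReal (Continuous.measurable ?_)
    fun_prop
  have hΨm : Measurable (Function.uncurry Ψ) := by
    have hms : Measurable fun p : (Fin N → Fin N → ℂ) × ℝ => frobeniusSq N p.1 :=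
      hcs.measurable.comp measurable_fst
    have hmg : Measurable fun p : (Fin N → Fin N → ℂ) × ℝ => gaussianDensity N p.1 :=
      hcg.measurable.comp measurable_fst
    have hmi : Measurable fun p : (Fin N → Fin N → ℂ) × ℝ => invariantRoot m N p.1 :=
      (measurable_invariantRoot m N).comp measurable_fst
    refine Measurable.ennreal_ofReal ?_
    fun_prop
  have hscale : ∀ x ∈ Set.Ioi (0 : ℝ), ∫⁻ M, Φ M x = ∫⁻ M, Ψ M x := by
    intro x hx
    have hx' : (0 : ℝ) < x := hx
    have hr : 0 < (Real.sqrt x)⁻¹ := inv_pos.2 (Real.sqrt_pos.2 hx')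
    have hr2 : (Real.sqrt x)⁻¹ ^ 2 = x⁻¹ := by rw [inv_pow, Real.sq_sqrt hx'.le]
    have h1 := lintegral_smul_matrix N (fun M => Φ M x) hr
    rw [hr2, inv_pow, inv_inv] at h1
    have h2 : ∀ᵐ M : Fin N → Fin N → ℂ,
        Φ ((Real.sqrt x)⁻¹ • M) x = ENNReal.ofReal (x ^ d) * Ψ M x := by
      filter_upwards [hne] with M hM
      have hs := frobeniusSq_pos hM
      simp only [hΦ, hΨ]
      rw [← ENNReal.ofReal_mul (by positivity), gaussianDensity, gaussianDensity, frobeniusSq_smul,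
        tracePower_smul, hr2, mul_pow (invariantRoot m N M) w, invariantRoot_pow hm]
      congr 1
      set s := frobeniusSq N M
      set P := tracePower (m + 1) N M
      have e1 : Real.exp (-(x⁻¹ * s)) * Real.exp (-(w ^ m * (x⁻¹ ^ (m + 1) * P))) *
          Real.exp (-(x * (x⁻¹ * s))) = Real.exp (-s) *
            Real.exp (-(s / x) - P / s ^ (m + 1) * w ^ m * (s / x) ^ (m + 1)) := by
        rw [← Real.exp_add, ← Real.exp_add, ← Real.exp_add]
        congr 1
        rw [div_pow, inv_pow]
        field_simp
        ring
      have e2 : (x⁻¹ * s) ^ d * x ^ (d - 1) = x ^ d * (s ^ d / x ^ (d + 1)) := by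
        obtain ⟨n, hn⟩ : ∃ n, d = n + 1 := ⟨d - 1, by omega⟩
        rw [hn, Nat.add_sub_cancel, mul_pow, inv_pow]
        field_simp
        ring
      calc _ = (Real.pi ^ N ^ 2)⁻¹ * ((d - 1).factorial : ℝ)⁻¹ * ((x⁻¹ * s) ^ d * x ^ (d - 1)) *
            (Real.exp (-(x⁻¹ * s)) * Real.exp (-(w ^ m * (x⁻¹ ^ (m + 1) * P))) *
              Real.exp (-(x * (x⁻¹ * s)))) := by ring
        _ = _ := by
          rw [e1, e2]
          ring
    rw [lintegral_congr_ae h2, lintegral_const_mul' _ _ ENNReal.ofReal_ne_top] at h1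
    have hne0 : ENNReal.ofReal (x ^ d) ≠ 0 := by
      rw [Ne, ENNReal.ofReal_eq_zero, not_le]
      positivity
    exact ((ENNReal.mul_right_inj hne0 ENNReal.ofReal_ne_top).1 h1).symm
  have key : ∫⁻ M, ENNReal.ofReal
        (gaussianDensity N M * Real.exp (-(w ^ m * tracePower (m + 1) N M))) =
      ∫⁻ M, ENNReal.ofReal
        (gaussianDensity N M * radialIntegral m d (invariantRoot m N M * w)) := by
    calc _ = ∫⁻ M, ∫⁻ x in Set.Ioi (0 : ℝ), Φ M x := by
          refine lintegral_congr_ae ?_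
          filter_upwards [hne] with M hM
          exact (lintegral_scaled_gamma hd (frobeniusSq_pos hM)
            (mul_nonneg (gaussianDensity_nonneg N M) (Real.exp_pos _).le)).symm
      _ = ∫⁻ x in Set.Ioi (0 : ℝ), ∫⁻ M, Φ M x := lintegral_lintegral_swap hΦm.aemeasurable
      _ = ∫⁻ x in Set.Ioi (0 : ℝ), ∫⁻ M, Ψ M x := setLIntegral_congr_fun measurableSet_Ioi hscale
      _ = ∫⁻ M, ∫⁻ x in Set.Ioi (0 : ℝ), Ψ M x :=
          (lintegral_lintegral_swap hΨm.aemeasurable).symm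
      _ = _ := by
          refine lintegral_congr_ae ?_
          filter_upwards [hne] with M hM
          exact lintegral_inverted_radial m hd (frobeniusSq_pos hM) (gaussianDensity_nonneg N M)
            (mul_nonneg (invariantRoot_nonneg m N M) hw)
  have hmR : Measurable fun M => radialIntegral m d (invariantRoot m N M * w) :=
    (measurable_radialIntegral m d).comp ((measurable_invariantRoot m N).mul_const w)
  have hmE : Measurable fun M => Real.exp (-(w ^ m * tracePower (m + 1) N M)) :=
    Continuous.measurable (by fun_prop)
  rw [integral_eq_lintegral_of_nonneg_ae (Filter.Eventually.of_forall fun M => (Real.exp_pos _).le)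
      hmE.aestronglyMeasurable,
    integral_eq_lintegral_of_nonneg_ae
      (Filter.Eventually.of_forall fun M => radialIntegral_nonneg m d _) hmR.aestronglyMeasurable,
    gaussianMatrixMeasure_eq,
    lintegral_withDensity_eq_lintegral_mul _ hcg.measurable.ennreal_ofReal hmE.ennreal_ofReal,
    lintegral_withDensity_eq_lintegral_mul _ hcg.measurable.ennreal_ofReal hmR.ennreal_ofReal]
  simp only [Pi.mul_apply, ← ENNReal.ofReal_mul (gaussianDensity_nonneg N _)]
  rw [key]

/-- The partition function is the Gaussian average of dilated radial integrals. -/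
theorem partitionFunction_ofReal_pow {m : ℕ} (hm : 1 ≤ m) {N : ℕ} (hN : 1 ≤ N) {w : ℝ}
    (hw : 0 ≤ w) : partitionFunction (m + 1) N ((w : ℂ) ^ m) =
      ((∫ M, radialIntegral m (N ^ 2) (invariantRoot m N M * (w / N)) ∂gaussianMatrixMeasure N : ℝ)
        : ℂ) := by
  rw [← integral_exp_tracePower_eq hm hN (div_nonneg hw N.cast_nonneg), partitionFunction,
    ← integral_complex_ofReal]
  refine integral_congr_ae (Filter.Eventually.of_forall fun M => ?_)
  simp only
  rw [traceInvariant_eq, Nat.add_sub_cancel]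
  push_cast
  rw [div_pow]
  ring_nf

/-! ### The Borel transform of the partition function -/

theorem ContinuousOn.measurable_comp_of_isOpen {α : Type*} [MeasurableSpace α] {Q : ℂ → ℂ}
    {U : Set ℂ} (hQ : ContinuousOn Q U) (hU : IsOpen U) {g : α → ℂ} (hg : Measurable g)
    (hgU : ∀ x, g x ∈ U) : Measurable fun x => Q (g x) := by
  classical
  have h1 : Measurable (U.piecewise Q 0) :=
    hQ.measurable_piecewise continuousOn_const hU.measurableSet
  have h2 : (fun x => Q (g x)) = fun x => U.piecewise Q 0 (g x) := by
    funext x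
    rw [Set.piecewise_eq_of_mem _ _ _ (hgU x)]
  rw [h2]
  exact h1.comp hg

theorem div_natCast_mem_rayNhd {κ : ℝ} {N : ℕ} (hN : 1 ≤ N) {v : ℂ} (hv : v ∈ rayNhd (κ * N)) :
    v / N ∈ rayNhd κ := by
  have hN' : (0 : ℝ) < N := by exact_mod_cast hN
  obtain ⟨t, ht, hvt⟩ := mem_rayNhd.1 hv
  refine mem_rayNhd.2 ⟨t / N, by positivity, ?_⟩
  rw [dist_eq_norm] at hvt ⊢
  have e : v / N - ((t / N : ℝ) : ℂ) = (v - t) / N := by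
    push_cast
    ring
  rw [e, norm_div, Complex.norm_natCast, div_lt_iff₀ hN']
  exact hvt

/-- The Laplace integral of the dilated kernel `Q (b v)` is the radial integral at `b w`, also in
the degenerate case `b = 0`, where both sides are `1`. -/
theorem inv_mul_integral_kernel {Q : ℂ → ℂ} (hQ0 : Q 0 = 1) {m d : ℕ} (hm : 1 ≤ m) (hd : 1 ≤ d)
    (hQr : ∀ w : ℝ, 0 < w → 2 < w⁻¹ → borelIntegral Q w = radialIntegral m d w) {b w : ℝ}
    (hb : 0 ≤ b) (hw : 0 < w) (hbw : b * w < 1 / 2) :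
    (w : ℂ)⁻¹ * ∫ v in Set.Ioi (0 : ℝ), Q (b * v) * Complex.exp (-((w : ℂ)⁻¹ * v)) =
      radialIntegral m d (b * w) := by
  rcases hb.eq_or_lt with rfl | hb'
  · have h1 : radialIntegral m d 0 = 1 := by
      rw [← (integral_gamma_density hd).2, radialIntegral]
      simp [Nat.one_le_iff_ne_zero.1 hm]
    have h2 : (-(w : ℂ)⁻¹).re < 0 := by
      rw [← Complex.ofReal_inv, Complex.neg_re, Complex.ofReal_re]
      simpa using hw
    have h3 := integral_exp_mul_complex_Ioi h2 0
    have hw' : (w : ℂ) ≠ 0 := by exact_mod_cast hw.ne'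
    simp only [Complex.ofReal_zero, zero_mul, hQ0, one_mul, h1, Complex.ofReal_one, ← neg_mul]
    rw [h3]
    simp [hw']
  · have hbc : (b : ℂ) ≠ 0 := by exact_mod_cast hb'.ne'
    have hpos : 0 < b * w := by positivity
    rw [← hQr (b * w) hpos (by rw [lt_inv_comm₀ two_pos hpos]; linarith), borelIntegral, laplaceIoi]
    have h := integral_comp_mul_left_Ioi
      (fun x : ℝ => Q x * Complex.exp (-(((b * w : ℝ) : ℂ)⁻¹ * x))) 0 hb'
    rw [mul_zero] at h
    have e : ∀ v : ℝ, Q (b * v) * Complex.exp (-((w : ℂ)⁻¹ * v)) =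
        Q ((b * v : ℝ) : ℂ) * Complex.exp (-(((b * w : ℝ) : ℂ)⁻¹ * ((b * v : ℝ) : ℂ))) := by
      intro v
      push_cast
      congr 3
      field_simp
    simp_rw [e]
    rw [h, Complex.real_smul]
    push_cast
    field_simp

/-- The partition function is, for small positive `w`, the Borel integral of a kernel `H` whose
derivative is bounded by `Λ D e ^ (Λ D ‖v‖)`, with `D = N ^ (1 + 2 / m)` and `Λ` independent of `N`.
-/
theorem exists_partition_kernel {m : ℕ} (hm : 1 ≤ m) : ∃ Λ : ℝ, 0 < Λ ∧ ∀ N : ℕ, 1 ≤ N →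
    ∃ (H : ℂ → ℂ) (δ C : ℝ), 0 < δ ∧
      IsBorelKernel δ (Λ * (N : ℝ) ^ (1 + 2 / (m : ℝ))) C H ∧
      (∀ v ∈ rayNhd δ, ‖deriv H v‖ ≤ Λ * (N : ℝ) ^ (1 + 2 / (m : ℝ)) *
        Real.exp (Λ * (N : ℝ) ^ (1 + 2 / (m : ℝ)) * ‖v‖)) ∧
      ∀ w : ℝ, 0 < w → w < 1 / 4 →
        borelIntegral H w = partitionFunction (m + 1) N ((w : ℂ) ^ m) := by
  obtain ⟨κ, hκ, Λ₀, hΛ₀, hker⟩ := exists_radial_kernel m hm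
  -- enlarging the constant to at least `2` covers the exponential type of `H` itself
  refine ⟨max Λ₀ 2, by positivity, fun N hN => ?_⟩
  set Λ := max Λ₀ 2 with hΛdef
  have hΛ2 : 2 ≤ Λ := le_max_right _ _
  have hΛ : 0 < Λ := by linarith
  have hd : 1 ≤ N ^ 2 := Nat.one_le_pow _ _ hN
  obtain ⟨Q, C, hQ, hQ0, hQ'₀, hQr⟩ := hker (N ^ 2) hd
  have hQ' : ∀ x ∈ rayNhd κ, ‖deriv Q x‖ ≤ Λ * ((N ^ 2 : ℕ) : ℝ) ^ (1 + 1 / (m : ℝ)) *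
      Real.exp (Λ * ((N ^ 2 : ℕ) : ℝ) ^ (1 + 1 / (m : ℝ)) * ‖x‖) := by
    intro x hx
    refine (hQ'₀ x hx).trans ?_
    have : Λ₀ ≤ Λ := le_max_left _ _
    gcongr
  have hN' : (0 : ℝ) < N := by exact_mod_cast hN
  have hN1 : (1 : ℝ) ≤ N := by exact_mod_cast hN
  have hC := hQ.const_nonneg hκ
  have hδ : 0 < κ * N := by positivity
  have hmem : ∀ v ∈ rayNhd (κ * N), ∀ M, (invariantRoot m N M : ℂ) * (v / N) ∈ rayNhd κ :=
    fun v hv M => mul_mem_rayNhd (div_natCast_mem_rayNhd hN hv) (invariantRoot_nonneg m N M)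
      (invariantRoot_le_one hm N M)
  have hmemb : Measurable fun M => (invariantRoot m N M : ℂ) :=
    Complex.measurable_ofReal.comp (measurable_invariantRoot m N)
  have hnorm : ∀ v : ℂ, ∀ M, ‖(invariantRoot m N M : ℂ) * (v / N)‖ ≤ ‖v‖ / N := by
    intro v M
    rw [norm_mul, norm_div, Complex.norm_natCast, Complex.norm_real, Real.norm_eq_abs,
      abs_of_nonneg (invariantRoot_nonneg m N M)]
    exact mul_le_of_le_one_left (by positivity) (invariantRoot_le_one hm N M)
  have hQle : ∀ v ∈ rayNhd (κ * N), ∀ M, ‖Q (invariantRoot m N M * (v / N))‖ ≤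
      C * Real.exp (2 / N * ‖v‖) := by
    intro v hv M
    refine (hQ.norm_le _ (hmem v hv M)).trans ?_
    have := hnorm v M
    have e : 2 / (N : ℝ) * ‖v‖ = 2 * (‖v‖ / N) := by ring
    rw [e]
    gcongr
  have hdiff : ∀ M, DifferentiableOn ℂ (fun v => Q (invariantRoot m N M * (v / N)))
      (rayNhd (κ * N)) := fun M =>
    hQ.differentiableOn.comp (by fun_prop) fun v hv => hmem v hv M
  have hmeas : ∀ v ∈ rayNhd (κ * N),
      AEStronglyMeasurable (fun M => Q (invariantRoot m N M * (v / N)))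
        (gaussianMatrixMeasure N) := fun v hv =>
    (hQ.differentiableOn.continuousOn.measurable_comp_of_isOpen (isOpen_rayNhd κ)
      (hmemb.mul_const _) (hmem v hv)).aestronglyMeasurable
  set H : ℂ → ℂ := fun v => ∫ M, Q (invariantRoot m N M * (v / N)) ∂gaussianMatrixMeasure N with hH
  have hderiv : ∀ v ∈ rayNhd (κ * N), HasDerivAt H
      (∫ M, deriv (fun v => Q (invariantRoot m N M * (v / N))) v ∂gaussianMatrixMeasure N) v := by
    intro v hv
    refine hasDerivAt_integral_of_dominated (isOpen_rayNhd _) hmeas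
      (Filter.Eventually.of_forall hdiff) (fun v hv => ?_) hv
    refine ⟨1, one_pos, fun _ => C * Real.exp (2 / N * (‖v‖ + 1)), integrable_const _,
      Filter.Eventually.of_forall fun M w hw => ?_⟩
    refine (hQle w hw.2 M).trans ?_
    have h1 : ‖w‖ ≤ ‖v‖ + 1 := by
      have h2 := norm_add_le v (w - v)
      have h3 := Metric.mem_ball.1 hw.1
      rw [dist_eq_norm] at h3
      rw [add_sub_cancel] at h2
      linarith
    exact mul_le_mul_of_nonneg_left
      (Real.exp_le_exp.2 (mul_le_mul_of_nonneg_left h1 (by positivity))) hC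
  have hHker : IsBorelKernel (κ * N) (2 / N) C H := by
    refine ⟨fun v hv => (hderiv v hv).differentiableAt.differentiableWithinAt, fun v hv => ?_⟩
    refine (norm_integral_le_of_norm_le_const (Filter.Eventually.of_forall (hQle v hv))).trans ?_
    simp
  have htype : 2 / (N : ℝ) ≤ Λ * (N : ℝ) ^ (1 + 2 / (m : ℝ)) := by
    have h1 : 1 ≤ (N : ℝ) ^ (1 + 2 / (m : ℝ)) := Real.one_le_rpow hN1 (by positivity)
    have h2 : 2 / (N : ℝ) ≤ 2 := div_le_self zero_le_two hN1
    nlinarith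
  refine ⟨H, κ * N, C, hδ, ⟨hHker.1, fun v hv => (hHker.2 v hv).trans ?_⟩, fun v hv => ?_,
    fun w hw hw2 => ?_⟩
  · gcongr
  · have hD : (((N ^ 2 : ℕ) : ℝ)) ^ (1 + 1 / (m : ℝ)) = (N : ℝ) ^ (1 + 2 / (m : ℝ)) * N := by
      rw [Nat.cast_pow, ← Real.rpow_natCast, ← Real.rpow_mul hN'.le]
      nth_rewrite 3 [← Real.rpow_one (N : ℝ)]
      rw [← Real.rpow_add hN']
      congr 1
      push_cast
      ring
    rw [hD] at hQ'
    set D := (N : ℝ) ^ (1 + 2 / (m : ℝ)) with hDdef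
    have hD0 : 0 ≤ D := by positivity
    rw [(hderiv v hv).deriv]
    refine (norm_integral_le_of_norm_le_const (C := Λ * D * Real.exp (Λ * D * ‖v‖))
      (Filter.Eventually.of_forall fun M => ?_)).trans (by simp)
    set b := invariantRoot m N M with hb
    have hx := hmem v hv M
    have h1 : HasDerivAt (fun v : ℂ => (b : ℂ) * (v / N)) ((b : ℂ) * (1 / N)) v :=
      ((hasDerivAt_id v).div_const _).const_mul _
    have h2 := ((hQ.differentiableOn _ hx).differentiableAt
      ((isOpen_rayNhd κ).mem_nhds hx)).hasDerivAt.comp v h1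
    have h3 : deriv (fun v => Q (b * (v / N))) v = deriv Q (b * (v / N)) * ((b : ℂ) * (1 / N)) :=
      h2.deriv
    rw [h3, norm_mul]
    have h4 : ‖(b : ℂ) * (1 / N)‖ ≤ 1 / N := by
      rw [norm_mul, norm_div, norm_one, Complex.norm_natCast, Complex.norm_real, Real.norm_eq_abs,
        abs_of_nonneg (invariantRoot_nonneg m N M)]
      exact mul_le_of_le_one_left (by positivity) (invariantRoot_le_one hm N M)
    have h5 : Λ * (D * N) * ‖(b : ℂ) * (v / N)‖ ≤ Λ * D * ‖v‖ := by
      calc Λ * (D * N) * ‖(b : ℂ) * (v / N)‖ ≤ Λ * (D * N) * (‖v‖ / N) := by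
            gcongr
            exact hnorm v M
        _ = Λ * D * ‖v‖ := by field_simp
    calc ‖deriv Q (b * (v / N))‖ * ‖(b : ℂ) * (1 / N)‖
        ≤ (Λ * (D * N) * Real.exp (Λ * D * ‖v‖)) * (1 / N) := by
          refine mul_le_mul ((hQ' _ hx).trans ?_) h4 (norm_nonneg _) (by positivity)
          gcongr
      _ = _ := by field_simp
  · have hw0 : (w : ℂ) ≠ 0 := by exact_mod_cast hw.ne'
    rw [partitionFunction_ofReal_pow hm hN hw.le, borelIntegral, laplaceIoi]
    set f : ℝ → (Fin N → Fin N → ℂ) → ℂ := fun v M =>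
      Q (invariantRoot m N M * ((v : ℂ) / N)) * Complex.exp (-((w : ℂ)⁻¹ * v)) with hf
    have hlt : 2 / (N : ℝ) < w⁻¹ := by
      rw [lt_inv_comm₀ (by positivity) hw, inv_div]
      linarith
    -- joint integrability, for the interchange of the two integrals
    have hint : Integrable (Function.uncurry f)
        ((volume.restrict (Set.Ioi (0 : ℝ))).prod (gaussianMatrixMeasure N)) := by
      have hfst : ∀ᵐ p ∂((volume.restrict (Set.Ioi (0 : ℝ))).prod (gaussianMatrixMeasure N)),
          p.1 ∈ Set.Ioi (0 : ℝ) :=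
        Measure.quasiMeasurePreserving_fst.ae (ae_restrict_mem measurableSet_Ioi)
      have hdom : Integrable (fun p : ℝ × (Fin N → Fin N → ℂ) =>
          C * Real.exp ((2 / N - w⁻¹) * p.1))
          ((volume.restrict (Set.Ioi (0 : ℝ))).prod (gaussianMatrixMeasure N)) :=
        ((integrableOn_exp_mul_Ioi (sub_neg.2 hlt) 0).const_mul C).comp_fst _
      refine Integrable.mono' hdom ?_ ?_
      · have hm1 : Measurable fun p : ℝ × (Fin N → Fin N → ℂ) =>
            Q (invariantRoot m N p.2 * (((|p.1| : ℝ) : ℂ) / N)) := by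
          refine hQ.differentiableOn.continuousOn.measurable_comp_of_isOpen (isOpen_rayNhd κ) ?_ ?_
          · exact (hmemb.comp measurable_snd).mul
              ((Complex.measurable_ofReal.comp measurable_fst.abs).div_const _)
          · intro p
            exact hmem _ (ofReal_mem_rayNhd hδ (abs_nonneg _)) _
        have hm2 : Measurable fun p : ℝ × (Fin N → Fin N → ℂ) =>
            Complex.exp (-((w : ℂ)⁻¹ * p.1)) := by
          exact (by fun_prop : Continuous fun p : ℝ × (Fin N → Fin N → ℂ) =>
            Complex.exp (-((w : ℂ)⁻¹ * p.1))).measurable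
        refine (hm1.mul hm2).aestronglyMeasurable.congr ?_
        filter_upwards [hfst] with p hp
        have hp' : (0 : ℝ) < p.1 := hp
        simp only [hf, Function.uncurry, Pi.mul_apply, abs_of_pos hp']
      · filter_upwards [hfst] with p hp
        have hp' : (0 : ℝ) < p.1 := hp
        simp only [hf, Function.uncurry, norm_mul, Complex.norm_exp]
        have h1 := hQle p.1 (ofReal_mem_rayNhd hδ hp'.le) p.2
        rw [Complex.norm_real, Real.norm_eq_abs, abs_of_pos hp'] at h1
        have h2 : (-((w : ℂ)⁻¹ * p.1)).re = -(w⁻¹ * p.1) := by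
          rw [← Complex.ofReal_inv, ← Complex.ofReal_mul, Complex.neg_re, Complex.ofReal_re]
        rw [h2]
        calc _ ≤ C * Real.exp (2 / N * p.1) * Real.exp (-(w⁻¹ * p.1)) := by gcongr
          _ = _ := by
            rw [mul_assoc, ← Real.exp_add]
            ring_nf
    have hswap := integral_integral_swap hint
    have e1 : ∫ v in Set.Ioi (0 : ℝ), H v * Complex.exp (-((w : ℂ)⁻¹ * v)) =
        ∫ v in Set.Ioi (0 : ℝ), ∫ M, f v M ∂gaussianMatrixMeasure N := by
      refine setIntegral_congr_fun measurableSet_Ioi fun v _ => ?_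
      simp only [hf, hH]
      rw [integral_mul_const]
    rw [e1, hswap, ← integral_const_mul, ← integral_complex_ofReal]
    refine integral_congr_ae (Filter.Eventually.of_forall fun M => ?_)
    have hb0 := invariantRoot_nonneg m N M
    have hb1 := invariantRoot_le_one hm N M
    have hdiv : invariantRoot m N M / N ≤ 1 := (div_le_self hb0 hN1).trans hb1
    have h := inv_mul_integral_kernel hQ0 hm hd hQr (b := invariantRoot m N M / N)
      (div_nonneg hb0 hN'.le) hw (by nlinarith)
    simp only [hf]
    rw [show invariantRoot m N M * (w / N) = invariantRoot m N M / N * w by ring, ← h]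
    congr 1
    refine setIntegral_congr_fun measurableSet_Ioi fun v _ => ?_
    congr 2
    push_cast
    ring

/-! ### The partition function on the half-plane and its perturbative expansion -/

/-- The Taylor remainder of `e ^ (-y)` on all of `[0, ∞)`, with a constant that is not optimal. -/
theorem norm_exp_neg_sub_sum_le {y : ℝ} (hy : 0 ≤ y) (q : ℕ) :
    ‖Complex.exp (-y) - ∑ n ∈ Finset.range q, (-(y : ℂ)) ^ n / n.factorial‖ ≤
      (Real.exp 1 + (1 + q)) * y ^ q := by
  have hn : ‖(-(y : ℂ))‖ = y := by
    rw [norm_neg, Complex.norm_real, Real.norm_eq_abs, abs_of_nonneg hy]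
  rcases le_total y 1 with h | h
  · have h1 := Complex.norm_exp_sub_sum_le_norm_mul_exp (-(y : ℂ)) q
    rw [hn] at h1
    refine h1.trans ?_
    rw [mul_comm]
    have : Real.exp y ≤ Real.exp 1 + (1 + q) := by
      have := Real.exp_le_exp.2 h
      have : (0 : ℝ) ≤ q := q.cast_nonneg
      linarith
    gcongr
  · have h1 : ‖Complex.exp (-(y : ℂ))‖ ≤ 1 * y ^ q := by
      rw [Complex.norm_exp, one_mul]
      refine le_trans ?_ (one_le_pow₀ h)
      rw [Real.exp_le_one_iff]
      simpa using hy
    have h2 : ‖∑ n ∈ Finset.range q, (-(y : ℂ)) ^ n / n.factorial‖ ≤ q * y ^ q := by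
      refine (norm_sum_le _ _).trans ((Finset.sum_le_card_nsmul _ _ (y ^ q) fun n hn' => ?_).trans
        (by simp))
      rw [norm_div, norm_pow, hn, Complex.norm_natCast]
      refine (div_le_self (by positivity) ?_).trans
        (pow_le_pow_right₀ h (Finset.mem_range.1 hn').le)
      exact_mod_cast n.factorial_pos
    refine (norm_sub_le _ _).trans ((add_le_add h1 h2).trans ?_)
    have : 0 ≤ Real.exp 1 * y ^ q := by positivity
    nlinarith

/-- The perturbative series is asymptotic to the partition function. -/
theorem partitionFunction_sub_isBigO {m : ℕ} (hm : 1 ≤ m) (N q : ℕ) :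
    (fun w : ℝ => partitionFunction (m + 1) N ((w : ℂ) ^ m) -
      ∑ n ∈ Finset.range q, PowerSeries.coeff n (partitionSeries (m + 1) N) * ((w : ℂ) ^ m) ^ n)
      =O[nhdsWithin 0 (Set.Ioi 0)] fun w : ℝ => w ^ (m * q) := by
  set P := tracePower (m + 1) N with hP
  have hPi := fun n => integrable_tracePower_pow (k := m + 1) (by omega) N n
  have hPc : ∀ n, ∫ M, traceInvariant (m + 1) N M ^ n ∂gaussianMatrixMeasure N =
      ((∫ M, P M ^ n ∂gaussianMatrixMeasure N : ℝ) : ℂ) := by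
    intro n
    rw [← integral_complex_ofReal]
    refine integral_congr_ae (Filter.Eventually.of_forall fun M => ?_)
    simp only [traceInvariant_eq, hP]
    push_cast
    rfl
  refine Asymptotics.IsBigO.of_bound ((Real.exp 1 + (1 + q)) * ((N : ℝ) ^ m)⁻¹ ^ q *
    ∫ M, P M ^ q ∂gaussianMatrixMeasure N) ?_
  filter_upwards [self_mem_nhdsWithin] with w hw
  have hw' : (0 : ℝ) < w := hw
  set c : ℝ := w ^ m / (N : ℝ) ^ m with hc
  have hc0 : 0 ≤ c := by positivity
  have hcP : ∀ M, 0 ≤ c * P M := fun M => mul_nonneg hc0 (tracePower_nonneg _ _ _)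
  have e1 : partitionFunction (m + 1) N ((w : ℂ) ^ m) =
      ∫ M, Complex.exp (-((c * P M : ℝ) : ℂ)) ∂gaussianMatrixMeasure N := by
    rw [partitionFunction]
    refine integral_congr_ae (Filter.Eventually.of_forall fun M => ?_)
    simp only [traceInvariant_eq, hP, hc, Nat.add_sub_cancel]
    push_cast
    ring_nf
  have hterm : ∀ n, Integrable (fun M => (-((c * P M : ℝ) : ℂ)) ^ n / n.factorial)
      (gaussianMatrixMeasure N) := by
    intro n
    have := ((hPi n).ofReal (𝕜 := ℂ)).const_mul ((-(c : ℂ)) ^ n / n.factorial)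
    refine this.congr (Filter.Eventually.of_forall fun M => ?_)
    simp only [Complex.coe_algebraMap, ← hP]
    push_cast
    rw [neg_mul_eq_neg_mul, mul_pow]
    ring
  have e2 : ∑ n ∈ Finset.range q, PowerSeries.coeff n (partitionSeries (m + 1) N) *
      ((w : ℂ) ^ m) ^ n = ∫ M, ∑ n ∈ Finset.range q,
        (-((c * P M : ℝ) : ℂ)) ^ n / n.factorial ∂gaussianMatrixMeasure N := by
    rw [integral_finsetSum _ fun n _ => hterm n]
    refine Finset.sum_congr rfl fun n _ => ?_
    rw [partitionSeries, PowerSeries.coeff_mk, hPc, Nat.add_sub_cancel, ← integral_complex_ofReal,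
      ← integral_const_mul, ← integral_mul_const]
    refine integral_congr_ae (Filter.Eventually.of_forall fun M => ?_)
    simp only [hc]
    push_cast
    rw [neg_pow ((w : ℂ) ^ m / (N : ℂ) ^ m * (P M : ℂ)), mul_pow, div_pow]
    ring
  have hexp : Integrable (fun M => Complex.exp (-((c * P M : ℝ) : ℂ)))
      (gaussianMatrixMeasure N) := by
    refine Integrable.mono' (integrable_const (1 : ℝ)) ?_ (Filter.Eventually.of_forall fun M => ?_)
    · have := continuous_tracePower (m + 1) N
      exact Continuous.aestronglyMeasurable (by fun_prop)
    · rw [Complex.norm_exp, Real.exp_le_one_iff]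
      simpa using hcP M
  rw [e1, e2, ← integral_sub hexp (integrable_finsetSum _ fun n _ => hterm n)]
  refine (norm_integral_le_of_norm_le (((hPi q).const_mul
    ((Real.exp 1 + (1 + q)) * c ^ q))) (Filter.Eventually.of_forall fun M => ?_)).trans ?_
  · refine (norm_exp_neg_sub_sum_le (hcP M) q).trans (le_of_eq ?_)
    rw [mul_pow]
    ring
  · rw [integral_const_mul, norm_pow, Real.norm_eq_abs, abs_of_pos hw', hc, div_pow, pow_mul]
    apply le_of_eq
    ring

theorem constantCoeff_partitionSeries (k N : ℕ) :
    PowerSeries.constantCoeff (partitionSeries k N) = 1 := by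
  rw [← PowerSeries.coeff_zero_eq_constantCoeff_apply, partitionSeries, PowerSeries.coeff_mk]
  simp

theorem differentiableOn_partitionFunction (k N : ℕ) :
    DifferentiableOn ℂ (partitionFunction k N) {lam | 0 < lam.re} := by
  refine differentiableOn_integral_of_dominated (isOpen_lt continuous_const Complex.continuous_re)
    (fun lam _ => ?_) (Filter.Eventually.of_forall fun M => by fun_prop) fun lam hlam =>
      ⟨1, one_pos, fun _ => 1, integrable_const _, Filter.Eventually.of_forall fun M w hw => ?_⟩
  · have := continuous_traceInvariant k N
    exact Continuous.aestronglyMeasurable (by fun_prop)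
  · have hw' : 0 < w.re := hw.2
    rw [Complex.norm_exp, Real.exp_le_one_iff, traceInvariant_eq, neg_mul, Complex.neg_re,
      Complex.re_mul_ofReal, ← Complex.ofReal_natCast, ← Complex.ofReal_pow, Complex.div_ofReal_re]
    have := tracePower_nonneg k N M
    have : 0 ≤ w.re / (N : ℝ) ^ (k - 1) * tracePower k N M := by positivity
    linarith

theorem convex_sector {θ : ℝ} (hθ0 : 0 < θ) (hθ : θ ≤ Real.pi / 2) :
    Convex ℝ {w : ℂ | w ≠ 0 ∧ |w.arg| < θ} := by
  have hpi := Real.pi_pos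
  -- the sector is the intersection of two half-planes with the right half-plane
  have key : {w : ℂ | w ≠ 0 ∧ |w.arg| < θ} =
      {w : ℂ | 0 < w.re ∧ w.im * Real.cos θ < w.re * Real.sin θ ∧
        -(w.re * Real.sin θ) < w.im * Real.cos θ} := by
    ext w
    simp only [Set.mem_ofPred_eq]
    rcases eq_or_ne w 0 with rfl | hw
    · simp
    have hn : 0 < ‖w‖ := norm_pos_iff.2 hw
    have hre := Complex.norm_mul_cos_arg w
    have him := Complex.norm_mul_sin_arg w
    have e1 : w.re * Real.sin θ - w.im * Real.cos θ = ‖w‖ * Real.sin (θ - w.arg) := by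
      rw [← hre, ← him, Real.sin_sub]
      ring
    have e2 : w.im * Real.cos θ + w.re * Real.sin θ = ‖w‖ * Real.sin (θ + w.arg) := by
      rw [← hre, ← him, Real.sin_add]
      ring
    constructor
    · rintro ⟨-, h⟩
      obtain ⟨h1, h2⟩ := abs_lt.1 h
      have h3 : 0 < ‖w‖ * Real.sin (θ - w.arg) :=
        mul_pos hn (Real.sin_pos_of_pos_of_lt_pi (by linarith) (by linarith))
      have h4 : 0 < ‖w‖ * Real.sin (θ + w.arg) :=
        mul_pos hn (Real.sin_pos_of_pos_of_lt_pi (by linarith) (by linarith))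
      refine ⟨?_, by linarith, by linarith⟩
      rw [← hre]
      exact mul_pos hn (Real.cos_pos_of_mem_Ioo ⟨by linarith, by linarith⟩)
    · rintro ⟨h0, h1, h2⟩
      refine ⟨hw, ?_⟩
      have harg := abs_lt.1 (Complex.abs_arg_lt_pi_div_two_iff.2 (Or.inl h0))
      have h3 : 0 < Real.sin (θ - w.arg) := pos_of_mul_pos_right (by linarith) hn.le
      have h4 : 0 < Real.sin (θ + w.arg) := pos_of_mul_pos_right (by linarith) hn.le
      refine abs_lt.2 ⟨?_, ?_⟩ <;> by_contra hcon <;> push Not at hcon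
      · exact absurd h4 (Real.sin_nonpos_of_nonpos_of_neg_pi_le (by linarith) (by linarith)).not_gt
      · exact absurd h3 (Real.sin_nonpos_of_nonpos_of_neg_pi_le (by linarith) (by linarith)).not_gt
  rw [key]
  intro x hx y hy a b ha hb hab
  obtain ⟨hx0, hx1, hx2⟩ := hx
  obtain ⟨hy0, hy1, hy2⟩ := hy
  have hpos : ∀ {p q : ℝ}, 0 < p → 0 < q → 0 < a * p + b * q := by
    intro p q hp hq
    rcases ha.eq_or_lt with rfl | ha'
    · have : b = 1 := by linarith
      subst this
      simpa using hq
    · have := mul_pos ha' hp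
      have := mul_nonneg hb hq.le
      linarith
  simp only [Set.mem_ofPred_eq, Complex.add_re, Complex.add_im, Complex.real_smul,
    Complex.re_ofReal_mul, Complex.im_ofReal_mul]
  have h1 := hpos (sub_pos.2 hx1) (sub_pos.2 hy1)
  have h2 := hpos (sub_pos.2 hx2) (sub_pos.2 hy2)
  refine ⟨hpos hx0 hy0, by nlinarith, by nlinarith⟩

theorem pow_re_pos {m : ℕ} (hm : 1 ≤ m) {w : ℂ} (hw : w ≠ 0) (harg : |w.arg| < Real.pi / (2 * m)) :
    0 < (w ^ m).re := by
  have hmr : (0 : ℝ) < m := by exact_mod_cast hm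
  have h1 : w ^ m = ((‖w‖ ^ m : ℝ) : ℂ) * Complex.exp (((m * w.arg : ℝ) : ℂ) * Complex.I) := by
    conv_lhs => rw [← Complex.norm_mul_exp_arg_mul_I w]
    rw [mul_pow, ← Complex.exp_nat_mul]
    push_cast
    congr 2
    ring
  have hn : 0 < ‖w‖ := norm_pos_iff.2 hw
  rw [h1, Complex.re_ofReal_mul, Complex.exp_ofReal_mul_I_re]
  refine mul_pos (by positivity) (Real.cos_pos_of_mem_Ioo ?_)
  have h2 : |m * w.arg| < Real.pi / 2 := by
    rw [abs_mul, abs_of_pos hmr]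
    rw [lt_div_iff₀ (by positivity)] at harg
    linarith
  exact abs_lt.1 h2

/-- By the identity theorem the representation of the partition function as a Borel integral extends
from small positive `w` to the part of the disk that corresponds to `0 < Re lam`. -/
theorem extendsOnLeRoyDisk_borelIntegral {m : ℕ} (hm : 1 ≤ m) {N : ℕ} {ρ δ a C : ℝ} {H : ℂ → ℂ}
    (hH : IsBorelKernel δ a C H) (hδ : 0 < δ) (hρ : 0 < ρ) (haρ : a < ρ⁻¹) {w₀ : ℝ} (hw₀ : 0 < w₀)
    (hHw : ∀ w : ℝ, 0 < w → w < w₀ →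
      borelIntegral H w = partitionFunction (m + 1) N ((w : ℂ) ^ m)) :
    ExtendsOnLeRoyDisk m ρ (partitionFunction (m + 1) N) (borelIntegral H) := by
  have hmr : (1 : ℝ) ≤ m := by exact_mod_cast hm
  have hpi := Real.pi_pos
  set θ := Real.pi / (2 * m) with hθ
  have hθ0 : 0 < θ := by positivity
  have hθ1 : θ ≤ Real.pi / 2 := by
    rw [hθ]
    gcongr
    linarith
  set V : Set ℂ := leRoyDisk ρ ∩ {w : ℂ | w ≠ 0 ∧ |w.arg| < θ} with hV
  have hconv : Convex ℝ V := (convex_leRoyDisk hρ).inter (convex_sector hθ0 hθ1)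
  have hVnhds : ∀ w ∈ V, V ∈ nhds w := by
    intro w hw
    have hslit : w ∈ Complex.slitPlane := by
      have := Complex.abs_arg_lt_pi_div_two_iff.1 (hw.2.2.trans_le hθ1)
      exact Or.inl (this.resolve_right hw.2.1)
    have h1 : ∀ᶠ z in nhds w, |z.arg| < θ :=
      (Complex.continuousAt_arg hslit).abs.eventually_lt continuousAt_const hw.2.2
    filter_upwards [(isOpen_leRoyDisk hρ).mem_nhds hw.1, h1, isOpen_ne.mem_nhds hw.2.1]
      with z hz1 hz2 hz3 using ⟨hz1, hz3, hz2⟩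
  have hVo : IsOpen V := isOpen_iff_mem_nhds.2 hVnhds
  have hf : AnalyticOnNhd ℂ (borelIntegral H) V := by
    refine DifferentiableOn.analyticOnNhd ?_ hVo
    have hinv : DifferentiableOn ℂ (fun w : ℂ => w⁻¹) V :=
      differentiableOn_inv.mono fun w hw => hw.2.1
    exact hinv.mul ((hH.differentiableOn_laplaceIoi hδ).comp hinv
      fun w hw => haρ.trans hw.1)
  have hg : AnalyticOnNhd ℂ (fun w => partitionFunction (m + 1) N (w ^ m)) V := by
    refine DifferentiableOn.analyticOnNhd ?_ hVo
    exact (differentiableOn_partitionFunction (m + 1) N).comp (by fun_prop)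
      fun w hw => pow_re_pos hm hw.2.1 hw.2.2
  have hreal : ∀ t : ℝ, 0 < t → t < ρ → (t : ℂ) ∈ V := by
    intro t ht htρ
    refine ⟨?_, by exact_mod_cast ht.ne', ?_⟩
    · simp only [leRoyDisk, Set.mem_ofPred_eq]
      rw [← Complex.ofReal_inv, Complex.ofReal_re]
      exact (inv_lt_inv₀ hρ ht).2 htρ
    · rw [Complex.arg_ofReal_of_nonneg ht.le, abs_zero]
      exact hθ0
  set t₀ := min ρ w₀ / 2 with ht₀
  have hmin : 0 < min ρ w₀ := lt_min hρ hw₀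
  have ht₀0 : 0 < t₀ := by positivity
  have ht₀ρ : t₀ < ρ := by linarith [min_le_left ρ w₀]
  have ht₀w : t₀ < w₀ := by linarith [min_le_right ρ w₀]
  have hfreq : ∃ᶠ z in nhdsWithin (t₀ : ℂ) {(t₀ : ℂ)}ᶜ,
      borelIntegral H z = partitionFunction (m + 1) N (z ^ m) := by
    have htend : Filter.Tendsto (fun t : ℝ => (t : ℂ)) (nhdsWithin t₀ (Set.Iio t₀))
        (nhdsWithin (t₀ : ℂ) {(t₀ : ℂ)}ᶜ) := by
      refine tendsto_nhdsWithin_iff.2 ⟨?_, ?_⟩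
      · exact (Complex.continuous_ofReal.tendsto t₀).mono_left nhdsWithin_le_nhds
      · filter_upwards [self_mem_nhdsWithin] with t ht
        have ht' : t < t₀ := ht
        simpa using ht'.ne
    refine htend.frequently (Filter.Eventually.frequently ?_)
    filter_upwards [self_mem_nhdsWithin, nhdsWithin_le_nhds (Ioi_mem_nhds ht₀0)] with t ht ht0
    have ht' : t < t₀ := ht
    exact hHw t ht0 (ht'.trans ht₀w)
  have heq := hf.eqOn_of_preconnected_of_frequently_eq hg hconv.isPreconnected
    (hreal t₀ ht₀0 ht₀ρ) hfreq
  intro w hw harg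
  exact heq ⟨hw, ne_zero_of_mem_leRoyDisk hρ hw, harg⟩

/-! ### The logarithm of a Borel sum -/

/-- The convolution powers of `h` along the rays from `0`, with the constant `1` at the start:
the Laplace integral of the `n`-th one is `z⁻¹` times the `n`-th power of that of `h`. -/
noncomputable def convPow (h : ℂ → ℂ) : ℕ → ℂ → ℂ
  | 0 => fun _ => 1
  | n + 1 => fun v => v * ∫ s in Set.Ioc (0 : ℝ) 1, h (s * v) * convPow h n ((1 - s : ℝ) * v)

section convPow

variable {δ Λ : ℝ} {h : ℂ → ℂ}

/-- Every convolution gains a factor `Λ ‖v‖ / n`, from the length of the segment and the integral of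
`(1 - s) ^ n`, while the exponential growth stays that of `h`. -/
theorem differentiableOn_and_norm_convPow_le (hΛ : 0 ≤ Λ) (hh : IsBorelKernel δ Λ Λ h) (n : ℕ) :
    DifferentiableOn ℂ (convPow h n) (rayNhd δ) ∧ ∀ v ∈ rayNhd δ,
      ‖convPow h n v‖ ≤ (Λ * ‖v‖) ^ n / n.factorial * Real.exp (Λ * ‖v‖) := by
  induction n with
  | zero =>
    refine ⟨differentiableOn_const _, fun v _ => ?_⟩
    simpa [convPow] using Real.one_le_exp (mul_nonneg hΛ (norm_nonneg v))
  | succ n ih =>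
    obtain ⟨hd, hb⟩ := ih
    have hpt : ∀ v ∈ rayNhd δ, ∀ s ∈ Set.Ioc (0 : ℝ) 1,
        ‖h (s * v) * convPow h n ((1 - s : ℝ) * v)‖ ≤
          Λ * ((Λ * ‖v‖) ^ n / n.factorial * Real.exp (Λ * ‖v‖)) * (1 - s) ^ n := by
      intro v hv s hs
      have h1 := hh.2 _ (mul_mem_rayNhd hv hs.1.le hs.2)
      have h2 := hb _ (mul_mem_rayNhd hv (sub_nonneg.2 hs.2) (by linarith [hs.1]))
      rw [norm_mul, Complex.norm_real, Real.norm_eq_abs, abs_of_nonneg hs.1.le] at h1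
      rw [norm_mul, Complex.norm_real, Real.norm_eq_abs, abs_of_nonneg (sub_nonneg.2 hs.2)] at h2
      rw [norm_mul]
      refine (mul_le_mul h1 h2 (norm_nonneg _) (by positivity)).trans (le_of_eq ?_)
      have h3 : Real.exp (Λ * ‖v‖) =
          Real.exp (Λ * (s * ‖v‖)) * Real.exp (Λ * ((1 - s) * ‖v‖)) := by
        rw [← Real.exp_add]; ring_nf
      rw [h3, mul_left_comm Λ (1 - s), mul_pow]
      ring
    have hmaps1 : ∀ v ∈ rayNhd δ, Set.MapsTo (fun s : ℝ => (s : ℂ) * v) (Set.Ioc 0 1) (rayNhd δ) :=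
      fun v hv s hs => mul_mem_rayNhd hv hs.1.le hs.2
    have hmaps2 : ∀ v ∈ rayNhd δ,
        Set.MapsTo (fun s : ℝ => ((1 - s : ℝ) : ℂ) * v) (Set.Ioc 0 1) (rayNhd δ) :=
      fun v hv s hs => mul_mem_rayNhd hv (sub_nonneg.2 hs.2) (by linarith [hs.1])
    constructor
    · refine differentiableOn_id.mul (differentiableOn_integral_of_dominated (isOpen_rayNhd δ)
        (fun v hv => ?_) ?_ fun v hv => ?_)
      · refine ContinuousOn.aestronglyMeasurable (ContinuousOn.mul ?_ ?_) measurableSet_Ioc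
        · exact hh.1.continuousOn.comp (Continuous.continuousOn (by fun_prop)) (hmaps1 v hv)
        · exact hd.continuousOn.comp (Continuous.continuousOn (by fun_prop)) (hmaps2 v hv)
      · refine (ae_restrict_iff' measurableSet_Ioc).2 (Filter.Eventually.of_forall fun s hs => ?_)
        refine DifferentiableOn.mul (hh.1.comp (by fun_prop) fun v hv => hmaps1 v hv hs)
          (hd.comp (by fun_prop) fun v hv => hmaps2 v hv hs)
      · refine ⟨1, one_pos, fun s => Λ * ((Λ * (‖v‖ + 1)) ^ n / n.factorial *
          Real.exp (Λ * (‖v‖ + 1))) * (1 - s) ^ n, ?_, ?_⟩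
        · exact (Continuous.integrableOn_Ioc (by fun_prop))
        · refine (ae_restrict_iff' measurableSet_Ioc).2
            (Filter.Eventually.of_forall fun s hs w hw => (hpt w hw.2 s hs).trans ?_)
          have h1 : ‖w‖ ≤ ‖v‖ + 1 := by
            have h2 := norm_add_le v (w - v)
            have h3 : ‖w - v‖ < 1 := by simpa [dist_eq_norm] using hw.1
            rw [add_sub_cancel] at h2
            linarith
          have := sub_nonneg.2 hs.2
          beta_reduce
          gcongr
    · intro v hv
      have hint : ∫ s in Set.Ioc (0 : ℝ) 1, (1 - s) ^ n = 1 / (n + 1) := by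
        rw [← intervalIntegral.integral_of_le zero_le_one,
          intervalIntegral.integral_comp_sub_left (fun s : ℝ => s ^ n) 1]
        simp
      have h1 : ‖∫ s in Set.Ioc (0 : ℝ) 1, h (s * v) * convPow h n ((1 - s : ℝ) * v)‖ ≤
          ∫ s in Set.Ioc (0 : ℝ) 1,
            Λ * ((Λ * ‖v‖) ^ n / n.factorial * Real.exp (Λ * ‖v‖)) * (1 - s) ^ n :=
        norm_integral_le_of_norm_le (Continuous.integrableOn_Ioc (by fun_prop))
          ((ae_restrict_iff' measurableSet_Ioc).2 (Filter.Eventually.of_forall (hpt v hv)))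
      rw [integral_const_mul, hint] at h1
      rw [convPow, norm_mul]
      refine (mul_le_mul_of_nonneg_left h1 (norm_nonneg v)).trans (le_of_eq ?_)
      rw [Nat.factorial_succ]
      push_cast
      field_simp
      rw [pow_succ']

theorem isBorelKernel_convPow (hΛ : 0 ≤ Λ) (hh : IsBorelKernel δ Λ Λ h) (n : ℕ) :
    IsBorelKernel δ (2 * Λ) 1 (convPow h n) := by
  obtain ⟨h1, h2⟩ := differentiableOn_and_norm_convPow_le hΛ hh n
  refine ⟨h1, fun v hv => (h2 v hv).trans ?_⟩
  rw [one_mul, mul_assoc, two_mul, Real.exp_add]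
  gcongr
  exact Real.pow_div_factorial_le_exp _ (by positivity) n

/-- The convolution theorem for the Laplace transform. -/
theorem borelIntegral_convPow (hδ : 0 < δ) (hΛ : 0 ≤ Λ) (hh : IsBorelKernel δ Λ Λ h) {w : ℂ}
    (hw : 2 * Λ < (w⁻¹).re) (n : ℕ) :
    borelIntegral (convPow h n) w = laplaceIoi h w⁻¹ ^ n := by
  induction n with
  | zero =>
    rw [(isBorelKernel_convPow hΛ hh 0).borelIntegral_eq_add_laplaceIoi hδ (by positivity) hw]
    have h1 : deriv (convPow h 0) = fun _ => 0 := by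
      funext v
      exact deriv_const v 1
    rw [h1]
    simp [laplaceIoi, convPow]
  | succ n ih =>
    rw [pow_succ', ← ih, borelIntegral, borelIntegral, mul_left_comm]
    congr 1
    have hf := hh.integrableOn hδ (z := w⁻¹) (by linarith)
    have hg := (isBorelKernel_convPow hΛ hh n).integrableOn hδ hw
    have h1 := integral_posConvolution hf hg (ContinuousLinearMap.mul ℝ ℂ)
    rw [ContinuousLinearMap.mul_apply'] at h1
    rw [laplaceIoi, laplaceIoi, laplaceIoi, ← h1]
    refine setIntegral_congr_fun measurableSet_Ioi fun x hx => ?_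
    have hx' : (0 : ℝ) < x := hx
    have h2 : ∀ t : ℝ, (ContinuousLinearMap.mul ℝ ℂ) (h t * Complex.exp (-(w⁻¹ * t)))
        (convPow h n (x - t : ℝ) * Complex.exp (-(w⁻¹ * (x - t : ℝ)))) =
        h t * convPow h n (x - t : ℝ) * Complex.exp (-(w⁻¹ * x)) := by
      intro t
      rw [ContinuousLinearMap.mul_apply', mul_mul_mul_comm, ← Complex.exp_add]
      congr 2
      push_cast
      ring
    simp only [h2, convPow]
    rw [intervalIntegral.integral_mul_const, ← intervalIntegral.integral_of_le zero_le_one]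
    congr 1
    have h3 := intervalIntegral.smul_integral_comp_mul_right (a := 0) (b := 1)
      (fun t : ℝ => h t * convPow h n (x - t : ℝ)) x
    rw [zero_mul, one_mul] at h3
    rw [← h3, Complex.real_smul]
    congr 1
    refine intervalIntegral.integral_congr fun s _ => ?_
    simp only [Complex.ofReal_mul]
    congr 2
    push_cast
    ring

/-- The Borel kernel of the logarithm: the Mercator series in convolution powers. The term `n = 0`
vanishes, as division by `0` yields `0`. -/
noncomputable def logKernel (h : ℂ → ℂ) (v : ℂ) : ℂ :=
  ∑' n : ℕ, (-1) ^ (n + 1) / (n : ℂ) * convPow h n v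

theorem norm_neg_one_pow_div_le (n : ℕ) : ‖(-1) ^ (n + 1) / (n : ℂ)‖ ≤ 1 := by
  rcases Nat.eq_zero_or_pos n with rfl | hn
  · simp
  · rw [norm_div, norm_pow, norm_neg, norm_one, one_pow, Complex.norm_natCast]
    exact div_le_one_of_le₀ (by exact_mod_cast hn) (by positivity)

theorem norm_logKernel_term_le (hΛ : 0 ≤ Λ) (hh : IsBorelKernel δ Λ Λ h) (n : ℕ)
    {v : ℂ} (hv : v ∈ rayNhd δ) :
    ‖(-1) ^ (n + 1) / (n : ℂ) * convPow h n v‖ ≤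
      (Λ * ‖v‖) ^ n / n.factorial * Real.exp (Λ * ‖v‖) := by
  rw [norm_mul, ← one_mul (_ / _ * _)]
  exact mul_le_mul (norm_neg_one_pow_div_le n)
    ((differentiableOn_and_norm_convPow_le hΛ hh n).2 v hv)
    (norm_nonneg _) zero_le_one

theorem hasSum_pow_div_factorial_mul_exp (x : ℝ) :
    HasSum (fun n : ℕ => x ^ n / n.factorial * Real.exp x) (Real.exp (2 * x)) := by
  have h1 : HasSum (fun n : ℕ => x ^ n / n.factorial) (Real.exp x) := by
    rw [Real.exp_eq_exp_ℝ]
    exact NormedSpace.expSeries_div_hasSum_exp x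
  rw [two_mul, Real.exp_add]
  exact h1.mul_right _

theorem isBorelKernel_logKernel (hΛ : 0 ≤ Λ) (hh : IsBorelKernel δ Λ Λ h) :
    IsBorelKernel δ (2 * Λ) 1 (logKernel h) := by
  constructor
  · intro v hv
    have hopen : IsOpen (rayNhd δ ∩ Metric.ball v 1) := (isOpen_rayNhd δ).inter Metric.isOpen_ball
    have h1 : DifferentiableOn ℂ (logKernel h) (rayNhd δ ∩ Metric.ball v 1) := by
      refine Complex.differentiableOn_tsum_of_summable_norm
        (hasSum_pow_div_factorial_mul_exp (Λ * (‖v‖ + 1))).summable (fun n => ?_) hopen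
        fun n w hw => (norm_logKernel_term_le hΛ hh n hw.1).trans ?_
      · exact ((differentiableOn_and_norm_convPow_le hΛ hh n).1.mono
          Set.inter_subset_left).const_mul _
      · have h1 : ‖w‖ ≤ ‖v‖ + 1 := by
          have h2 := norm_add_le v (w - v)
          have h3 : ‖w - v‖ < 1 := by simpa [dist_eq_norm] using hw.2
          rw [add_sub_cancel] at h2
          linarith
        gcongr
    exact (h1.differentiableAt
      (hopen.mem_nhds ⟨hv, Metric.mem_ball_self one_pos⟩)).differentiableWithinAt
  · intro v hv
    have h1 := hasSum_pow_div_factorial_mul_exp (Λ * ‖v‖)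
    have h2 := tsum_of_norm_bounded h1 fun n => norm_logKernel_term_le hΛ hh n hv
    rw [one_mul, mul_assoc]
    exact h2

/-- The Borel sum of the logarithmic kernel is the logarithm of `1` plus the Laplace integral of
`h`, which is the Borel sum of a kernel with value `1` at `0` and derivative `h`. -/
theorem borelIntegral_logKernel (hδ : 0 < δ) (hΛ : 0 < Λ) (hh : IsBorelKernel δ Λ Λ h) {w : ℂ}
    (hw : 2 * Λ < (w⁻¹).re) :
    borelIntegral (logKernel h) w = Complex.log (1 + laplaceIoi h w⁻¹) := by
  have hnorm : ‖laplaceIoi h w⁻¹‖ < 1 := by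
    refine (hh.norm_laplaceIoi_le hδ (by linarith)).trans_lt ?_
    rw [div_lt_one (by linarith)]
    linarith
  have hmercator := Complex.hasSum_taylorSeries_log hnorm
  have hint : HasSum (fun n : ℕ => ∫ v in Set.Ioi (0 : ℝ),
      (-1) ^ (n + 1) / (n : ℂ) * convPow h n v * Complex.exp (-(w⁻¹ * v)))
      (laplaceIoi (logKernel h) w⁻¹) := by
    have hexp : ∀ v : ℝ, HasSum (fun n : ℕ => (Λ * v) ^ n / n.factorial * Real.exp (Λ * v) *
        Real.exp (-(w⁻¹).re * v)) (Real.exp ((2 * Λ - (w⁻¹).re) * v)) := fun v => by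
      have := (hasSum_pow_div_factorial_mul_exp (Λ * v)).mul_right (Real.exp (-(w⁻¹).re * v))
      rwa [← Real.exp_add, show 2 * (Λ * v) + -(w⁻¹).re * v = (2 * Λ - (w⁻¹).re) * v by ring]
        at this
    refine hasSum_integral_of_dominated_convergence
      (fun n v => (Λ * v) ^ n / n.factorial * Real.exp (Λ * v) * Real.exp (-(w⁻¹).re * v))
      (fun n => ?_) (fun n => ?_) (Filter.Eventually.of_forall fun v => (hexp v).summable) ?_ ?_
    · simp only [mul_assoc]
      exact ((isBorelKernel_convPow hΛ.le hh n).aestronglyMeasurable hδ w⁻¹).const_mul _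
    · refine (ae_restrict_iff' measurableSet_Ioi).2 (Filter.Eventually.of_forall fun v hv => ?_)
      have hv' : (0 : ℝ) < v := hv
      rw [norm_mul, Complex.norm_exp, Complex.neg_re, Complex.re_mul_ofReal, ← neg_mul]
      have := norm_logKernel_term_le hΛ.le hh n (ofReal_mem_rayNhd hδ hv'.le)
      rw [Complex.norm_real, Real.norm_eq_abs, abs_of_nonneg hv'.le] at this
      gcongr
    · simp only [fun v => (hexp v).tsum_eq]
      exact integrableOn_exp_mul_Ioi (by linarith) 0
    · refine (ae_restrict_iff' measurableSet_Ioi).2 (Filter.Eventually.of_forall fun v hv => ?_)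
      refine HasSum.mul_right _ (Summable.hasSum ?_)
      exact Summable.of_norm_bounded (hasSum_pow_div_factorial_mul_exp _).summable
        fun n => norm_logKernel_term_le hΛ.le hh n (ofReal_mem_rayNhd hδ (le_of_lt hv))
  refine HasSum.unique (hint.mul_left w⁻¹) ?_
  refine hmercator.congr_fun fun n => ?_
  rw [← borelIntegral_convPow hδ hΛ.le hh hw n, borelIntegral, laplaceIoi]
  simp only [mul_assoc]
  rw [integral_const_mul]
  ring

end convPow

/-! ### Asymptotic expansions and the formal logarithm -/

/-- `f` has the asymptotic expansion `A` in powers of `w ^ m` as `w → 0⁺`. -/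
def HasPowExpansion (m : ℕ) (f : ℝ → ℂ) (A : PowerSeries ℂ) : Prop :=
  ∀ q : ℕ, (fun w : ℝ => f w - (PowerSeries.trunc q A).eval ((w : ℂ) ^ m))
    =O[nhdsWithin 0 (Set.Ioi 0)] fun w : ℝ => w ^ (m * q)

theorem hasPowExpansion_iff {m : ℕ} {f : ℝ → ℂ} {A : PowerSeries ℂ} :
    HasPowExpansion m f A ↔ ∀ q : ℕ,
      (fun w : ℝ => f w - ∑ n ∈ Finset.range q, PowerSeries.coeff n A * ((w : ℂ) ^ m) ^ n)
        =O[nhdsWithin 0 (Set.Ioi 0)] fun w : ℝ => w ^ (m * q) := by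
  simp only [HasPowExpansion, Polynomial.eval, PowerSeries.eval₂_trunc_eq_sum_range,
    RingHom.id_apply]

/-- A polynomial in `w ^ m` is bounded near `0`. -/
theorem isBigO_eval_pow (m : ℕ) (P : Polynomial ℂ) :
    (fun w : ℝ => P.eval ((w : ℂ) ^ m)) =O[nhdsWithin 0 (Set.Ioi 0)] fun _ => (1 : ℝ) := by
  have h1 : Continuous fun w : ℝ => P.eval ((w : ℂ) ^ m) := by fun_prop
  exact (h1.tendsto 0).isBigO_one ℝ |>.mono nhdsWithin_le_nhds

theorem isBigO_eval_of_X_pow_dvd (m : ℕ) {q : ℕ} {P : Polynomial ℂ} (h : Polynomial.X ^ q ∣ P) :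
    (fun w : ℝ => P.eval ((w : ℂ) ^ m)) =O[nhdsWithin 0 (Set.Ioi 0)] fun w : ℝ => w ^ (m * q) := by
  obtain ⟨Q, rfl⟩ := h
  have h1 : (fun w : ℝ => ((w : ℂ) ^ m) ^ q) =O[nhdsWithin 0 (Set.Ioi 0)]
      fun w : ℝ => w ^ (m * q) :=
    Asymptotics.isBigO_of_le _ fun w => by
      rw [← pow_mul, norm_pow, norm_pow, Complex.norm_real]
  simpa using h1.mul (isBigO_eval_pow m Q)

namespace HasPowExpansion

variable {m : ℕ} {f g : ℝ → ℂ} {A B : PowerSeries ℂ}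

theorem isBigO_one (hf : HasPowExpansion m f A) :
    f =O[nhdsWithin 0 (Set.Ioi 0)] fun _ => (1 : ℝ) := by
  simpa using hf 0

theorem add (hf : HasPowExpansion m f A) (hg : HasPowExpansion m g B) :
    HasPowExpansion m (fun w => f w + g w) (A + B) := fun q =>
  ((hf q).add (hg q)).congr_left fun w => by
    rw [map_add, Polynomial.eval_add]
    ring

theorem of_const (m : ℕ) (c : ℂ) : HasPowExpansion m (fun _ => c) (PowerSeries.C c) := by
  rintro (_ | q)
  · simpa using Asymptotics.isBigO_const_one ℝ c _
  · simpa using Asymptotics.isBigO_zero _ _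

/-- Asymptotic expansions multiply like power series. -/
theorem mul (hf : HasPowExpansion m f A) (hg : HasPowExpansion m g B) :
    HasPowExpansion m (fun w => f w * g w) (A * B) := by
  intro q
  have h1 := (hf q).mul hg.isBigO_one
  have h2 := (isBigO_eval_pow m (PowerSeries.trunc q A)).mul (hg q)
  have h3 : Polynomial.X ^ q ∣ PowerSeries.trunc q A * PowerSeries.trunc q B -
      PowerSeries.trunc q (A * B) := by
    rw [Polynomial.X_pow_dvd_iff]
    intro d hd
    rw [Polynomial.coeff_sub, PowerSeries.coeff_trunc, if_pos hd,
      PowerSeries.coeff_mul_eq_coeff_trunc_mul_trunc A B hd, ← Polynomial.coe_mul,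
      Polynomial.coeff_coe, sub_self]
  simp only [mul_one, one_mul] at h1 h2
  refine ((h1.add h2).add (isBigO_eval_of_X_pow_dvd m h3)).congr_left fun w => ?_
  rw [Polynomial.eval_sub, Polynomial.eval_mul]
  ring

theorem pow (hf : HasPowExpansion m f A) (n : ℕ) :
    HasPowExpansion m (fun w => f w ^ n) (A ^ n) := by
  induction n with
  | zero => simpa using of_const m 1
  | succ n ih => simpa only [pow_succ] using ih.mul hf

theorem sum {ι : Type*} (s : Finset ι) {f : ι → ℝ → ℂ} {A : ι → PowerSeries ℂ}
    (hf : ∀ i ∈ s, HasPowExpansion m (f i) (A i)) :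
    HasPowExpansion m (fun w => ∑ i ∈ s, f i w) (∑ i ∈ s, A i) := by
  classical
  induction s using Finset.induction_on with
  | empty => simpa using of_const m 0
  | insert i s hi ih =>
    simp only [Finset.sum_insert hi]
    exact (hf i (Finset.mem_insert_self i s)).add
      (ih fun j hj => hf j (Finset.mem_insert_of_mem hj))

end HasPowExpansion

/-- The low coefficients of the formal logarithm come from a partial Mercator sum. -/
theorem trunc_logOf {A : PowerSeries ℂ} (hA : PowerSeries.constantCoeff A = 1) (q : ℕ) :
    PowerSeries.trunc q (PowerSeries.logOf A) = PowerSeries.trunc q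
      (∑ j ∈ Finset.range (q + 1), PowerSeries.C ((-1) ^ (j + 1) / (j : ℂ)) * (A - 1) ^ j) := by
  have hB : PowerSeries.constantCoeff (A - 1) = 0 := by simp [hA]
  ext e
  rw [PowerSeries.coeff_trunc, PowerSeries.coeff_trunc]
  split_ifs with he
  · rw [PowerSeries.logOf_eq, PowerSeries.coeff_subst' (.of_constantCoeff_zero' hB), map_sum]
    rw [finsum_eq_sum_of_support_subset (s := Finset.range (q + 1))]
    · refine Finset.sum_congr rfl fun j _ => ?_
      rw [PowerSeries.coeff_log, PowerSeries.coeff_C_mul, smul_eq_mul]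
      split_ifs with hj
      · simp [hj]
      · simp
    · intro j hj
      by_contra hjq
      refine hj ?_
      have h1 : PowerSeries.X ^ j ∣ (A - 1) ^ j := pow_dvd_pow_of_dvd (PowerSeries.X_dvd_iff.2 hB) j
      have h2 : e < j := by
        simp only [Finset.coe_range, Set.mem_Iio] at hjq
        omega
      simp only [PowerSeries.X_pow_dvd_iff.1 h1 e h2, smul_zero]
  · rfl

/-- The logarithm of a function is expanded by the formal logarithm of its expansion. -/
theorem HasPowExpansion.log {m : ℕ} (hm : 1 ≤ m) {f : ℝ → ℂ} {A : PowerSeries ℂ}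
    (hf : HasPowExpansion m f A) (hA : PowerSeries.constantCoeff A = 1) :
    HasPowExpansion m (fun w => Complex.log (f w)) (PowerSeries.logOf A) := by
  have hg : HasPowExpansion m (fun w => f w - 1) (A - 1) := by
    simpa [sub_eq_add_neg] using hf.add (.of_const m (-1))
  have hg1 : (fun w => f w - 1) =O[nhdsWithin 0 (Set.Ioi 0)] fun w : ℝ => w ^ m := by
    simpa [hA] using hg 1
  have hlim : Filter.Tendsto (fun w => f w - 1) (nhdsWithin 0 (Set.Ioi 0)) (nhds 0) := by
    refine hg1.trans_tendsto ?_
    have : Filter.Tendsto (fun w : ℝ => w ^ m) (nhds 0) (nhds (0 ^ m)) :=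
      (continuous_pow m).tendsto 0
    rw [zero_pow (by omega)] at this
    exact this.mono_left nhdsWithin_le_nhds
  intro q
  have hpow : (fun w : ℝ => w ^ (m * (q + 1))) =O[nhdsWithin 0 (Set.Ioi 0)]
      fun w : ℝ => w ^ (m * q) := by
    have h1 := (Asymptotics.isBigO_refl (fun w : ℝ => w ^ (m * q)) (nhdsWithin 0 (Set.Ioi 0))).mul
      (((continuous_pow (M := ℝ) m).tendsto 0).isBigO_one ℝ |>.mono nhdsWithin_le_nhds)
    simpa only [mul_one, ← pow_add, ← Nat.mul_succ] using h1
  have h1 : (fun w => Complex.log (f w) - Complex.logTaylor (q + 1) (f w - 1))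
      =O[nhdsWithin 0 (Set.Ioi 0)] fun w : ℝ => w ^ (m * q) := by
    have h2 : (fun w => Complex.log (f w) - Complex.logTaylor (q + 1) (f w - 1))
        =O[nhdsWithin 0 (Set.Ioi 0)] fun w : ℝ => (f w - 1) ^ (q + 1) := by
      refine Asymptotics.IsBigO.of_bound 2 ?_
      filter_upwards [hlim.eventually (Metric.ball_mem_nhds 0 (one_half_pos (α := ℝ)))] with w hw
      have hw' : ‖f w - 1‖ < 1 / 2 := by simpa using hw
      have h3 := Complex.norm_log_sub_logTaylor_le q (z := f w - 1) (by linarith)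
      rw [add_sub_cancel] at h3
      refine h3.trans ?_
      have h4 : (1 - ‖f w - 1‖)⁻¹ ≤ 2 := by
        rw [inv_le_comm₀ (by linarith) two_pos]
        linarith
      have h5 : (0 : ℝ) ≤ (1 - ‖f w - 1‖)⁻¹ := inv_nonneg.2 (by linarith)
      rw [norm_pow, mul_comm (2 : ℝ)]
      refine (div_le_self (by positivity) (by linarith [(q.cast_nonneg : (0 : ℝ) ≤ q)])).trans ?_
      gcongr
    refine h2.trans (((hg1.pow (q + 1)).congr_right fun w => ?_).trans hpow)
    rw [pow_mul]
  have h2 : HasPowExpansion m (fun w => Complex.logTaylor (q + 1) (f w - 1))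
      (∑ j ∈ Finset.range (q + 1), PowerSeries.C ((-1) ^ (j + 1) / (j : ℂ)) * (A - 1) ^ j) := by
    have := HasPowExpansion.sum (Finset.range (q + 1)) fun j _ =>
      (HasPowExpansion.of_const m ((-1) ^ (j + 1) / (j : ℂ))).mul (hg.pow j)
    simpa only [Complex.logTaylor, div_mul_eq_mul_div] using this
  rw [trunc_logOf hA]
  exact (h1.add (h2 q)).congr_left fun w => by ring

/-! ### Borel-Le Roy summability of the partition function and of the free energy -/

/-- The formal logarithm of the perturbative series is asymptotic to the free energy. -/
theorem freeEnergy_sub_isBigO {m : ℕ} (hm : 1 ≤ m) (N q : ℕ) :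
    (fun w : ℝ => freeEnergy (m + 1) N ((w : ℂ) ^ m) -
      ∑ n ∈ Finset.range q, PowerSeries.coeff n (freeEnergySeries (m + 1) N) * ((w : ℂ) ^ m) ^ n)
      =O[nhdsWithin 0 (Set.Ioi 0)] fun w : ℝ => w ^ (m * q) := by
  have hZ : HasPowExpansion m (fun w : ℝ => partitionFunction (m + 1) N ((w : ℂ) ^ m))
      (partitionSeries (m + 1) N) :=
    hasPowExpansion_iff.2 fun q => partitionFunction_sub_isBigO hm N q
  exact hasPowExpansion_iff.1 ((HasPowExpansion.of_const m (((N : ℂ) ^ 2)⁻¹)).mul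
    (hZ.log hm (constantCoeff_partitionSeries (m + 1) N))) q

theorem inv_shrinkingRadius (m N : ℕ) (r : ℝ) :
    (shrinkingRadius m r N)⁻¹ = r⁻¹ * (N : ℝ) ^ (1 + 2 / (m : ℝ)) := by
  rw [shrinkingRadius, mul_inv, ← Real.rpow_neg (Nat.cast_nonneg N), mul_comm]
  congr 2
  ring

theorem borelIntegral_const_mul (c : ℂ) (H : ℂ → ℂ) (w : ℂ) :
    borelIntegral (fun v => c * H v) w = c * borelIntegral H w := by
  simp only [borelIntegral, laplaceIoi, mul_assoc, integral_const_mul]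
  ring

theorem mainTheorem2 :
    ∃ K : ℝ, 0 < K ∧ ∀ k : ℕ, 2 ≤ k → ∃ r : ℝ, 0 < r ∧ ∀ N : ℕ, 1 ≤ N →
      ∃ Z F : ℂ → ℂ,
        ExtendsOnLeRoyDisk (k - 1) (shrinkingRadius (k - 1) r N) (partitionFunction k N) Z ∧
        ExtendsOnLeRoyDisk (k - 1) (shrinkingRadius (k - 1) r N) (freeEnergy k N) F ∧
        (∀ w ∈ leRoyDisk (shrinkingRadius (k - 1) r N),
          Complex.exp ((N : ℂ) ^ 2 * F w) = Z w) ∧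
        IsBorelLeRoySum (k - 1) (shrinkingRadius (k - 1) r N) (partitionSeries k N) Z ∧
        IsBorelLeRoySum (k - 1) (shrinkingRadius (k - 1) r N) (freeEnergySeries k N) F ∧
        ∀ w ∈ leRoyDisk (shrinkingRadius (k - 1) r N),
          ‖Z w‖ ≤ K ^ ((k : ℝ) ^ (3 / 2 : ℝ) * (N : ℝ) ^ 2) := by
  refine ⟨2, two_pos, fun k hk => ?_⟩
  obtain ⟨m, rfl⟩ : ∃ m, k = m + 1 := ⟨k - 1, by omega⟩
  have hm : 1 ≤ m := by omega
  rw [Nat.add_sub_cancel]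
  obtain ⟨Λ, hΛ, hkernel⟩ := exists_partition_kernel hm
  -- the disk `8 Λ D < Re w⁻¹`, `D = N ^ (1 + 2 / m)`, lies in the region `2 Λ D < Re w⁻¹` of
  -- convergence for the logarithmic kernel, with room to spare for the bound on `Z - 1`
  refine ⟨(8 * Λ)⁻¹, by positivity, fun N hN => ?_⟩
  obtain ⟨H, δ, C, hδ, hH, hH', hHw⟩ := hkernel N hN
  have hN0 : (0 : ℝ) < N := by exact_mod_cast hN
  set a : ℝ := Λ * (N : ℝ) ^ (1 + 2 / (m : ℝ)) with ha_def
  have ha : 0 < a := by positivity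
  set ρ := shrinkingRadius m (8 * Λ)⁻¹ N with hρ_def
  have hρinv : ρ⁻¹ = 8 * a := by
    rw [hρ_def, inv_shrinkingRadius, inv_inv, ha_def, mul_assoc]
  have hρ : 0 < ρ := by
    rw [← inv_pos, hρinv]
    positivity
  have haρ : a < ρ⁻¹ := by linarith
  have haρ2 : 2 * a < ρ⁻¹ := by linarith
  have hZ_exp : ∀ q : ℕ, (fun w : ℝ => borelIntegral H w - ∑ n ∈ Finset.range q,
      PowerSeries.coeff n (partitionSeries (m + 1) N) * ((w : ℂ) ^ m) ^ n)
      =O[nhdsWithin 0 (Set.Ioi 0)] fun w : ℝ => w ^ (m * q) := fun q => by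
    refine (partitionFunction_sub_isBigO hm N q).congr' ?_ Filter.EventuallyEq.rfl
    filter_upwards [Ioo_mem_nhdsGT (show (0 : ℝ) < 1 / 4 by norm_num)] with w hw
    rw [hHw w hw.1 hw.2]
  have hH0 : H 0 = 1 := by
    have h1 := hH.iteratedDeriv_zero_eq hδ ha.le hm hZ_exp 0
    rw [iteratedDeriv_zero] at h1
    rw [h1]
    simp [spreadCoeff, constantCoeff_partitionSeries]
  have hh : IsBorelKernel δ a a (deriv H) :=
    ⟨hH.1.deriv (isOpen_rayNhd δ), hH'⟩
  -- on the disk the Borel sum is `1` plus a Laplace integral of modulus at most `1 / 7`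
  have hZ_eq : ∀ w, a < (w⁻¹).re → borelIntegral H w = 1 + laplaceIoi (deriv H) w⁻¹ :=
    fun w hw => by rw [hH.borelIntegral_eq_add_laplaceIoi hδ ha.le hw, hH0]
  have hsmall : ∀ w ∈ leRoyDisk ρ, ‖laplaceIoi (deriv H) w⁻¹‖ ≤ 1 / 7 := fun w hw => by
    have hw' : ρ⁻¹ < (w⁻¹).re := hw
    refine (hh.norm_laplaceIoi_le hδ (by linarith)).trans ?_
    rw [div_le_div_iff₀ (by linarith) (by norm_num)]
    linarith
  set L : ℂ → ℂ := fun v => ((N : ℂ) ^ 2)⁻¹ * logKernel (deriv H) v with hL_def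
  have hlog := isBorelKernel_logKernel ha.le hh
  have hL : IsBorelKernel δ (2 * a) (‖((N : ℂ) ^ 2)⁻¹‖ * 1) L := by
    refine ⟨hlog.1.const_mul _, fun v hv => ?_⟩
    rw [hL_def, norm_mul, mul_assoc]
    exact mul_le_mul_of_nonneg_left (hlog.2 v hv) (norm_nonneg _)
  have hF_eq : ∀ w, 2 * a < (w⁻¹).re →
      borelIntegral L w = ((N : ℂ) ^ 2)⁻¹ * Complex.log (borelIntegral H w) := fun w hw => by
    rw [hL_def, borelIntegral_const_mul, borelIntegral_logKernel hδ ha hh hw,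
      hZ_eq w (by linarith)]
  have hF_exp : ∀ q : ℕ, (fun w : ℝ => borelIntegral L w - ∑ n ∈ Finset.range q,
      PowerSeries.coeff n (freeEnergySeries (m + 1) N) * ((w : ℂ) ^ m) ^ n)
      =O[nhdsWithin 0 (Set.Ioi 0)] fun w : ℝ => w ^ (m * q) := fun q => by
    refine (freeEnergy_sub_isBigO hm N q).congr' ?_ Filter.EventuallyEq.rfl
    filter_upwards [Ioo_mem_nhdsGT (show (0 : ℝ) < 1 / 4 by norm_num),
      eventually_lt_inv_re (2 * a)] with w hw hwa
    rw [hF_eq w hwa, hHw w hw.1 hw.2, freeEnergy]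
  have hZ_ext := extendsOnLeRoyDisk_borelIntegral hm hH hδ hρ haρ
    (show (0 : ℝ) < 1 / 4 by norm_num) hHw
  refine ⟨borelIntegral H, borelIntegral L, hZ_ext, ?_, ?_,
    hH.isBorelLeRoySum hδ ha.le hm hρ haρ hZ_exp,
    hL.isBorelLeRoySum hδ (by positivity) hm hρ haρ2 hF_exp, ?_⟩
  · intro w hw hwarg
    have hw' : ρ⁻¹ < (w⁻¹).re := hw
    rw [hF_eq w (by linarith), hZ_ext w hw hwarg, freeEnergy]
  · intro w hw
    have hw' : ρ⁻¹ < (w⁻¹).re := hw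
    have hN2 : ((N : ℂ) ^ 2) ≠ 0 := pow_ne_zero _ (by exact_mod_cast hN0.ne')
    rw [hF_eq w (by linarith), mul_inv_cancel_left₀ hN2, Complex.exp_log]
    rw [hZ_eq w (by linarith)]
    intro h0
    have h1 := hsmall w hw
    rw [← neg_eq_of_add_eq_zero_right h0, norm_neg, norm_one] at h1
    norm_num at h1
  · intro w hw
    have hw' : ρ⁻¹ < (w⁻¹).re := hw
    rw [hZ_eq w (by linarith)]
    have h1 : ‖1 + laplaceIoi (deriv H) w⁻¹‖ ≤ 2 := by
      refine (norm_add_le _ _).trans ?_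
      rw [norm_one]
      linarith [hsmall w hw]
    refine h1.trans (Real.self_le_rpow_of_one_le one_le_two ?_)
    have h2 : (1 : ℝ) ≤ ((m + 1 : ℕ) : ℝ) ^ (3 / 2 : ℝ) :=
      Real.one_le_rpow (by exact_mod_cast Nat.le_add_left 1 m) (by norm_num)
    have h3 : (1 : ℝ) ≤ (N : ℝ) ^ 2 := one_le_pow₀ (by exact_mod_cast hN)
    exact one_le_mul_of_one_le_of_one_le h2 h3
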